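/- Let $n\in\{2,3\}$ and let $M$ be a smooth $n$-manifold, possibly with boundary (Hausdorff, second countable). Hypersurface means a properly embedded (closed as a subset) smooth codimension-one submanifold transverse to the boundary. Orientations of hypersurfaces are understood as transverse orientations; if the ambient manifold is oriented these are the same as orientations, and the orientation a region induces on its boundary is the transverse one pointing out of the region. A shading of a manifold $X$ consists of an oriented hypersurface $U_r$ (red) and an unoriented hypersurface $U_b$ (blue), in general position with respect to each other and to $\partial X$, together with a checkerboard coloring: each connected component (region) of $X\setminus(U_r\cup U_b)$ is painted white or black so that at every point of $U_r\cup U_b$ outside $U_r\cap U_b$ one side is white and the other is black. The components of $U_r\setminus U_b$ and of $U_b\setminus U_r$ are the red and blue facets; the components of $U_r\cap U_b$ are the bindings. A trivalent manifold $V$ in $X$ is a closed subset of $X$ which is the disjoint union of red facets, blue facets and bindings. The facets are oriented smooth codimension-one submanifolds transverse to $\partial X$. Near a point of a binding there are smooth functions $f,g$ with linearly independent differentials (after restriction to $\partial X$ as well, if the point is in $\partial X$) such that the binding is $\{f=g=0\}$, the blue facets are $\{f=0,\ g>0\}$ and $\{f=0,\ g<0\}$, the red facet is $\{g=0,\ f>0\}$,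 and (flow condition) the red facet is oriented towards $g>0$, the first blue facet towards $f>0$ and the second towards $f<0$. For $n=2$ the flow condition says that at each vertex either both blue edges enter and the red edge leaves, or both blue edges leave and the red edge enters. For a shading $(U_r,U_b)$ let $\Gamma(U_r,U_b)$ be the trivalent manifold with bindings $U_r\cap U_b$, whose blue facets are all the blue facets, each with the orientation induced by the white region next to it, and whose red facets are those red facets whose orientation is the one induced by the white region next to them. Shadings and trivalent manifolds of $M$ restrict to $\partial M$ (sets, colors and transverse orientations are restricted); the restriction of $V$ is denoted $\partial V$. Let $V$ be a trivalent manifold in $M$, and suppose that $\partial V=\Gamma(\tilde U_r,\tilde U_b)$ for some shading $(\tilde U_r,\tilde U_b)$ of $\partial M$. Then there is a shading $(U_r,U_b)$ of $M$ that restricts to $(\tilde U_r,\tilde U_b)$ on $\partial M$ (including the orientation of the red part and the coloring) and such that $\Gamma(U_r,U_b)=V$. -/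

import Mathlib

open Set Filter
open scoped Manifold ContDiff Topology

noncomputable section

namespace TrivalentShading

section Local

variable {E H M : Type*} [NormedAddCommGroup E] [NormedSpace ℝ E] [TopologicalSpace H]
  (I : ModelWithCorners ℝ E H) [TopologicalSpace M] [ChartedSpace H M]

/-- The differential at `p` of a real-valued function. -/
def diff (f : M → ℝ) (p : M) : TangentSpace I p →L[ℝ] ℝ :=
  mfderiv I 𝓘(ℝ, ℝ) f p

/-- The vectors at `p` along which one can move in both directions without leaving the manifold
(read in the preferred chart at `p`, which is how Mathlib identifies the tangent space with `E`).
On a manifold with boundary this is the whole tangent space if `p` is an interior point,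
and the tangent space of the boundary if `p` is a boundary point. -/
def faceTangent (p : M) : Set (TangentSpace I p) :=
  {v : E | ∀ᶠ t : ℝ in 𝓝 0, extChartAt I p p + t • v ∈ range I}

/-- `f` is smooth on a neighbourhood of `p`. -/
def SmoothNear (f : M → ℝ) (p : M) : Prop :=
  ∀ᶠ q in 𝓝 p, ContMDiffAt I 𝓘(ℝ, ℝ) ∞ f q

/-- The differential of `f` does not vanish at `p`; if `p` is a boundary point, the differential
of the restriction of `f` to the boundary does not vanish at `p`. So the level set of `f` through
`p` is, near `p`, a smooth hypersurface transverse to the boundary. -/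
def RegularAt (f : M → ℝ) (p : M) : Prop :=
  ∃ v ∈ faceTangent I p, diff I f p v ≠ 0

/-- The differentials of `f` and `g` at `p` are linearly independent; if `p` is a boundary point,
those of their restrictions to the boundary are. So the level sets of `f` and `g` through `p` and
the boundary are in general position at `p`. -/
def IndependentAt (f g : M → ℝ) (p : M) : Prop :=
  ∀ a b : ℝ, (∀ v ∈ faceTangent I p, a * diff I f p v + b * diff I g p v = 0) → a = 0 ∧ b = 0

/-- The open half-space of the tangent vectors at `p` along which `f` increases. -/
def posSide (f : M → ℝ) (p : M) : Set (TangentSpace I p) :=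
  {v | 0 < diff I f p v}

/-- Near `p`, the set `U` is the zero set of the smooth function `f`, which is regular at `p`. -/
def IsLocalEquation (U : Set M) (p : M) (f : M → ℝ) : Prop :=
  SmoothNear I f p ∧ RegularAt I f p ∧ ∀ᶠ q in 𝓝 p, (q ∈ U ↔ f q = 0)

/-- `U` is a properly embedded smooth submanifold of codimension one, transverse to the
boundary. -/
def IsHypersurface (U : Set M) : Prop :=
  IsClosed U ∧ ∀ p ∈ U, ∃ f, IsLocalEquation I U p f

/-- `pos` is an orientation of the hypersurface `U`, given as a transverse orientation: a
continuous choice, for `p ∈ U`, of one of the two open half-spaces bounded by the tangent space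
of `U` at `p` (and the empty set for `p ∉ U`, so that equality of orientations is equality of
functions). In an oriented manifold these are the orientations of `U`: the half-space `pos p`
corresponds to the orientation of the tangent space of `U` which is positive when preceded by a
vector of `pos p`. -/
def IsOrientation (U : Set M) (pos : ∀ p : M, Set (TangentSpace I p)) : Prop :=
  (∀ p, p ∉ U → pos p = ∅) ∧
    ∀ p ∈ U, ∃ f, IsLocalEquation I U p f ∧ ∀ᶠ q in 𝓝 p, q ∈ U → pos q = posSide I f q

/-- The hypersurfaces `U` and `U'` are transverse (in general position together with the
boundary). -/
def AreTransverse (U U' : Set M) : Prop :=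
  ∀ p ∈ U ∩ U', ∃ f g, IsLocalEquation I U p f ∧ IsLocalEquation I U' p g ∧ IndependentAt I f g p

/-- The orientation induced by the region `W` on its boundary at `p`, by the convention of the
outward normal: the vectors at `p` that point out of `W`, where `W` is near `p` the negative side
of a function with non-zero differential at `p`. -/
def outward (W : Set M) (p : M) : Set (TangentSpace I p) :=
  {v | ∃ f : M → ℝ, SmoothNear I f p ∧ f p = 0 ∧ (∀ᶠ q in 𝓝 p, (q ∈ W ↔ f q < 0)) ∧
    v ∈ posSide I f p}

end Local

section Objects

variable {E H : Type*} [NormedAddCommGroup E] [NormedSpace ℝ E] [TopologicalSpace H]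

/-- The data of a shading: a red set with a transverse orientation, a blue set, and the union of
the regions painted white (the other regions being black). -/
structure ShadingData (I : ModelWithCorners ℝ E H) (M : Type*) [TopologicalSpace M]
    [ChartedSpace H M] where
  red : Set M
  redPos : ∀ p : M, Set (TangentSpace I p)
  blue : Set M
  white : Set M

/-- The data of a trivalent manifold: the union of the (open) blue facets, the union of the (open)
red facets, the union of the bindings, and a transverse orientation of the facets. -/
structure TrivalentData (I : ModelWithCorners ℝ E H) (M : Type*) [TopologicalSpace M]
    [ChartedSpace H M] where
  blue : Set M
  red : Set M
  binding : Set M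
  pos : ∀ p : M, Set (TangentSpace I p)

variable {I : ModelWithCorners ℝ E H} {M : Type*} [TopologicalSpace M] [ChartedSpace H M]

/-- `S` is a shading of `M`. -/
structure IsShading (S : ShadingData I M) : Prop where
  red_hypersurface : IsHypersurface I S.red
  red_orientation : IsOrientation I S.red S.redPos
  blue_hypersurface : IsHypersurface I S.blue
  transverse : AreTransverse I S.red S.blue
  /-- white points lie in the complement of the hypersurfaces -/
  white_subset : S.white ⊆ (S.red ∪ S.blue)ᶜ
  /-- every region is entirely white or entirely black -/
  white_region : ∀ p ∈ S.white, connectedComponentIn (S.red ∪ S.blue)ᶜ p ⊆ S.white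
  /-- checkerboard condition: every facet has a white and a black side -/
  checkerboard : ∀ p ∈ S.red ∪ S.blue, p ∉ S.red ∩ S.blue →
    ∃ f, IsLocalEquation I (S.red ∪ S.blue) p f ∧ ∀ᶠ q in 𝓝 p, (q ∈ S.white ↔ f q < 0)

/-- `V` is a trivalent manifold properly embedded in `M`. -/
structure IsTrivalent (V : TrivalentData I M) : Prop where
  closed : IsClosed (V.blue ∪ V.red ∪ V.binding)
  pos_eq_empty : ∀ p, p ∉ V.blue ∪ V.red → V.pos p = ∅
  /-- blue facets are oriented hypersurfaces transverse to the boundary, away from the rest -/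
  blue_facet : ∀ p ∈ V.blue, ∃ f, IsLocalEquation I V.blue p f ∧
    ∀ᶠ q in 𝓝 p, q ∉ V.red ∧ q ∉ V.binding ∧ (q ∈ V.blue → V.pos q = posSide I f q)
  /-- red facets are oriented hypersurfaces transverse to the boundary, away from the rest -/
  red_facet : ∀ p ∈ V.red, ∃ f, IsLocalEquation I V.red p f ∧
    ∀ᶠ q in 𝓝 p, q ∉ V.blue ∧ q ∉ V.binding ∧ (q ∈ V.red → V.pos q = posSide I f q)
  /-- At a binding `f = g = 0`, the two blue facets `f = 0 < g` and `f = 0 > g` together form a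
  smooth hypersurface, and the red facet `g = 0 < f` is attached to it transversally.
  Flow condition: with the red facet oriented towards `g > 0`, the blue facets are oriented
  towards `f > 0` where `g > 0` and towards `f < 0` where `g < 0`. In dimension two: either both
  blue edges enter the vertex and the red edge leaves it, or the other way around. -/
  binding_model : ∀ p ∈ V.binding, ∃ f g : M → ℝ, SmoothNear I f p ∧ SmoothNear I g p ∧
    IndependentAt I f g p ∧ ∀ᶠ q in 𝓝 p,
      (q ∈ V.binding ↔ f q = 0 ∧ g q = 0) ∧
      (q ∈ V.blue ↔ f q = 0 ∧ g q ≠ 0) ∧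
      (q ∈ V.red ↔ 0 < f q ∧ g q = 0) ∧
      (q ∈ V.red → V.pos q = posSide I g q) ∧
      (q ∈ V.blue → 0 < g q → V.pos q = posSide I f q) ∧
      (q ∈ V.blue → g q < 0 → V.pos q = posSide I (-f) q)

/-- The points of the red facets of a shading whose orientation is the one induced by the
neighbouring white region. -/
def ShadingData.keptRed (S : ShadingData I M) : Set M :=
  {p | p ∈ S.red \ S.blue ∧ S.redPos p = outward I S.white p}

/-- The trivalent manifold of a shading: the blue facets are oriented by the white regions, and a
red facet is kept if and only if it is oriented by the neighbouring white region. -/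
def ShadingData.Gamma (S : ShadingData I M) : TrivalentData I M where
  blue := S.blue \ S.red
  red := S.keptRed
  binding := S.red ∩ S.blue
  pos p := {v | p ∈ (S.blue \ S.red) ∪ S.keptRed ∧ v ∈ outward I S.white p}

variable {E' H' : Type*} [NormedAddCommGroup E'] [NormedSpace ℝ E'] [TopologicalSpace H']
  (J : ModelWithCorners ℝ E' H') {N : Type*} [TopologicalSpace N] [ChartedSpace H' N]

/-- Restriction of a shading along a map `ι : N → M` (used for the inclusion of the boundary). -/
def ShadingData.restrict (S : ShadingData I M) (ι : N → M) : ShadingData J N where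
  red := ι ⁻¹' S.red
  redPos x := {v | mfderiv J I ι x v ∈ S.redPos (ι x)}
  blue := ι ⁻¹' S.blue
  white := ι ⁻¹' S.white

/-- Restriction of a trivalent manifold along a map `ι : N → M`. For the inclusion of the boundary
of `M` this is the boundary of the trivalent manifold. -/
def TrivalentData.restrict (V : TrivalentData I M) (ι : N → M) : TrivalentData J N where
  blue := ι ⁻¹' V.blue
  red := ι ⁻¹' V.red
  binding := ι ⁻¹' V.binding
  pos x := {v | mfderiv J I ι x v ∈ V.pos (ι x)}

end Objects

end TrivalentShading

end

/-! The whole shading can be encoded in a single function `h` on `M`. White will be `h > 0`, black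
will be `h < 0`, and the zeros of `h` outside `V` will be the red facets to be added. These are
oriented towards `h > 0`, that is, into the white regions, so `Γ` discards them. The facets of `V`
must point out of the white regions, which prescribes the sign of `h` on both sides of each facet.

`IsAdaptedAt` lists what `h` must satisfy. Off `V` it is smooth. Near a facet of `V` with equation
`f`, oriented towards `f > 0`, it has the sign of `-f`. Near a binding with model `f`, `g`, it has
the sign of `-f * g` where `f ≥ 0`; the flow condition says exactly that this is right for both blue
facets and the red one. Where `f < 0` it equals a smooth function `k` whose zero set continues the
red facet through the binding. Over the boundary it has the signs and the oriented red zeros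
prescribed by the given shading. No continuity across `V` is asked for.

These are conditions on signs, or on differentials up to positive factors, so positive combinations
preserve them (`IsAdaptedAt.add_mul`) and a partition of unity glues local solutions
(`exists_isAdapted_of_local`). Local solutions are `-f` near a facet, an extension of the boundary
data off `V`, and the function built from `k` and `-f * g` near a binding. Only a binding that meets
the boundary is delicate: the red hypersurface of the boundary is given there, and its equation must
be extended with the sign of `g` kept on `f ≥ 0`. As the boundary has dimension at most two, `f` and
`g` are coordinates on it, and the boundary equation extends as a function of `f` and `g`
(`exists_red_equation`).

The zeros of the glued function off `V` are already regular near `V` and the boundary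
(`eventually_regular`). A perturbation supported elsewhere makes all of them regular
(`exists_regular_perturbation`: affine perturbations in charts and Baire's theorem). The shading is
then `TrivalentData.fill`; see `isShading_fill`, `gamma_fill` and `restrict_fill`.

Throughout, equations of the same hypersurface have to be compared, also at boundary points. This is
done by moving along paths on which several functions are monotone (`exists_increasing_paths`),
which gives `eventually_sign_eq` and `sign_eq_of_posSide_eq`, and by one-sided derivatives in inward
directions (`exists_smul_of_cone`). -/

noncomputable section

namespace TrivalentShading

/-! ### Differentials and monotone paths in charts, up to the boundary -/

section Chart

variable {E H M : Type*} [NormedAddCommGroup E] [NormedSpace ℝ E] [TopologicalSpace H]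
  {I : ModelWithCorners ℝ E H} [TopologicalSpace M] [ChartedSpace H M]

theorem eventually_chart_iff {p : M} {P : M → Prop} :
    (∀ᶠ q in 𝓝 p, P q) ↔
      ∀ᶠ x in 𝓝[range I] (extChartAt I p p), P ((extChartAt I p).symm x) := by
  conv_lhs => rw [← map_extChartAt_symm_nhdsWithin_range (I := I) p]
  rw [eventually_map]

theorem SmoothNear.contMDiffAt {f : M → ℝ} {p : M} (hf : SmoothNear I f p) :
    ContMDiffAt I 𝓘(ℝ, ℝ) ∞ f p :=
  hf.self_of_nhds

theorem SmoothNear.mdifferentiableAt {f : M → ℝ} {p : M} (hf : SmoothNear I f p) :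
    MDifferentiableAt I 𝓘(ℝ, ℝ) f p :=
  hf.contMDiffAt.mdifferentiableAt (by simp)

theorem SmoothNear.continuousAt {f : M → ℝ} {p : M} (hf : SmoothNear I f p) :
    ContinuousAt f p :=
  hf.contMDiffAt.continuousAt

theorem SmoothNear.eventually {f : M → ℝ} {p : M} (hf : SmoothNear I f p) :
    ∀ᶠ q in 𝓝 p, SmoothNear I f q :=
  eventually_eventually_nhds.2 hf

theorem SmoothNear.congr {f g : M → ℝ} {p : M} (hf : SmoothNear I f p) (h : f =ᶠ[𝓝 p] g) :
    SmoothNear I g p := by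
  filter_upwards [hf, h.eventuallyEq_nhds] with q hq h'
  exact hq.congr_of_eventuallyEq h'.symm

theorem SmoothNear.neg {f : M → ℝ} {p : M} (hf : SmoothNear I f p) : SmoothNear I (-f) p := by
  filter_upwards [hf] with q hq
  exact hq.neg

theorem SmoothNear.add {f g : M → ℝ} {p : M} (hf : SmoothNear I f p) (hg : SmoothNear I g p) :
    SmoothNear I (f + g) p := by
  filter_upwards [hf, hg] with q hq hq'
  exact hq.add hq'

theorem SmoothNear.mul {f g : M → ℝ} {p : M} (hf : SmoothNear I f p) (hg : SmoothNear I g p) :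
    SmoothNear I (f * g) p := by
  filter_upwards [hf, hg] with q hq hq'
  exact hq.mul hq'

theorem smoothNear_const {c : ℝ} {p : M} : SmoothNear I (fun _ : M => c) p :=
  Eventually.of_forall fun _ => contMDiffAt_const

variable (I) in
/-- The differential of `f` at `p`, as a linear form on the model space. -/
def chartDiff (f : M → ℝ) (p : M) : E →L[ℝ] ℝ := diff I f p

theorem hasFDerivWithinAt_chart {f : M → ℝ} {p : M} (hf : MDifferentiableAt I 𝓘(ℝ, ℝ) f p) :
    HasFDerivWithinAt (f ∘ (extChartAt I p).symm) (chartDiff I f p) (range I)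
      (extChartAt I p p) :=
  hf.hasMFDerivAt.2

theorem contDiffWithinAt_chart {f : M → ℝ} {p : M} (hf : ContMDiffAt I 𝓘(ℝ, ℝ) ∞ f p) :
    ContDiffWithinAt ℝ ∞ (f ∘ (extChartAt I p).symm) (range I) (extChartAt I p p) :=
  (contMDiffAt_iff.1 hf).2

theorem chartDiff_eq {f : M → ℝ} {p : M} {L : E →L[ℝ] ℝ}
    (hf : MDifferentiableAt I 𝓘(ℝ, ℝ) f p)
    (hL : HasFDerivWithinAt (f ∘ (extChartAt I p).symm) L (range I) (extChartAt I p p)) :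
    chartDiff I f p = L :=
  (I.uniqueDiffOn _ (by simp)).eq (hasFDerivWithinAt_chart hf) hL

theorem chartDiff_congr {f g : M → ℝ} {p : M} (h : f =ᶠ[𝓝 p] g) :
    chartDiff I f p = chartDiff I g p :=
  h.mfderiv_eq

theorem chartDiff_neg {f : M → ℝ} {p : M} : chartDiff I (-f) p = -chartDiff I f p :=
  mfderiv_neg

theorem chartDiff_add {f g : M → ℝ} {p : M} (hf : MDifferentiableAt I 𝓘(ℝ, ℝ) f p)
    (hg : MDifferentiableAt I 𝓘(ℝ, ℝ) g p) :
    chartDiff I (f + g) p = chartDiff I f p + chartDiff I g p :=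
  mfderiv_add hf hg

theorem chartDiff_mul_of_eq_zero {f g : M → ℝ} {p : M} (hf : MDifferentiableAt I 𝓘(ℝ, ℝ) f p)
    (hg : MDifferentiableAt I 𝓘(ℝ, ℝ) g p) (h0 : g p = 0) :
    chartDiff I (f * g) p = f p • chartDiff I g p := by
  refine chartDiff_eq (hf.mul hg) ?_
  have := (hasFDerivWithinAt_chart hf).mul (hasFDerivWithinAt_chart hg)
  simp only [Function.comp_apply, extChartAt_to_inv, h0, zero_smul, add_zero] at this
  exact this

/-- The estimate behind strict differentiability, within a convex set. -/
theorem exists_ball_norm_sub_le {C : Set E} (hC : Convex ℝ C) (hu : UniqueDiffOn ℝ C) {x₀ : E}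
    (hx₀ : x₀ ∈ C) {F : E → ℝ} (hF : ContDiffWithinAt ℝ ∞ F C x₀) {L : E →L[ℝ] ℝ}
    (hL : HasFDerivWithinAt F L C x₀) {η : ℝ} (hη : 0 < η) :
    ∃ r > 0, ∀ x ∈ C ∩ Metric.ball x₀ r, ∀ y ∈ C ∩ Metric.ball x₀ r,
      |F y - F x - L (y - x)| ≤ η * ‖y - x‖ := by
  have hc := hF.continuousWithinAt_fderivWithin hu (by simp) hx₀
  have h1 : ∀ᶠ x in 𝓝[C] x₀, ContDiffWithinAt ℝ 1 F C x := by
    have := (hF.of_le (m := 1) (by simp)).eventually (by simp)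
    rwa [insert_eq_of_mem hx₀] at this
  have h2 : ∀ᶠ x in 𝓝[C] x₀, ‖fderivWithin ℝ F C x - L‖ < η := by
    have h3 : Tendsto (fun x => ‖fderivWithin ℝ F C x - L‖) (𝓝[C] x₀) (𝓝 0) := by
      rw [← tendsto_iff_norm_sub_tendsto_zero, ← hL.fderivWithin (hu x₀ hx₀)]
      exact hc
    exact h3.eventually (gt_mem_nhds hη)
  obtain ⟨r, hr, h⟩ := Metric.mem_nhdsWithin_iff.1 (h1.and h2)
  refine ⟨r, hr, fun x hx y hy => ?_⟩
  have hd : ∀ z ∈ C ∩ Metric.ball x₀ r,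
      HasFDerivWithinAt F (fderivWithin ℝ F C z) (C ∩ Metric.ball x₀ r) z := fun z hz =>
    ((h ⟨hz.2, hz.1⟩).1.differentiableWithinAt (by simp)).hasFDerivWithinAt.mono inter_subset_left
  exact Convex.norm_image_sub_le_of_norm_hasFDerivWithin_le' hd
    (fun z hz => (h ⟨hz.2, hz.1⟩).2.le) (hC.inter (convex_ball _ _)) hx hy

/-- Near `p` one can move towards a common point `z`, along paths on which all the functions
`f j` increase that have positive derivative in the direction `w` of the face of `p`. -/
theorem exists_increasing_paths {J : Type*} [Finite J] {p : M} {w : E}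
    (hw : w ∈ faceTangent I p) {U : Set M} (hU : U ∈ 𝓝 p) {f : J → M → ℝ}
    (hf : ∀ j, SmoothNear I (f j) p) (hfw : ∀ j, 0 < chartDiff I (f j) p w) :
    ∃ z, ∀ᶠ q in 𝓝 p, ∃ γ : ℝ → M, ContinuousOn γ (Icc 0 1) ∧ γ 0 = q ∧ γ 1 = z ∧
      (∀ s ∈ Icc (0 : ℝ) 1, γ s ∈ U) ∧ ∀ s ∈ Ioc (0 : ℝ) 1, ∀ j, f j q < f j (γ s) := by
  set φ := extChartAt I p
  set x₀ : E := φ p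
  have hC : Convex ℝ (range I) := I.convex_range
  have hx₀ : x₀ ∈ range I := by simp [x₀, φ]
  -- With this constant the error along `δ • w` is less than half of the linear gain `δ * chartDiff
  -- I (f j) p w`.
  have hball : ∀ j, ∃ r > 0, ∀ x ∈ range I ∩ Metric.ball x₀ r, ∀ y ∈ range I ∩ Metric.ball x₀ r,
      |(f j ∘ φ.symm) y - (f j ∘ φ.symm) x - chartDiff I (f j) p (y - x)| ≤
        (chartDiff I (f j) p w / (2 * (‖w‖ + 1))) * ‖y - x‖ := fun j =>
    exists_ball_norm_sub_le hC I.uniqueDiffOn hx₀ (contDiffWithinAt_chart (hf j).contMDiffAt)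
      (hasFDerivWithinAt_chart (hf j).mdifferentiableAt)
      (div_pos (hfw j) (by positivity))
  choose r hr hball using hball
  have hUt : ∀ᶠ x in 𝓝[range I] x₀, φ.symm x ∈ U ∧ x ∈ φ.target :=
    (eventually_chart_iff.1 hU).and (extChartAt_target_mem_nhdsWithin p)
  obtain ⟨r', hr', hUt⟩ := Metric.mem_nhdsWithin_iff.1 hUt
  obtain ⟨R, hR, hRr, hRj⟩ : ∃ R > 0, R ≤ r' ∧ ∀ j, R ≤ r j := by
    cases nonempty_fintype J
    by_cases hJ : Nonempty J
    · refine ⟨min r' (Finset.univ.inf' Finset.univ_nonempty r), ?_, min_le_left _ _, fun j =>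
        (min_le_right _ _).trans (Finset.inf'_le _ (Finset.mem_univ j))⟩
      simp [hr', hr]
    · exact ⟨r', hr', le_rfl, fun j => (hJ ⟨j⟩).elim⟩
  -- the common endpoint
  obtain ⟨δ, hδ, hzC, hzR⟩ : ∃ δ > (0 : ℝ), x₀ + δ • w ∈ range I ∧
      x₀ + δ • w ∈ Metric.ball x₀ R := by
    have h1 : ∀ᶠ t : ℝ in 𝓝 0, x₀ + t • w ∈ range I := hw
    have h2 : ∀ᶠ t : ℝ in 𝓝 0, x₀ + t • w ∈ Metric.ball x₀ R := by
      have : Tendsto (fun t : ℝ => x₀ + t • w) (𝓝 0) (𝓝 (x₀ + (0 : ℝ) • w)) :=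
        (by fun_prop : Continuous fun t : ℝ => x₀ + t • w).tendsto 0
      rw [zero_smul, add_zero] at this
      exact this (Metric.ball_mem_nhds _ hR)
    have h3 := ((h1.and h2).filter_mono (nhdsWithin_le_nhds (s := Ioi 0))).and
      (self_mem_nhdsWithin : ∀ᶠ t : ℝ in 𝓝[>] 0, t ∈ Ioi (0 : ℝ))
    obtain ⟨δ, ⟨ha, hb⟩, hc⟩ := h3.exists
    exact ⟨δ, hc, ha, hb⟩
  set z := x₀ + δ • w
  refine ⟨φ.symm z, ?_⟩
  have hsrc : ∀ᶠ q in 𝓝 p, q ∈ φ.source := extChartAt_source_mem_nhds p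
  have hφ : Tendsto φ (𝓝 p) (𝓝 x₀) := continuousAt_extChartAt p
  have hnear : ∀ᶠ q in 𝓝 p, φ q ∈ Metric.ball x₀ R := hφ (Metric.ball_mem_nhds _ hR)
  -- At `q = p` the segment is `δ • w` and the inequality is strict; it persists for nearby starting
  -- points by continuity.
  have hpos : ∀ᶠ q in 𝓝 p, ∀ j, 0 < chartDiff I (f j) p (z - φ q) -
      (chartDiff I (f j) p w / (2 * (‖w‖ + 1))) * ‖z - φ q‖ := by
    rw [eventually_all]
    intro j
    have hcont : Continuous fun x : E => chartDiff I (f j) p (z - x) -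
      (chartDiff I (f j) p w / (2 * (‖w‖ + 1))) * ‖z - x‖ := by fun_prop
    have h1 := (hcont.tendsto x₀).comp hφ
    refine h1.eventually (lt_mem_nhds ?_)
    have e1 : z - x₀ = δ • w := by simp [z]
    rw [e1, map_smul, norm_smul, Real.norm_of_nonneg hδ.le, smul_eq_mul]
    have h2 : chartDiff I (f j) p w / (2 * (‖w‖ + 1)) * ‖w‖ < chartDiff I (f j) p w := by
      rw [div_mul_eq_mul_div, div_lt_iff₀ (by positivity)]
      nlinarith [hfw j, norm_nonneg w]
    have h3 := mul_lt_mul_of_pos_left h2 hδ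
    linarith
  filter_upwards [hsrc, hnear, hpos] with q hq hqR hqpos
  have hqC : φ q ∈ range I := extChartAt_target_subset_range p (φ.map_source hq)
  have hseg : ∀ s ∈ Icc (0 : ℝ) 1, φ q + s • (z - φ q) ∈ range I ∩ Metric.ball x₀ R := fun s hs =>
    (hC.inter (convex_ball _ _)).add_smul_sub_mem ⟨hqC, hqR⟩ ⟨hzC, hzR⟩ hs
  have hsegU : ∀ s ∈ Icc (0 : ℝ) 1, φ.symm (φ q + s • (z - φ q)) ∈ U ∧
      φ q + s • (z - φ q) ∈ φ.target := fun s hs =>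
    hUt ⟨Metric.ball_subset_ball hRr (hseg s hs).2, (hseg s hs).1⟩
  refine ⟨fun s => φ.symm (φ q + s • (z - φ q)), ?_, ?_, ?_, fun s hs => (hsegU s hs).1, ?_⟩
  · exact (continuousOn_extChartAt_symm p).comp
      (by fun_prop : Continuous fun s : ℝ => φ q + s • (z - φ q)).continuousOn
      fun s hs => (hsegU s hs).2
  · simp [φ.left_inv hq]
  · simp
  · intro s hs j
    have hs' : s ∈ Icc (0 : ℝ) 1 := ⟨hs.1.le, hs.2⟩
    have h := hball j (φ q) ⟨hqC, Metric.ball_subset_ball (hRj j) hqR⟩ (φ q + s • (z - φ q))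
      ⟨(hseg s hs').1, Metric.ball_subset_ball (hRj j) (hseg s hs').2⟩
    simp only [Function.comp_apply, add_sub_cancel_left, map_smul, norm_smul,
      Real.norm_of_nonneg hs.1.le, smul_eq_mul, φ.left_inv hq] at h
    have h1 := (abs_le.1 h).1
    have h2 := mul_pos hs.1 (hqpos j)
    change f j q < f j (φ.symm (φ q + s • (z - φ q)))
    linarith

/-- The faces of the range of the model are flat: velocities of curves are tangent to the face,
and nearby faces are at least as large. -/
class FlatFaces (I : ModelWithCorners ℝ E H) : Prop where
  deriv_mem : ∀ {c : ℝ → E} {w : E}, (∀ᶠ t in 𝓝 0, c t ∈ range I) → HasDerivAt c w 0 →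
    ∀ᶠ t : ℝ in 𝓝 0, c 0 + t • w ∈ range I
  eventually_mem : ∀ {x v : E}, x ∈ range I → (∀ᶠ t : ℝ in 𝓝 0, x + t • v ∈ range I) →
    ∀ᶠ y in 𝓝[range I] x, ∀ᶠ t : ℝ in 𝓝 0, y + t • v ∈ range I

instance [I.Boundaryless] : FlatFaces I where
  deriv_mem := by simp [I.range_eq_univ]
  eventually_mem := by simp [I.range_eq_univ]

theorem eventually_pos_coord {n : ℕ} {y : EuclideanSpace ℝ (Fin n)} {i : Fin n} (h : 0 < y i) :
    ∀ᶠ z in 𝓝 y, 0 < z i :=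
  (by fun_prop : Continuous fun z : EuclideanSpace ℝ (Fin n) => z i).continuousAt.eventually
    (lt_mem_nhds h)

/-- Along a curve in the half-space through a boundary point the first coordinate has a minimum
there, so its derivative vanishes. Where the first coordinate is positive, nothing is constrained.
-/
instance {n : ℕ} [NeZero n] : FlatFaces (𝓡∂ n) where
  deriv_mem := by
    intro c w hc hw
    rw [range_modelWithCornersEuclideanHalfSpace] at *
    have h0 : 0 ≤ c 0 0 := hc.self_of_nhds
    rcases h0.eq_or_lt with h0 | h0
    · have hmin : IsLocalMin (fun t => c t 0) 0 := by
        filter_upwards [hc] with t ht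
        rw [← h0]
        exact ht
      have hd : HasDerivAt (fun t => c t 0) (w 0) 0 := by
        exact (EuclideanSpace.proj (𝕜 := ℝ) (0 : Fin n)).hasFDerivAt.comp_hasDerivAt (0 : ℝ) hw
      have := hmin.hasDerivAt_eq_zero hd
      refine Eventually.of_forall fun t => ?_
      simp [this, ← h0]
    · have hcont : ContinuousAt (fun t : ℝ => c 0 + t • w) 0 := by fun_prop
      have := hcont.eventually (p := fun z => 0 < z 0)
        (eventually_pos_coord (by simpa using h0))
      exact this.mono fun t ht => ht.le
  eventually_mem := by
    intro x v hx hv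
    rw [range_modelWithCornersEuclideanHalfSpace] at *
    have h0 : 0 ≤ x 0 := hx
    rcases h0.eq_or_lt with h0 | h0
    · have hv0 : v 0 = 0 := by
        by_contra hne
        have hmin : IsLocalMin (fun t : ℝ => t * v 0) 0 := by
          filter_upwards [hv] with t ht
          simpa [← h0] using ht
        have := hmin.hasDerivAt_eq_zero ((hasDerivAt_id (0 : ℝ)).mul_const (v 0))
        simp at this
        exact hne this
      filter_upwards [self_mem_nhdsWithin] with y hy
      exact Eventually.of_forall fun t => by simpa [hv0] using hy
    · filter_upwards [(eventually_pos_coord h0).filter_mono nhdsWithin_le_nhds] with y hy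
      have hcont : ContinuousAt (fun t : ℝ => y + t • v) 0 := by fun_prop
      have := hcont.eventually (p := fun z => 0 < z 0)
        (eventually_pos_coord (by simpa using hy))
      exact this.mono fun t ht => ht.le

variable [IsManifold I ∞ M]

theorem hasFDerivWithinAt_coord_change {p q : M} (hq : q ∈ (extChartAt I p).source) :
    HasFDerivWithinAt (extChartAt I q ∘ (extChartAt I p).symm)
      (fderivWithin ℝ (extChartAt I q ∘ (extChartAt I p).symm) (range I) (extChartAt I p q))
      (range I) (extChartAt I p q) := by
  refine DifferentiableWithinAt.hasFDerivWithinAt ?_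
  refine (contDiffWithinAt_ext_coord_change (n := ∞) q p ?_).differentiableWithinAt (by simp)
  rw [PartialEquiv.trans_source]
  refine ⟨(extChartAt I p).map_source hq, ?_⟩
  change (extChartAt I p).symm _ ∈ (extChartAt I q).source
  rw [(extChartAt I p).left_inv hq]
  exact mem_extChartAt_source q

theorem hasFDerivWithinAt_chart_of_mem {f : M → ℝ} {p q : M} (hq : q ∈ (extChartAt I p).source)
    (hf : MDifferentiableAt I 𝓘(ℝ, ℝ) f q) :
    HasFDerivWithinAt (f ∘ (extChartAt I p).symm) (chartDiff I f q ∘L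
      fderivWithin ℝ (extChartAt I q ∘ (extChartAt I p).symm) (range I) (extChartAt I p q))
      (range I) (extChartAt I p q) := by
  have hinv := (extChartAt I p).left_inv hq
  have h1 : HasFDerivWithinAt (f ∘ (extChartAt I q).symm) (chartDiff I f q) (range I)
      ((extChartAt I q ∘ (extChartAt I p).symm) (extChartAt I p q)) := by
    rw [Function.comp_apply, hinv]
    exact hasFDerivWithinAt_chart hf
  have h2 := h1.comp (extChartAt I p q) (hasFDerivWithinAt_coord_change hq)
    (fun x _ => by simp)
  refine h2.congr_of_eventuallyEq ?_ ?_
  · have hcont : ContinuousAt (extChartAt I p).symm (extChartAt I p q) :=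
      continuousAt_extChartAt_symm' hq
    have := hcont.eventually (p := fun z => z ∈ (extChartAt I q).source)
      (by rw [hinv]; exact extChartAt_source_mem_nhds q)
    filter_upwards [this.filter_mono nhdsWithin_le_nhds] with x hx
    simp only [Function.comp_apply, (extChartAt I q).left_inv hx]
  · simp only [Function.comp_apply, hinv]
    rw [(extChartAt I q).left_inv (mem_extChartAt_source q)]

/-- A tangent vector at `p` extends to a vector field `X` along which differentials vary
continuously and which is tangent to the faces if it is so at `p`. -/
theorem exists_vector_field [FlatFaces I] (p : M) (v : E) :
    ∃ X : M → E, (v ∈ faceTangent I p → ∀ᶠ q in 𝓝 p, X q ∈ faceTangent I q) ∧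
      ∀ f : M → ℝ, SmoothNear I f p →
        Tendsto (fun q => chartDiff I f q (X q)) (𝓝 p) (𝓝 (chartDiff I f p v)) := by
  have hsrc : ∀ᶠ q in 𝓝 p, q ∈ (extChartAt I p).source := extChartAt_source_mem_nhds p
  have hφ : Tendsto (extChartAt I p) (𝓝 p) (𝓝[range I] (extChartAt I p p)) :=
    (map_extChartAt_nhds p).le
  -- `X` is the constant field `v` of the chart at `p`, rewritten at each `q` in the preferred chart
  -- of `q`, which is the one used by `chartDiff I f q`. Pairing it with `chartDiff I f q` gives the
  -- derivative of `f` in the fixed chart at `p`, which is continuous.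
  refine ⟨fun q => fderivWithin ℝ (extChartAt I q ∘ (extChartAt I p).symm) (range I)
    (extChartAt I p q) v, fun hv => ?_, fun f hf => ?_⟩
  · have := hφ.eventually (FlatFaces.eventually_mem (by simp) hv)
    filter_upwards [hsrc, this] with q hq hqv
    have hline : HasDerivWithinAt (fun t : ℝ => extChartAt I p q + t • v) v
        {t | extChartAt I p q + t • v ∈ range I} 0 := by
      have : HasDerivAt (fun t : ℝ => extChartAt I p q + t • v) v 0 := by
        simpa using ((hasDerivAt_id (0 : ℝ)).smul_const v).const_add (extChartAt I p q)
      exact this.hasDerivWithinAt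
    have h1 := (hasFDerivWithinAt_coord_change hq).comp_hasDerivWithinAt_of_eq (0 : ℝ) hline
      (fun t ht => ht) (by simp)
    have h2 := FlatFaces.deriv_mem (I := I) (Eventually.of_forall fun t => by simp)
      (h1.hasDerivAt hqv)
    simp only [Function.comp_apply, zero_smul, add_zero, (extChartAt I p).left_inv hq] at h2
    exact h2
  · have hc := (contDiffWithinAt_chart hf.contMDiffAt).continuousWithinAt_fderivWithin
      I.uniqueDiffOn (by simp) (by simp)
    have h1 : Tendsto (fun q => fderivWithin ℝ (f ∘ (extChartAt I p).symm) (range I)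
        (extChartAt I p q) v) (𝓝 p) (𝓝 (chartDiff I f p v)) := by
      rw [← (hasFDerivWithinAt_chart hf.mdifferentiableAt).fderivWithin
        (I.uniqueDiffOn _ (by simp))]
      exact ((ContinuousLinearMap.apply ℝ ℝ v).continuous.tendsto _).comp (hc.tendsto.comp hφ)
    refine h1.congr' ?_
    filter_upwards [hsrc, hf.eventually] with q hq hfq
    rw [(hasFDerivWithinAt_chart_of_mem hq hfq.mdifferentiableAt).fderivWithin
      (I.uniqueDiffOn _ (by simp))]
    rfl

theorem RegularAt.eventually [FlatFaces I] {f : M → ℝ} {p : M} (hf : SmoothNear I f p)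
    (h : RegularAt I f p) : ∀ᶠ q in 𝓝 p, RegularAt I f q := by
  obtain ⟨v, hv, hfv⟩ := h
  obtain ⟨X, hX, hXf⟩ := exists_vector_field (I := I) p v
  filter_upwards [hX hv, (hXf f hf).eventually (isOpen_ne.mem_nhds hfv)] with q h1 h2
  exact ⟨X q, h1, h2⟩

theorem eventually_chartDiff_ne_zero [FlatFaces I] {f : M → ℝ} {p : M} (hf : SmoothNear I f p)
    (h : chartDiff I f p ≠ 0) : ∀ᶠ q in 𝓝 p, chartDiff I f q ≠ 0 := by
  obtain ⟨v, hv⟩ : ∃ v, chartDiff I f p v ≠ 0 := by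
    by_contra! h'
    exact h (ContinuousLinearMap.ext h')
  obtain ⟨X, hX, hXf⟩ := exists_vector_field (I := I) p v
  filter_upwards [(hXf f hf).eventually (isOpen_ne.mem_nhds hv)] with q h2 h3
  simp [h3] at h2

end Chart

/-! ### Faces as subspaces and independence of differentials on them -/

section Faces

variable {E H M : Type*} [NormedAddCommGroup E] [NormedSpace ℝ E] [TopologicalSpace H]
  {I : ModelWithCorners ℝ E H} [TopologicalSpace M] [ChartedSpace H M]

variable (I) in
/-- `faceTangent` as a submodule of the model space. -/
def faceSubmodule (p : M) : Submodule ℝ E where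
  carrier := faceTangent I p
  zero_mem' := Eventually.of_forall fun t => by simp
  smul_mem' := by
    intro c v hv
    have : Tendsto (fun t : ℝ => t * c) (𝓝 0) (𝓝 0) := by
      simpa using (tendsto_id (x := 𝓝 (0 : ℝ))).mul_const c
    have := this.eventually hv
    filter_upwards [this] with t ht
    simpa [mul_smul] using ht
  add_mem' := by
    intro v w hv hw
    have : Tendsto (fun t : ℝ => 2 * t) (𝓝 0) (𝓝 0) := by
      simpa using (tendsto_id (x := 𝓝 (0 : ℝ))).const_mul 2
    have h1 := this.eventually hv
    have h2 := this.eventually hw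
    filter_upwards [h1, h2] with t h1 h2
    have := I.convex_range h1 h2 (by norm_num : (0 : ℝ) ≤ 1 / 2) (by norm_num : (0 : ℝ) ≤ 1 / 2)
      (by norm_num)
    convert this using 1
    module

theorem mem_faceSubmodule {p : M} {v : E} : v ∈ faceSubmodule I p ↔ v ∈ faceTangent I p := Iff.rfl

theorem independentAt_of_det {f g : M → ℝ} {p : M} {u v : E} (hu : u ∈ faceSubmodule I p)
    (hv : v ∈ faceSubmodule I p)
    (h : chartDiff I f p u * chartDiff I g p v - chartDiff I f p v * chartDiff I g p u ≠ 0) :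
    IndependentAt I f g p := by
  intro a b hab
  have h1 : a * chartDiff I f p u + b * chartDiff I g p u = 0 := hab u hu
  have h2 : a * chartDiff I f p v + b * chartDiff I g p v = 0 := hab v hv
  constructor
  · refine (mul_eq_zero.1 ?_).resolve_right h
    linear_combination chartDiff I g p v * h1 - chartDiff I g p u * h2
  · refine (mul_eq_zero.1 ?_).resolve_right h
    linear_combination -chartDiff I f p v * h1 + chartDiff I f p u * h2

/-- If the pair of differentials did not map the face onto `ℝ × ℝ`, a nonzero linear form killing
the image would be a linear relation between them. -/
theorem IndependentAt.exists_dual {f g : M → ℝ} {p : M} (h : IndependentAt I f g p) :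
    ∃ u ∈ faceSubmodule I p, ∃ v ∈ faceSubmodule I p, chartDiff I f p u = 1 ∧
      chartDiff I g p u = 0 ∧ chartDiff I f p v = 0 ∧ chartDiff I g p v = 1 := by
  set L : E →ₗ[ℝ] ℝ × ℝ := (chartDiff I f p : E →ₗ[ℝ] ℝ).prod (chartDiff I g p : E →ₗ[ℝ] ℝ)
  have htop : (faceSubmodule I p).map L = ⊤ := by
    by_contra hne
    obtain ⟨ℓ, hℓ, hle⟩ := Submodule.exists_le_ker_of_lt_top _ (lt_top_iff_ne_top.2 hne)
    have key : ∀ x y : ℝ, ℓ (x, y) = ℓ (1, 0) * x + ℓ (0, 1) * y := by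
      intro x y
      have : ((x, y) : ℝ × ℝ) = x • (1, 0) + y • (0, 1) := by simp
      rw [this, map_add, map_smul, map_smul]
      simp [mul_comm]
    obtain ⟨ha, hb⟩ := h (ℓ (1, 0)) (ℓ (0, 1)) fun v hv => by
      have := hle (Submodule.mem_map_of_mem (f := L) hv)
      rw [LinearMap.mem_ker] at this
      exact (key _ _).symm.trans this
    apply hℓ
    ext <;> simp [ha, hb]
  obtain ⟨u, hu, hu'⟩ : ((1, 0) : ℝ × ℝ) ∈ (faceSubmodule I p).map L := htop ▸ trivial
  obtain ⟨v, hv, hv'⟩ : ((0, 1) : ℝ × ℝ) ∈ (faceSubmodule I p).map L := htop ▸ trivial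
  exact ⟨u, hu, v, hv, congrArg Prod.fst hu', congrArg Prod.snd hu', congrArg Prod.fst hv',
    congrArg Prod.snd hv'⟩

theorem IndependentAt.regularAt_left {f g : M → ℝ} {p : M} (h : IndependentAt I f g p) :
    RegularAt I f p := by
  obtain ⟨u, hu, v, hv, h1, -⟩ := h.exists_dual
  exact ⟨u, hu, by change chartDiff I f p u ≠ 0; simp [h1]⟩

theorem IndependentAt.symm {f g : M → ℝ} {p : M} (h : IndependentAt I f g p) :
    IndependentAt I g f p := fun a b hab =>
  (h b a fun v hv => by rw [add_comm]; exact hab v hv).symm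

/-- Extend the dual vectors to fields tangent to the faces: the determinant of the two differentials
on these fields tends to `1`. -/
theorem IndependentAt.eventually [IsManifold I ∞ M] [FlatFaces I] {f g : M → ℝ} {p : M}
    (hf : SmoothNear I f p) (hg : SmoothNear I g p) (h : IndependentAt I f g p) :
    ∀ᶠ q in 𝓝 p, IndependentAt I f g q := by
  obtain ⟨u, hu, v, hv, h1, h2, h3, h4⟩ := h.exists_dual
  obtain ⟨X, hX, hXf⟩ := exists_vector_field (I := I) p u
  obtain ⟨Y, hY, hYf⟩ := exists_vector_field (I := I) p v
  have := ((hXf f hf).mul (hYf g hg)).sub ((hYf f hf).mul (hXf g hg))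
  rw [h1, h2, h3, h4] at this
  filter_upwards [hX hu, hY hv, this.eventually (isOpen_ne.mem_nhds (by norm_num : _ ≠ (0 : ℝ)))]
    with q hq1 hq2 hq3
  exact independentAt_of_det hq1 hq2 hq3

end Faces

/-! ### Comparing the signs and differentials of two equations -/

section Comparison

variable {E H M : Type*} [NormedAddCommGroup E] [NormedSpace ℝ E] [TopologicalSpace H]
  {I : ModelWithCorners ℝ E H} [TopologicalSpace M] [ChartedSpace H M]

/-- Follow a path from `q` in the direction `w`: `k` grows while `g` and `g'` decrease, and `g` ends
negative. The path meets `g = 0` at a point with `k > 0`, where `g'` vanishes, so `g'` was positive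
at `q`. -/
theorem eventually_pos_of_vanishing {k g g' : M → ℝ} {p : M} {w : E}
    (hk : SmoothNear I k p) (hg : SmoothNear I g p) (hg' : SmoothNear I g' p) (hgp : g p = 0)
    (hw : w ∈ faceSubmodule I p) (hkw : 0 < chartDiff I k p w) (hgw : chartDiff I g p w < 0)
    (hgw' : chartDiff I g' p w < 0) (h : ∀ᶠ q in 𝓝 p, 0 < k q → g q = 0 → g' q = 0) :
    ∀ᶠ q in 𝓝 p, 0 ≤ k q → 0 < g q → 0 < g' q := by
  have hU := h.and hg.eventually
  obtain ⟨z, hz⟩ := exists_increasing_paths hw hU (f := ![k, -g, -g'])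
    (by intro j; fin_cases j; exacts [hk, hg.neg, hg'.neg])
    (by intro j; fin_cases j <;> simp [chartDiff_neg, hkw, hgw, hgw'])
  obtain ⟨γ, -, -, hγ, -, hinc⟩ := hz.self_of_nhds
  have hgz : g z < 0 := by simpa [hγ, hgp] using hinc 1 (by simp) 1
  filter_upwards [hz] with q ⟨γ, hc, h0, h1, hγU, hinc⟩ hkq hgq
  have hcont : ContinuousOn (g ∘ γ) (Icc 0 1) := fun s hs =>
    (hγU s hs).2.continuousAt.comp_continuousWithinAt (hc s hs)
  have hmem : (0 : ℝ) ∈ Icc ((g ∘ γ) 1) ((g ∘ γ) 0) := by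
    simp [h0, h1, hgz.le, hgq.le]
  obtain ⟨s, hs, hs0⟩ := intermediate_value_Icc' zero_le_one hcont hmem
  have hs' : s ∈ Ioc (0 : ℝ) 1 := by
    refine ⟨hs.1.lt_of_ne ?_, hs.2⟩
    rintro rfl
    simp only [Function.comp_apply, h0] at hs0
    exact hgq.ne' hs0
  have h3 := hinc s hs' 0
  have h4 := hinc s hs' 2
  simp only [Matrix.cons_val, Pi.neg_apply] at h3 h4
  have h5 := (hγU s hs).1 (hkq.trans_lt h3) hs0
  linarith

/-- Two functions vanishing on the same hypersurface and increasing in a common direction have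
the same sign. -/
theorem eventually_sign_eq {f f' : M → ℝ} {p : M} {v : E} (hf : SmoothNear I f p)
    (hf' : SmoothNear I f' p) (hfp : f p = 0) (hv : v ∈ faceSubmodule I p)
    (hfv : 0 < chartDiff I f p v) (hfv' : 0 < chartDiff I f' p v)
    (h : ∀ᶠ q in 𝓝 p, f q = 0 → f' q = 0) :
    ∀ᶠ q in 𝓝 p, SignType.sign (f' q) = SignType.sign (f q) := by
  -- The role of `k` is played by `-f'`: where `f > 0`, assuming `f' ≤ 0` then gives `f' > 0`, so
  -- `f' ≤ 0` is impossible. The second application does the same for the negative side.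
  have h1 := eventually_pos_of_vanishing hf'.neg hf hf' hfp (w := -v)
    ((faceSubmodule I p).neg_mem hv) (by simpa [chartDiff_neg]) (by simpa) (by simpa)
    (h.mono fun q hq _ => hq)
  have h2 := eventually_pos_of_vanishing hf' hf.neg hf'.neg (by simpa) (w := v)
    hv hfv' (by simpa [chartDiff_neg]) (by simpa [chartDiff_neg])
    (h.mono fun q hq _ => by simpa using hq)
  filter_upwards [h, h1, h2] with q h h1 h2
  simp only [Pi.neg_apply, Left.nonneg_neg_iff, Left.neg_pos_iff] at h1 h2
  rcases lt_trichotomy (f q) 0 with h3 | h3 | h3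
  · have : f' q < 0 := by
      by_contra! h4
      exact (h2 h4 h3).not_ge h4
    rw [sign_neg h3, sign_neg this]
  · rw [h3, h h3]
  · have : 0 < f' q := by
      by_contra! h4
      exact (h1 h4 h3).not_ge h4
    rw [sign_pos h3, sign_pos this]

theorem nonneg_of_forall_add_mul {a b : ℝ} (h : ∀ ε > 0, 0 ≤ a + ε * b) : 0 ≤ a := by
  have h1 : Tendsto (fun ε : ℝ => a + ε * b) (𝓝[>] 0) (𝓝 (a + 0 * b)) :=
    (by fun_prop : Continuous fun ε : ℝ => a + ε * b).continuousWithinAt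
  rw [zero_mul, add_zero] at h1
  exact ge_of_tendsto h1 (by filter_upwards [self_mem_nhdsWithin] with ε hε using h ε hε)

variable (I) in
/-- The vectors at `p` along which one can move without leaving the manifold. -/
def inwardCone (p : M) : Set E :=
  {w | ∀ᶠ t : ℝ in 𝓝[>] 0, extChartAt I p p + t • w ∈ range I}

theorem inwardCone_add {p : M} {w v : E} (hw : w ∈ inwardCone I p) (hv : v ∈ faceSubmodule I p) :
    w + v ∈ inwardCone I p := by
  have ht : Tendsto (fun t : ℝ => 2 * t) (𝓝[>] 0) (𝓝[>] 0) := by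
    refine tendsto_nhdsWithin_iff.2 ⟨?_, ?_⟩
    · have : Tendsto (fun t : ℝ => 2 * t) (𝓝 0) (𝓝 0) := by
        simpa using (tendsto_id (x := 𝓝 (0 : ℝ))).const_mul 2
      exact this.mono_left nhdsWithin_le_nhds
    · filter_upwards [self_mem_nhdsWithin] with t ht
      simpa using ht
  have h1 := ht.eventually hw
  have h2 := ht.eventually ((mem_faceSubmodule.1 hv).filter_mono nhdsWithin_le_nhds)
  filter_upwards [h1, h2] with t h1 h2
  have := I.convex_range h1 h2 (by norm_num : (0 : ℝ) ≤ 1 / 2) (by norm_num : (0 : ℝ) ≤ 1 / 2)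
    (by norm_num)
  convert this using 1
  module

theorem eventually_pos_of_inward {f : M → ℝ} {p : M} (hf : MDifferentiableAt I 𝓘(ℝ, ℝ) f p)
    (hfp : f p = 0) {w : E} (hw : w ∈ inwardCone I p) (hfw : 0 < chartDiff I f p w) :
    ∀ᶠ t : ℝ in 𝓝[>] 0, 0 < f ((extChartAt I p).symm (extChartAt I p p + t • w)) := by
  have hline : HasDerivWithinAt (fun t : ℝ => extChartAt I p p + t • w) w
      (Ioi 0 ∩ {t | extChartAt I p p + t • w ∈ range I}) 0 := by
    have : HasDerivAt (fun t : ℝ => extChartAt I p p + t • w) w 0 := by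
      simpa using ((hasDerivAt_id (0 : ℝ)).smul_const w).const_add (extChartAt I p p)
    exact this.hasDerivWithinAt
  have h1 := (hasFDerivWithinAt_chart hf).comp_hasDerivWithinAt_of_eq (0 : ℝ) hline
    (fun t ht => ht.2) (by simp)
  rw [hasDerivWithinAt_iff_tendsto_slope' (by simp)] at h1
  have hle : 𝓝[>] (0 : ℝ) ≤ 𝓝[Ioi 0 ∩ {t | extChartAt I p p + t • w ∈ range I}] 0 :=
    nhdsWithin_le_iff.2 (inter_mem self_mem_nhdsWithin hw)
  filter_upwards [(h1.mono_left hle).eventually (lt_mem_nhds hfw), self_mem_nhdsWithin]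
    with t ht ht0
  have ht0 : 0 < t := ht0
  simp only [slope, Function.comp_apply, sub_zero, zero_smul, add_zero, extChartAt_to_inv, hfp,
    vsub_eq_sub, smul_eq_mul] at ht
  exact (mul_pos_iff_of_pos_left (inv_pos.2 ht0)).1 ht

theorem eventually_inward {p : M} {w : E} (hw : w ∈ inwardCone I p) {P : M → Prop}
    (hP : ∀ᶠ q in 𝓝 p, P q) :
    ∀ᶠ t : ℝ in 𝓝[>] 0, P ((extChartAt I p).symm (extChartAt I p p + t • w)) := by
  rw [eventually_chart_iff (I := I)] at hP
  have h1 : Tendsto (fun t : ℝ => extChartAt I p p + t • w) (𝓝[>] 0)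
      (𝓝[range I] (extChartAt I p p)) := by
    refine tendsto_nhdsWithin_iff.2 ⟨?_, hw⟩
    have : Tendsto (fun t : ℝ => extChartAt I p p + t • w) (𝓝 0)
        (𝓝 (extChartAt I p p + (0 : ℝ) • w)) :=
      (by fun_prop : Continuous fun t : ℝ => extChartAt I p p + t • w).tendsto 0
    rw [zero_smul, add_zero] at this
    exact this.mono_left nhdsWithin_le_nhds
  exact h1.eventually hP

theorem nonneg_of_inward {f : M → ℝ} {p : M} (hf : MDifferentiableAt I 𝓘(ℝ, ℝ) f p)
    (hfp : f p = 0) {w : E} (hw : w ∈ inwardCone I p)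
    (h : ∀ᶠ t : ℝ in 𝓝[>] 0, 0 ≤ f ((extChartAt I p).symm (extChartAt I p p + t • w))) :
    0 ≤ chartDiff I f p w := by
  by_contra! hneg
  have h1 := eventually_pos_of_inward hf.neg (by simpa) hw (by simpa [chartDiff_neg])
  obtain ⟨t, h2, h3⟩ := (h1.and h).exists
  simp only [Pi.neg_apply] at h2
  linarith

/-- Linear algebra behind the comparison of differentials: `A` is an admissibility condition on
directions which holds far in the direction `u`. -/
theorem exists_smul_of_cone {G G' : E →L[ℝ] ℝ} {p : M} {u v : E} (hu : u ∈ faceSubmodule I p)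
    (hv : v ∈ faceSubmodule I p) (hGu : G u = 0) (hGv : G v = 1) {A : E → Prop}
    (hAv : ∀ w (s : ℝ), A w → A (w + s • v)) (hAu : ∀ w, ∃ l₀ : ℝ, ∀ l ≥ l₀, A (w + l • u))
    (h : ∀ w ∈ inwardCone I p, A w → (0 < G w → 0 ≤ G' w) ∧ (G w < 0 → G' w ≤ 0)) :
    ∃ c : ℝ, 0 ≤ c ∧ G' = c • G := by
  -- The hypothesis says nothing where `G` vanishes, so `w` is moved by `±ε • v` and `ε` tends to
  -- zero.
  have h0 : ∀ w ∈ inwardCone I p, A w → G w = 0 → G' w = 0 := by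
    intro w hw hAw hGw
    refine le_antisymm ?_ ?_
    · rw [← neg_nonneg]
      refine nonneg_of_forall_add_mul (b := G' v) fun ε hε => ?_
      have := (h (w + (-ε) • v) (inwardCone_add hw (Submodule.smul_mem _ _ hv)) (hAv _ _ hAw)).2
        (by simp [hGw, hGv, hε])
      simp only [map_add, map_smul, smul_eq_mul] at this
      linarith
    · refine nonneg_of_forall_add_mul (b := G' v) fun ε hε => ?_
      have := (h (w + ε • v) (inwardCone_add hw (Submodule.smul_mem _ _ hv)) (hAv _ _ hAw)).1
        (by simp [hGw, hGv, hε])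
      simpa using this
  have hzero : (0 : E) ∈ inwardCone I p := by simp [inwardCone]
  -- For large `l` the form `G'` vanishes at `l • u` and at `(l + 1) • u`.
  have hGu' : G' u = 0 := by
    obtain ⟨l, hl⟩ := hAu 0
    have h1 := h0 _ (inwardCone_add hzero (Submodule.smul_mem _ l hu)) (hl l le_rfl) (by simp [hGu])
    have h2 := h0 _ (inwardCone_add hzero (Submodule.smul_mem _ (l + 1) hu)) (hl (l + 1) (by simp))
      (by simp [hGu])
    simp only [map_add, map_zero, map_smul, smul_eq_mul] at h1 h2
    linarith
  refine ⟨G' v, ?_, ?_⟩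
  · obtain ⟨l, hl⟩ := hAu v
    have hvI : v ∈ inwardCone I p := by simpa using inwardCone_add hzero hv
    have := (h _ (inwardCone_add hvI (Submodule.smul_mem _ l hu)) (hl l le_rfl)).1
      (by simp [hGu, hGv])
    simpa [hGu'] using this
  · have key : ∀ w ∈ inwardCone I p, G' w = G' v * G w := by
      intro w hw
      obtain ⟨l, hl⟩ := hAu (w + (-G w) • v)
      have := h0 _ (inwardCone_add (inwardCone_add hw (Submodule.smul_mem _ (-G w) hv))
        (Submodule.smul_mem _ l hu)) (hl l le_rfl) (by simp [hGu, hGv])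
      simp only [map_add, map_smul, smul_eq_mul, hGu'] at this
      linarith
    have hx₀ : extChartAt I p p ∈ range I := by simp
    -- The form is known to vanish only on inward directions, hence on differences between points of
    -- `range I` and the base point. So it is constant on `range I` and has derivative zero there,
    -- and unique differentiability forces it to be zero.
    have h1 : HasFDerivWithinAt (G' - G' v • G) (0 : E →L[ℝ] ℝ) (range I) (extChartAt I p p) := by
      refine (hasFDerivWithinAt_const ((G' - G' v • G) (extChartAt I p p)) _ _).congr
        (fun y hy => ?_) rfl
      have hy' : y - extChartAt I p p ∈ inwardCone I p := by
        have : ∀ᶠ t : ℝ in 𝓝[>] 0, t ∈ Ioc (0 : ℝ) 1 := Ioc_mem_nhdsGT one_pos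
        filter_upwards [this] with t ht
        exact I.convex_range.add_smul_sub_mem hx₀ hy ⟨ht.1.le, ht.2⟩
      have := key _ hy'
      simp only [map_sub] at this
      simp only [sub_apply, smul_apply, smul_eq_mul]
      linarith
    have h2 := (I.uniqueDiffOn _ hx₀).eq (G' - G' v • G).hasFDerivWithinAt h1
    exact sub_eq_zero.1 h2

theorem RegularAt.exists_eq_one {f : M → ℝ} {p : M} (h : RegularAt I f p) :
    ∃ v ∈ faceSubmodule I p, chartDiff I f p v = 1 := by
  obtain ⟨v, hv, hfv⟩ : ∃ v ∈ faceSubmodule I p, chartDiff I f p v ≠ 0 := h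
  refine ⟨(chartDiff I f p v)⁻¹ • v, Submodule.smul_mem _ _ hv, ?_⟩
  rw [map_smul, smul_eq_mul]
  exact inv_mul_cancel₀ hfv

theorem chartDiff_eq_smul_of_sign {f f' : M → ℝ} {p : M} (hf : MDifferentiableAt I 𝓘(ℝ, ℝ) f p)
    (hf' : MDifferentiableAt I 𝓘(ℝ, ℝ) f' p) (hfp : f p = 0) (hfp' : f' p = 0)
    (hreg : RegularAt I f p) (h : ∀ᶠ q in 𝓝 p, (0 < f q → 0 ≤ f' q) ∧ (f q < 0 → f' q ≤ 0)) :
    ∃ c : ℝ, 0 ≤ c ∧ chartDiff I f' p = c • chartDiff I f p := by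
  obtain ⟨v, hv, hfv⟩ := hreg.exists_eq_one
  refine exists_smul_of_cone (A := fun _ => True) (Submodule.zero_mem _) hv (by simp) hfv
    (by simp) (by simp) fun w hw _ => ⟨fun hpos => ?_, fun hneg => ?_⟩
  · refine nonneg_of_inward hf' hfp' hw ?_
    filter_upwards [eventually_inward hw h, eventually_pos_of_inward hf hfp hw hpos] with t h1 h2
    exact h1.1 h2
  · have : 0 ≤ chartDiff I (-f') p w := by
      refine nonneg_of_inward hf'.neg (by simpa) hw ?_
      filter_upwards [eventually_inward hw h, eventually_pos_of_inward hf.neg (by simpa) hw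
        (by simpa [chartDiff_neg])] with t h1 h2
      simpa using h1.2 (by simpa using h2)
    simpa [chartDiff_neg] using this

/-- Signs are known only on the half `k > 0`, so the admissible directions are those along which `k`
increases. By independence, adding a multiple of a vector that changes only `k` brings every
direction into this half. -/
theorem chartDiff_eq_smul_of_sign_on {k f f' : M → ℝ} {p : M}
    (hk : MDifferentiableAt I 𝓘(ℝ, ℝ) k p) (hf : MDifferentiableAt I 𝓘(ℝ, ℝ) f p)
    (hf' : MDifferentiableAt I 𝓘(ℝ, ℝ) f' p) (hkp : k p = 0) (hfp : f p = 0) (hfp' : f' p = 0)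
    (hind : IndependentAt I k f p)
    (h : ∀ᶠ q in 𝓝 p, 0 < k q → (0 < f q → 0 ≤ f' q) ∧ (f q < 0 → f' q ≤ 0)) :
    ∃ c : ℝ, 0 ≤ c ∧ chartDiff I f' p = c • chartDiff I f p := by
  obtain ⟨u, hu, v, hv, hku, hfu, hkv, hfv⟩ := hind.exists_dual
  refine exists_smul_of_cone (A := fun w => 0 < chartDiff I k p w) hu hv hfu hfv
    (by simp [hkv]) (fun w => ⟨1 - chartDiff I k p w, fun l hl => ?_⟩)
    fun w hw hkw => ⟨fun hpos => ?_, fun hneg => ?_⟩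
  · simp [hku]
    linarith
  · refine nonneg_of_inward hf' hfp' hw ?_
    filter_upwards [eventually_inward hw h, eventually_pos_of_inward hf hfp hw hpos,
      eventually_pos_of_inward hk hkp hw hkw] with t h1 h2 h3
    exact (h1 h3).1 h2
  · have : 0 ≤ chartDiff I (-f') p w := by
      refine nonneg_of_inward hf'.neg (by simpa) hw ?_
      filter_upwards [eventually_inward hw h, eventually_pos_of_inward hf.neg (by simpa) hw
        (by simpa [chartDiff_neg]), eventually_pos_of_inward hk hkp hw hkw] with t h1 h2 h3
      simpa using (h1 h3).2 (by simpa using h2)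
    simpa [chartDiff_neg] using this

theorem posSide_eq_iff {f f' : M → ℝ} {p : M} :
    posSide I f p = posSide I f' p ↔ ∀ v : E, 0 < chartDiff I f p v ↔ 0 < chartDiff I f' p v :=
  Set.ext_iff

theorem posSide_eq_of_smul {f f' : M → ℝ} {p : M} {c : ℝ} (hc : 0 < c)
    (h : chartDiff I f' p = c • chartDiff I f p) : posSide I f' p = posSide I f p := by
  rw [posSide_eq_iff]
  intro v
  rw [h, smul_apply, smul_eq_mul]
  exact mul_pos_iff_of_pos_left hc

theorem posSide_congr {f f' : M → ℝ} {p : M} (h : f =ᶠ[𝓝 p] f') :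
    posSide I f p = posSide I f' p := by
  rw [posSide_eq_iff, chartDiff_congr h]
  simp

theorem posSide_neg_congr {f f' : M → ℝ} {p : M} (h : posSide I f p = posSide I f' p) :
    posSide I (-f) p = posSide I (-f') p := by
  rw [posSide_eq_iff] at *
  intro v
  simpa [chartDiff_neg] using h (-v)

theorem posSide_eq_of_sign {f f' : M → ℝ} {p : M} (hf : MDifferentiableAt I 𝓘(ℝ, ℝ) f p)
    (hf' : MDifferentiableAt I 𝓘(ℝ, ℝ) f' p) (hfp : f p = 0) (hreg : RegularAt I f p)
    (hne : chartDiff I f' p ≠ 0)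
    (h : ∀ᶠ q in 𝓝 p, SignType.sign (f' q) = SignType.sign (f q)) :
    posSide I f' p = posSide I f p := by
  have hfp' : f' p = 0 := by
    have := h.self_of_nhds
    rwa [hfp, sign_zero, sign_eq_zero_iff] at this
  obtain ⟨c, hc, hcf⟩ := chartDiff_eq_smul_of_sign hf hf' hfp hfp' hreg (by
    filter_upwards [h] with q hq
    refine ⟨fun h1 => ?_, fun h1 => ?_⟩
    · rw [sign_pos h1, sign_eq_one_iff] at hq
      exact hq.le
    · rw [sign_neg h1, sign_eq_neg_one_iff] at hq
      exact hq.le)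
  refine posSide_eq_of_smul (hc.lt_of_ne ?_) hcf
  rintro rfl
  simp [hcf] at hne

/-- Any competing function with negative side `W` has as differential a nonnegative multiple of that
of `f`, so it contributes no vector outside the half-space of `f`. -/
theorem outward_eq_posSide {W : Set M} {f : M → ℝ} {p : M} (hf : SmoothNear I f p)
    (hfp : f p = 0) (hreg : RegularAt I f p) (hW : ∀ᶠ q in 𝓝 p, (q ∈ W ↔ f q < 0)) :
    outward I W p = posSide I f p := by
  ext v
  refine ⟨?_, fun hv => ⟨f, hf, hfp, hW, hv⟩⟩
  rintro ⟨f', hf', hfp', hW', hv⟩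
  obtain ⟨c, hc, hcf⟩ := chartDiff_eq_smul_of_sign hf.mdifferentiableAt hf'.mdifferentiableAt
    hfp hfp' hreg (by
      filter_upwards [hW, hW'] with q h1 h2
      refine ⟨fun h3 => ?_, fun h3 => (h2.1 (h1.2 h3)).le⟩
      by_contra! h4
      exact (h1.1 (h2.2 h4)).not_gt h3)
  have hv' : 0 < chartDiff I f' p v := hv
  rw [hcf] at hv'
  exact pos_of_mul_pos_right (show 0 < c * chartDiff I f p v from hv') hc

theorem IsLocalEquation.eventually [IsManifold I ∞ M] [FlatFaces I] {U : Set M} {p : M}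
    {f : M → ℝ} (h : IsLocalEquation I U p f) : ∀ᶠ q in 𝓝 p, IsLocalEquation I U q f := by
  filter_upwards [h.1.eventually, h.2.1.eventually h.1, eventually_eventually_nhds.2 h.2.2]
    with q h1 h2 h3
  exact ⟨h1, h2, h3⟩

theorem IsLocalEquation.congr_set {U U' : Set M} {p : M} {f : M → ℝ}
    (h : IsLocalEquation I U p f) (hU : ∀ᶠ q in 𝓝 p, (q ∈ U' ↔ q ∈ U)) :
    IsLocalEquation I U' p f :=
  ⟨h.1, h.2.1, by filter_upwards [h.2.2, hU] with q h1 h2 using h2.trans h1⟩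

theorem RegularAt.neg {f : M → ℝ} {p : M} (h : RegularAt I f p) : RegularAt I (-f) p := by
  obtain ⟨v, hv, hfv⟩ := h
  refine ⟨v, hv, ?_⟩
  change chartDiff I (-f) p v ≠ 0
  rw [chartDiff_neg]
  exact neg_ne_zero.2 hfv

theorem IsLocalEquation.neg {U : Set M} {p : M} {f : M → ℝ}
    (h : IsLocalEquation I U p f) : IsLocalEquation I U p (-f) :=
  ⟨h.1.neg, h.2.1.neg, by simpa using h.2.2⟩

theorem IsLocalEquation.eq_zero {U : Set M} {p : M} {f : M → ℝ}
    (h : IsLocalEquation I U p f) (hp : p ∈ U) : f p = 0 :=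
  h.2.2.self_of_nhds.1 hp

theorem IsLocalEquation.chartDiff_ne_zero {U : Set M} {p : M} {f : M → ℝ}
    (h : IsLocalEquation I U p f) : chartDiff I f p ≠ 0 := by
  obtain ⟨v, -, hv⟩ : ∃ v ∈ faceSubmodule I p, chartDiff I f p v ≠ 0 := h.2.1
  rintro h0
  simp [h0] at hv

theorem RegularAt.chartDiff_ne_zero {p : M} {f : M → ℝ} (h : RegularAt I f p) :
    chartDiff I f p ≠ 0 := by
  obtain ⟨v, -, hv⟩ : ∃ v ∈ faceSubmodule I p, chartDiff I f p v ≠ 0 := h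
  rintro h0
  simp [h0] at hv

end Comparison

/-! ### Crossings and local models of bindings -/

section Binding

variable {E H M : Type*} [NormedAddCommGroup E] [NormedSpace ℝ E] [TopologicalSpace H]
  {I : ModelWithCorners ℝ E H} [TopologicalSpace M] [ChartedSpace H M]

/-- A small push of `w` in the direction `v` makes `G'` nonzero and preserves the two strict
inequalities. -/
theorem exists_face_ne_zero {p : M} {F G G' : E →L[ℝ] ℝ} {w v : E}
    (hw : w ∈ faceSubmodule I p) (hv : v ∈ faceSubmodule I p) (hF : 0 < F w) (hG : G w < 0)
    (hG' : G' v ≠ 0) : ∃ w' ∈ faceSubmodule I p, 0 < F w' ∧ G w' < 0 ∧ G' w' ≠ 0 := by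
  by_cases h : G' w = 0
  · have h1 : ∀ᶠ ε : ℝ in 𝓝[>] 0, 0 < F (w + ε • v) ∧ G (w + ε • v) < 0 := by
      have hc : Tendsto (fun ε : ℝ => w + ε • v) (𝓝 0) (𝓝 (w + (0 : ℝ) • v)) :=
        (by fun_prop : Continuous fun ε : ℝ => w + ε • v).tendsto 0
      rw [zero_smul, add_zero] at hc
      exact ((hc.eventually (F.continuous.continuousAt.eventually (lt_mem_nhds hF))).and
        (hc.eventually (G.continuous.continuousAt.eventually (gt_mem_nhds hG)))).filter_mono
        nhdsWithin_le_nhds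
    obtain ⟨ε, ⟨h2, h3⟩, h4⟩ := (h1.and self_mem_nhdsWithin).exists
    refine ⟨w + ε • v, add_mem hw (Submodule.smul_mem _ _ hv), h2, h3, ?_⟩
    simpa [h, hG'] using (ne_of_gt h4 : ε ≠ 0)
  · exact ⟨w, hw, hF, hG, h⟩

/-- Points of the half hypersurface `g = 0 < f` accumulate at the points of `f = g = 0`. -/
theorem frequently_pos_eq_zero {f g : M → ℝ} {p : M} (hf : SmoothNear I f p)
    (hg : SmoothNear I g p) (hfp : f p = 0) (hgp : g p = 0) (h : IndependentAt I f g p) :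
    ∃ᶠ q in 𝓝 p, 0 < f q ∧ g q = 0 := by
  rw [frequently_iff]
  intro U hU
  obtain ⟨u, hu, v, hv, hfu, hgu, hfv, hgv⟩ := h.exists_dual
  have hU' := inter_mem hU hg.eventually
  obtain ⟨z, hz⟩ := exists_increasing_paths (add_mem hu hv) hU' (f := ![f, g])
    (by intro j; fin_cases j; exacts [hf, hg])
    (by intro j; fin_cases j <;> simp [hfu, hgu, hfv, hgv])
  obtain ⟨γ, -, -, hγ, -, hinc⟩ := hz.self_of_nhds
  have hgz : 0 < g z := by simpa [hγ, hgp] using hinc 1 (by simp) 1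
  -- The point `y` is chosen with `f > 0 > g` and so close to `p` that an increasing path leads from
  -- it to `z`, where `g > 0`. That path keeps `f` positive and crosses `g = 0`.
  obtain ⟨y, hy⟩ := exists_increasing_paths (sub_mem hu hv) hz (f := ![f, -g])
    (by intro j; fin_cases j; exacts [hf, hg.neg])
    (by intro j; fin_cases j <;> simp [hfu, hgu, hfv, hgv, chartDiff_neg])
  obtain ⟨γ', -, -, hγ', hyU, hinc'⟩ := hy.self_of_nhds
  have hfy : 0 < f y := by simpa [hγ', hfp] using hinc' 1 (by simp) 0
  have hgy : g y < 0 := by simpa [hγ', hgp] using hinc' 1 (by simp) 1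
  have := hyU 1 (by simp)
  rw [hγ'] at this
  obtain ⟨γ, hc, h0, h1, hγU, hinc⟩ := this
  have hcont : ContinuousOn (g ∘ γ) (Icc 0 1) := fun s hs =>
    (hγU s hs).2.continuousAt.comp_continuousWithinAt (hc s hs)
  obtain ⟨s, hs, hs0⟩ := intermediate_value_Icc zero_le_one hcont
    (show (0 : ℝ) ∈ Icc ((g ∘ γ) 0) ((g ∘ γ) 1) by simp [h0, h1, hgz.le, hgy.le])
  have hs' : s ∈ Ioc (0 : ℝ) 1 := by
    refine ⟨hs.1.lt_of_ne ?_, hs.2⟩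
    rintro rfl
    simp only [Function.comp_apply, h0] at hs0
    exact hgy.ne hs0
  exact ⟨γ s, (hγU s hs).1, hfy.trans (hinc s hs' 0), hs0⟩

/-- Two equations of the same hypersurface have the same or opposite signs. -/
theorem sign_eq_or_sign_eq_neg {f f' : M → ℝ} {p : M} (hf : SmoothNear I f p)
    (hf' : SmoothNear I f' p) (hfp : f p = 0) (hreg : RegularAt I f p) (hreg' : RegularAt I f' p)
    (h : ∀ᶠ q in 𝓝 p, f q = 0 → f' q = 0) :
    (∀ᶠ q in 𝓝 p, SignType.sign (f' q) = SignType.sign (f q)) ∨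
      ∀ᶠ q in 𝓝 p, SignType.sign (f' q) = -SignType.sign (f q) := by
  obtain ⟨v, hv, hfv⟩ := hreg.exists_eq_one
  obtain ⟨v', hv', hfv'⟩ := hreg'.exists_eq_one
  obtain ⟨w, hw, h1, -, h2⟩ := exists_face_ne_zero (F := chartDiff I f p)
    (G := -chartDiff I f p) (G' := chartDiff I f' p) hv hv' (by simp [hfv]) (by simp [hfv])
    (by simp [hfv'])
  rcases h2.lt_or_gt with h2 | h2
  · right
    have := eventually_sign_eq hf hf'.neg hfp hw h1 (by simpa [chartDiff_neg])
      (h.mono fun q hq => by simpa using hq)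
    filter_upwards [this] with q hq
    rw [← hq, Pi.neg_apply, Left.sign_neg, neg_neg]
  · left
    exact eventually_sign_eq hf hf' hfp hw h1 h2 h

/-- A local model `f`, `g` of the trivalent manifold `V` near the point `p` of a binding. -/
structure IsBindingModel (V : TrivalentData I M) (f g : M → ℝ) (p : M) : Prop where
  left_eq_zero : f p = 0
  right_eq_zero : g p = 0
  smooth_left : SmoothNear I f p
  smooth_right : SmoothNear I g p
  independent : IndependentAt I f g p
  eventually_iff : ∀ᶠ q in 𝓝 p,
      (q ∈ V.binding ↔ f q = 0 ∧ g q = 0) ∧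
      (q ∈ V.blue ↔ f q = 0 ∧ g q ≠ 0) ∧
      (q ∈ V.red ↔ 0 < f q ∧ g q = 0) ∧
      (q ∈ V.red → V.pos q = posSide I g q) ∧
      (q ∈ V.blue → 0 < g q → V.pos q = posSide I f q) ∧
      (q ∈ V.blue → g q < 0 → V.pos q = posSide I (-f) q)

theorem IsTrivalent.exists_bindingModel {V : TrivalentData I M} (hV : IsTrivalent V) {p : M}
    (hp : p ∈ V.binding) : ∃ f g, IsBindingModel V f g p := by
  obtain ⟨f, g, hf, hg, hind, h⟩ := hV.binding_model p hp
  have := h.self_of_nhds.1.1 hp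
  exact ⟨f, g, this.1, this.2, hf, hg, hind, h⟩

/-- The quadrants at a transverse crossing are connected near the crossing. -/
theorem exists_preconnected_quadrant {f g : M → ℝ} {p : M} (hf : SmoothNear I f p)
    (hg : SmoothNear I g p) (h : IndependentAt I f g p) {U : Set M} (hU : U ∈ 𝓝 p) :
    ∃ z, ∀ᶠ q in 𝓝 p, 0 < f q → 0 < g q → ∃ s : Set M, IsPreconnected s ∧ q ∈ s ∧ z ∈ s ∧
      s ⊆ U ∩ {q | 0 < f q ∧ 0 < g q} := by
  obtain ⟨u, hu, v, hv, hfu, hgu, hfv, hgv⟩ := h.exists_dual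
  obtain ⟨z, hz⟩ := exists_increasing_paths (add_mem hu hv) hU (f := ![f, g])
    (by intro j; fin_cases j; exacts [hf, hg])
    (by intro j; fin_cases j <;> simp [hfu, hgu, hfv, hgv])
  refine ⟨z, ?_⟩
  filter_upwards [hz] with q ⟨γ, hc, h0, h1, hγU, hinc⟩ hfq hgq
  refine ⟨γ '' Icc 0 1, isPreconnected_Icc.image _ hc, ⟨0, by simp, h0⟩, ⟨1, by simp, h1⟩, ?_⟩
  rintro _ ⟨s, hs, rfl⟩
  refine ⟨hγU s hs, ?_⟩
  rcases hs.1.eq_or_lt with hs0 | hs0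
  · rw [← hs0, h0]
    exact ⟨hfq, hgq⟩
  · exact ⟨hfq.trans (hinc s ⟨hs0, hs.2⟩ 0), hgq.trans (hinc s ⟨hs0, hs.2⟩ 1)⟩

/-- Both `f` and `f'` cut out the blue facets together with the binding, so their signs agree or are
opposite. The red facet lies on the positive side of both. -/
theorem IsBindingModel.sign_left {V : TrivalentData I M} {f g f' g' : M → ℝ} {p : M}
    (h : IsBindingModel V f g p) (h' : IsBindingModel V f' g' p) :
    ∀ᶠ q in 𝓝 p, SignType.sign (f' q) = SignType.sign (f q) := by
  have h0 : ∀ᶠ q in 𝓝 p, f q = 0 → f' q = 0 := by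
    filter_upwards [h.eventually_iff, h'.eventually_iff] with q h1 h2 hfq
    by_cases hgq : g q = 0
    · exact (h2.1.1 (h1.1.2 ⟨hfq, hgq⟩)).1
    · exact (h2.2.1.1 (h1.2.1.2 ⟨hfq, hgq⟩)).1
  refine (sign_eq_or_sign_eq_neg h.smooth_left h'.smooth_left h.left_eq_zero
    h.independent.regularAt_left h'.independent.regularAt_left h0).resolve_right fun hneg => ?_
  obtain ⟨q, ⟨h1, h2⟩, h3, h4, h5⟩ := ((frequently_pos_eq_zero h.smooth_left h.smooth_right
    h.left_eq_zero h.right_eq_zero h.independent).and_eventually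
    (hneg.and (h.eventually_iff.and h'.eventually_iff))).exists
  have h6 := (h5.2.2.1.1 (h4.2.2.1.2 ⟨h1, h2⟩)).1
  rw [sign_pos h1, sign_pos h6] at h3
  exact absurd h3 (by decide)

variable [IsManifold I ∞ M] [FlatFaces I]

/-- Take a direction in which `f` increases, `g` decreases and `g'` is not stationary. If `g'`
increased, it would be negative where `g > 0 ≤ f`. But at nearby points of `g = 0 < f` both
functions vanish and increase towards the same side. -/
theorem eventually_pos_of_posSide_eq {f g g' : M → ℝ} {p : M} (hf : SmoothNear I f p)
    (hg : SmoothNear I g p) (hg' : SmoothNear I g' p) (hfp : f p = 0) (hgp : g p = 0)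
    (hind : IndependentAt I f g p) (hreg : RegularAt I g' p)
    (h : ∀ᶠ q in 𝓝 p, 0 < f q → g q = 0 → g' q = 0 ∧ posSide I g' q = posSide I g q) :
    ∀ᶠ q in 𝓝 p, 0 ≤ f q → 0 < g q → 0 < g' q := by
  obtain ⟨u, hu, v, hv, hfu, hgu, hfv, hgv⟩ := hind.exists_dual
  obtain ⟨v', hv', hgv'⟩ : ∃ v ∈ faceSubmodule I p, chartDiff I g' p v ≠ 0 := hreg
  obtain ⟨w, hw, h1, h2, h3⟩ := exists_face_ne_zero (F := chartDiff I f p) (G := chartDiff I g p)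
    (sub_mem hu hv) hv' (by simp [hfu, hfv]) (by simp [hgu, hgv]) hgv'
  rcases h3.lt_or_gt with h3 | h3
  · exact eventually_pos_of_vanishing hf hg hg' hgp hw h1 h2 h3
      (h.mono fun q hq hq1 hq2 => (hq hq1 hq2).1)
  · exfalso
    have key := eventually_pos_of_vanishing hf hg hg'.neg hgp hw h1 h2
      (by simpa [chartDiff_neg] using h3)
      (h.mono fun q hq hq1 hq2 => by simpa using (hq hq1 hq2).1)
    obtain ⟨q, ⟨hfq, hgq⟩, hq, hkey, hfs, hgs, hgs', hregq⟩ :=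
      ((frequently_pos_eq_zero hf hg hfp hgp hind).and_eventually
        (h.and ((eventually_eventually_nhds.2 key).and (hf.eventually.and (hg.eventually.and
          (hg'.eventually.and (hind.symm.regularAt_left.eventually hg))))))).exists
    obtain ⟨hq0, hqpos⟩ := hq hfq hgq
    obtain ⟨y, hy, hgy⟩ := hregq.exists_eq_one
    have hgy' : 0 < chartDiff I g' q y := (posSide_eq_iff.1 hqpos y).2 (by simp [hgy])
    obtain ⟨z, hz⟩ := exists_increasing_paths hy
      (hkey.and (hfs.continuousAt.eventually (lt_mem_nhds hfq))) (f := ![g, g'])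
      (by intro j; fin_cases j; exacts [hgs, hgs'])
      (by intro j; fin_cases j <;> simp [hgy, hgy'])
    obtain ⟨γ, -, -, hγ, hU, hinc⟩ := hz.self_of_nhds
    have e1 := hinc 1 (by simp) 0
    have e2 := hinc 1 (by simp) 1
    obtain ⟨e3, e4⟩ := hU 1 (by simp)
    simp only [Matrix.cons_val, hgq, hq0, hγ] at e1 e2 e3 e4
    have := e3 e4.le e1
    simp only [Pi.neg_apply] at this
    linarith

/-- If `g'` vanishes on the half hypersurface `g = 0 ≤ f` and is a compatible equation of it, then
`g'` and `g` have the same sign where `f ≥ 0`. -/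
theorem sign_eq_of_posSide_eq {f g g' : M → ℝ} {p : M} (hf : SmoothNear I f p)
    (hg : SmoothNear I g p) (hg' : SmoothNear I g' p) (hfp : f p = 0) (hgp : g p = 0)
    (hind : IndependentAt I f g p) (hreg : RegularAt I g' p)
    (h : ∀ᶠ q in 𝓝 p, 0 < f q → g q = 0 → posSide I g' q = posSide I g q)
    (h0 : ∀ᶠ q in 𝓝 p, 0 ≤ f q → g q = 0 → g' q = 0) :
    (∀ᶠ q in 𝓝 p, 0 ≤ f q → SignType.sign (g' q) = SignType.sign (g q)) ∧
      ∃ c > (0 : ℝ), chartDiff I g' p = c • chartDiff I g p := by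
  have hindn : IndependentAt I f (-g) p := by
    obtain ⟨u, hu, v, hv, hfu, hgu, hfv, hgv⟩ := hind.exists_dual
    exact independentAt_of_det hu hv (by simp [chartDiff_neg, hfu, hgu, hfv, hgv])
  have h1 := eventually_pos_of_posSide_eq hf hg hg' hfp hgp hind hreg (by
    filter_upwards [h, h0] with q e1 e2 e3 e4 using ⟨e2 e3.le e4, e1 e3 e4⟩)
  have h2 := eventually_pos_of_posSide_eq hf hg.neg hg'.neg hfp (by simpa) hindn hreg.neg (by
    filter_upwards [h, h0] with q e1 e2 e3 e4
    simp only [Pi.neg_apply, neg_eq_zero] at *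
    exact ⟨e2 e3.le e4, posSide_neg_congr (e1 e3 e4)⟩)
  have hsign : ∀ᶠ q in 𝓝 p, 0 ≤ f q → SignType.sign (g' q) = SignType.sign (g q) := by
    filter_upwards [h0, h1, h2] with q h0 h1 h2 hfq
    rcases lt_trichotomy (g q) 0 with h3 | h3 | h3
    · rw [sign_neg h3, sign_neg]
      simpa using h2 hfq (by simpa)
    · rw [h3, h0 hfq h3]
    · rw [sign_pos h3, sign_pos (h1 hfq h3)]
  refine ⟨hsign, ?_⟩
  have hgp' : g' p = 0 := h0.self_of_nhds hfp.ge hgp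
  obtain ⟨c, hc, hcg⟩ := chartDiff_eq_smul_of_sign_on hf.mdifferentiableAt hg.mdifferentiableAt
    hg'.mdifferentiableAt hfp hgp hgp' hind (by
      filter_upwards [hsign] with q hq hfq
      have hq := hq hfq.le
      refine ⟨fun h1 => ?_, fun h1 => ?_⟩
      · rw [sign_pos h1, sign_eq_one_iff] at hq
        exact hq.le
      · rw [sign_neg h1, sign_eq_neg_one_iff] at hq
        exact hq.le)
  refine ⟨c, hc.lt_of_ne ?_, hcg⟩
  rintro rfl
  exact hreg.chartDiff_ne_zero (by simpa using hcg)

theorem IsBindingModel.eventually {V : TrivalentData I M} {f g : M → ℝ} {p : M}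
    (h : IsBindingModel V f g p) : ∀ᶠ q in 𝓝 p, q ∈ V.binding → IsBindingModel V f g q := by
  filter_upwards [h.smooth_left.eventually, h.smooth_right.eventually,
    h.independent.eventually h.smooth_left h.smooth_right, h.eventually_iff,
    eventually_eventually_nhds.2 h.eventually_iff] with q h1 h2 h3 h4 h5 hq
  exact ⟨(h4.1.1 hq).1, (h4.1.1 hq).2, h1, h2, h3, h5⟩

/-- Where `f < 0` the trivalent manifold is absent and two models need not agree. What survives is
the sign on `f ≥ 0` and, to first order, the differential at `p`. -/
theorem IsBindingModel.sign_right {V : TrivalentData I M} {f g f' g' : M → ℝ} {p : M}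
    (h : IsBindingModel V f g p) (h' : IsBindingModel V f' g' p) :
    (∀ᶠ q in 𝓝 p, 0 ≤ f q → SignType.sign (g' q) = SignType.sign (g q)) ∧
      ∃ c > (0 : ℝ), chartDiff I g' p = c • chartDiff I g p := by
  refine sign_eq_of_posSide_eq h.smooth_left h.smooth_right h'.smooth_right h.left_eq_zero
    h.right_eq_zero h.independent h'.independent.symm.regularAt_left ?_ ?_
  · filter_upwards [h.eventually_iff, h'.eventually_iff] with q h1 h2 hfq hgq
    have hq := h1.2.2.1.2 ⟨hfq, hgq⟩
    rw [← h2.2.2.2.1 hq, ← h1.2.2.2.1 hq]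
  · filter_upwards [h.eventually_iff, h'.eventually_iff] with q h1 h2 hfq hgq
    rcases hfq.eq_or_lt with hfq | hfq
    · exact (h2.1.1 (h1.1.2 ⟨hfq.symm, hgq⟩)).2
    · exact (h2.2.2.1.1 (h1.2.2.1.2 ⟨hfq, hgq⟩)).2

theorem IsBindingModel.posSide_right {V : TrivalentData I M} {f g f' g' : M → ℝ} {p : M}
    (h : IsBindingModel V f g p) (h' : IsBindingModel V f' g' p) :
    posSide I g' p = posSide I g p := by
  obtain ⟨c, hc, hcg⟩ := (h.sign_right h').2
  exact posSide_eq_of_smul hc hcg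

end Binding

/-! ### Restriction to the boundary and extension from it -/

section BoundaryMap

variable {E H M : Type*} [NormedAddCommGroup E] [NormedSpace ℝ E] [TopologicalSpace H]
  {I : ModelWithCorners ℝ E H} [TopologicalSpace M] [ChartedSpace H M]
  {E' H' N : Type*} [NormedAddCommGroup E'] [NormedSpace ℝ E'] [TopologicalSpace H']
  {J : ModelWithCorners ℝ E' H'} [TopologicalSpace N] [ChartedSpace H' N]

variable (I J) in
/-- The differential of a map at `x`, as a linear map between the model spaces. -/
def mapDiff (i : N → M) (x : N) : E' →L[ℝ] E := mfderiv J I i x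

variable (I J) in
/-- The properties of the inclusion `i` of the boundary of `M` that matter for restrictions. -/
structure IsBoundaryMap (i : N → M) : Prop where
  contMDiff : ContMDiff J I ∞ i
  isEmbedding : Topology.IsEmbedding i
  isClosed_range : IsClosed (range i)
  range_mapDiff : ∀ x, (mapDiff I J i x).range = faceSubmodule I (i x)
  interior : ∀ q ∉ range i, range I ∈ 𝓝 (extChartAt I q q)
  retract : ∀ x, ∃ P : M → E', (∀ᶠ q in 𝓝 (i x), ContMDiffAt I 𝓘(ℝ, E') ∞ P q) ∧
    ∃ L : E' ≃L[ℝ] E', HasFDerivAt (P ∘ i ∘ (extChartAt J x).symm) (L : E' →L[ℝ] E')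
      (extChartAt J x x)

variable {i : N → M}

theorem chartDiff_comp (hi : ContMDiff J I ∞ i) {f : M → ℝ} {x : N}
    (hf : MDifferentiableAt I 𝓘(ℝ, ℝ) f (i x)) :
    chartDiff J (f ∘ i) x = chartDiff I f (i x) ∘L mapDiff I J i x :=
  mfderiv_comp x hf ((hi x).mdifferentiableAt (by simp))

theorem SmoothNear.comp (hi : ContMDiff J I ∞ i) {f : M → ℝ} {x : N}
    (hf : SmoothNear I f (i x)) : SmoothNear J (f ∘ i) x := by
  filter_upwards [hi.continuous.continuousAt.eventually hf] with y hy
  exact hy.comp y (hi y)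

theorem posSide_comp (hi : ContMDiff J I ∞ i) {f : M → ℝ} {x : N}
    (hf : MDifferentiableAt I 𝓘(ℝ, ℝ) f (i x)) :
    posSide J (f ∘ i) x = {v | mfderiv J I i x v ∈ posSide I f (i x)} := by
  change {v : E' | 0 < chartDiff J (f ∘ i) x v} =
    {v : E' | 0 < chartDiff I f (i x) (mapDiff I J i x v)}
  rw [chartDiff_comp hi hf]
  rfl

theorem mapDiff_mem_face [J.Boundaryless] [FlatFaces I] (hi : ContMDiff J I ∞ i) (x : N)
    (v : E') :
    mapDiff I J i x v ∈ faceSubmodule I (i x) := by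
  have h1 : HasFDerivWithinAt (writtenInExtChartAt J I x i) (mapDiff I J i x) (range J)
      (extChartAt J x x) := ((hi x).mdifferentiableAt (by simp)).hasMFDerivAt.2
  rw [J.range_eq_univ, hasFDerivWithinAt_univ] at h1
  have hline : HasDerivAt (fun t : ℝ => extChartAt J x x + t • v) v 0 := by
    simpa using ((hasDerivAt_id (0 : ℝ)).smul_const v).const_add (extChartAt J x x)
  have h2 := h1.comp_hasDerivAt_of_eq (0 : ℝ) hline (by simp)
  have h3 := FlatFaces.deriv_mem (I := I) (Eventually.of_forall fun t => by
    simp [writtenInExtChartAt]) h2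
  simp only [writtenInExtChartAt, Function.comp_apply, zero_smul, add_zero,
    extChartAt_to_inv] at h3
  exact h3

namespace IsBoundaryMap

theorem regularAt_comp (hi : IsBoundaryMap I J i) [J.Boundaryless] {f : M → ℝ} {x : N}
    (hf : MDifferentiableAt I 𝓘(ℝ, ℝ) f (i x)) :
    RegularAt J (f ∘ i) x ↔ RegularAt I f (i x) := by
  change (∃ v ∈ faceSubmodule J x, chartDiff J (f ∘ i) x v ≠ 0) ↔
    ∃ v ∈ faceSubmodule I (i x), chartDiff I f (i x) v ≠ 0
  have hJ : ∀ v : E', v ∈ faceSubmodule J x := fun v => by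
    change ∀ᶠ t in _, _
    simp [J.range_eq_univ]
  rw [chartDiff_comp hi.contMDiff hf, ← hi.range_mapDiff]
  constructor
  · rintro ⟨v, -, hv⟩
    exact ⟨_, ⟨v, rfl⟩, hv⟩
  · rintro ⟨_, ⟨v, rfl⟩, hv⟩
    exact ⟨v, hJ v, hv⟩

theorem independentAt_comp (hi : IsBoundaryMap I J i) [J.Boundaryless] {f g : M → ℝ} {x : N}
    (hf : MDifferentiableAt I 𝓘(ℝ, ℝ) f (i x)) (hg : MDifferentiableAt I 𝓘(ℝ, ℝ) g (i x))
    (h : IndependentAt I f g (i x)) : IndependentAt J (f ∘ i) (g ∘ i) x := by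
  have hJ : ∀ v : E', v ∈ faceSubmodule J x := fun v => by
    change ∀ᶠ t in _, _
    simp [J.range_eq_univ]
  obtain ⟨u, hu, v, hv, h1, h2, h3, h4⟩ := h.exists_dual
  rw [← hi.range_mapDiff] at hu hv
  obtain ⟨u, rfl⟩ := hu
  obtain ⟨v, rfl⟩ := hv
  refine independentAt_of_det (hJ u) (hJ v) ?_
  rw [chartDiff_comp hi.contMDiff hf, chartDiff_comp hi.contMDiff hg]
  simp only [ContinuousLinearMap.comp_apply]
  change chartDiff I f (i x) (mapDiff I J i x u) = 1 at h1
  change chartDiff I g (i x) (mapDiff I J i x u) = 0 at h2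
  change chartDiff I f (i x) (mapDiff I J i x v) = 0 at h3
  change chartDiff I g (i x) (mapDiff I J i x v) = 1 at h4
  rw [h1, h2, h3, h4]
  norm_num

end IsBoundaryMap

/-- A smooth function `k` on `N` extends to a function on `M` which depends only on a smooth map
`P` on `M`, if `P ∘ i` is a local diffeomorphism. -/
theorem exists_extension [IsManifold J ∞ N] [J.Boundaryless] (hi : ContMDiff J I ∞ i)
    {F : Type*} [NormedAddCommGroup F] [NormedSpace ℝ F] [CompleteSpace E'] {P : M → F} {x : N}
    (hP : ∀ᶠ q in 𝓝 (i x), ContMDiffAt I 𝓘(ℝ, F) ∞ P q) {L : E' ≃L[ℝ] F}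
    (hL : HasFDerivAt (P ∘ i ∘ (extChartAt J x).symm) (L : E' →L[ℝ] F) (extChartAt J x x))
    {k : N → ℝ} (hk : SmoothNear J k x) :
    ∃ h : M → ℝ, SmoothNear I h (i x) ∧ (∀ᶠ y in 𝓝 x, h (i y) = k y) ∧
      ∀ U ∈ 𝓝 x, ∀ᶠ q in 𝓝 (i x), ∃ y ∈ U, P (i y) = P q ∧ h q = k y := by
  set φ := extChartAt J x
  set Φ : E' → F := P ∘ i ∘ φ.symm with hΦ
  have hPc : ContinuousAt P (i x) := hP.self_of_nhds.continuousAt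
  have hφsymm : ContinuousAt φ.symm (φ x) := continuousAt_extChartAt_symm x
  have hx : φ.symm (φ x) = x := extChartAt_to_inv x
  have hsm : ∀ᶠ y in 𝓝 (φ x), ContDiffAt ℝ ∞ Φ y := by
    have h1 : ∀ᶠ y in 𝓝 (φ x), ContMDiffAt I 𝓘(ℝ, F) ∞ P (i (φ.symm y)) := by
      have : ContinuousAt (i ∘ φ.symm) (φ x) := hi.continuous.continuousAt.comp hφsymm
      refine this.eventually (p := fun q => ContMDiffAt I 𝓘(ℝ, F) ∞ P q) ?_
      simpa [hx] using hP
    filter_upwards [h1, extChartAt_target_mem_nhds (I := J) x,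
      (isOpen_extChartAt_target (I := J) x).mem_nhds (mem_extChartAt_target x)] with y h2 h3 h4
    rw [← contMDiffAt_iff_contDiffAt]
    have h5 : ContMDiffAt 𝓘(ℝ, E') J ∞ φ.symm y :=
      (contMDiffOn_extChartAt_symm x).contMDiffAt ((isOpen_extChartAt_target x).mem_nhds h4)
    exact h2.comp y ((hi _).comp y h5)
  have hstrict : HasStrictFDerivAt Φ (L : E' →L[ℝ] F) (φ x) :=
    hsm.self_of_nhds.hasStrictFDerivAt' hL (by simp)
  set e := hstrict.toOpenPartialHomeomorph Φ
  have heΦ : ∀ y, e y = Φ y := fun y => rfl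
  have hsrc : φ x ∈ e.source := hstrict.mem_toOpenPartialHomeomorph_source
  have hΦx : Φ (φ x) = P (i x) := by simp [hΦ, hx]
  have htgt : P (i x) ∈ e.target := hΦx ▸ e.map_source hsrc
  have hesymm : e.symm (P (i x)) = φ x := by
    rw [← hΦx, ← heΦ, e.left_inv hsrc]
  have hec : ContinuousAt e.symm (P (i x)) := e.continuousAt_symm htgt
  -- smoothness of the local inverse
  have hinv : ∀ᶠ y in 𝓝 (φ x), ∃ L' : E' ≃L[ℝ] F, HasFDerivAt Φ (L' : E' →L[ℝ] F) y := by
    have hc : ContinuousAt (fderiv ℝ Φ) (φ x) :=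
      (hsm.self_of_nhds.fderiv_right (m := 0) (by simp)).continuousAt
    have := hc.eventually (p := fun A => A ∈ range ((↑) : (E' ≃L[ℝ] F) → E' →L[ℝ] F))
      (by rw [hL.fderiv]; exact L.nhds)
    filter_upwards [this, hsm] with y ⟨L', hL'⟩ hy
    exact ⟨L', hL' ▸ (hy.differentiableAt (by simp)).hasFDerivAt⟩
  have hsymm : ∀ᶠ a in 𝓝 (P (i x)), ContDiffAt ℝ ∞ e.symm a := by
    have h1 := hec.eventually (p := fun y => (∃ L' : E' ≃L[ℝ] F,
      HasFDerivAt Φ (L' : E' →L[ℝ] F) y) ∧ ContDiffAt ℝ ∞ Φ y) (by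
        rw [hesymm]; exact hinv.and hsm)
    filter_upwards [h1, e.open_target.mem_nhds htgt] with a ⟨⟨L', hL'⟩, h2⟩ ha
    exact e.contDiffAt_symm ha hL' h2
  have hkey : Tendsto (fun q => φ.symm (e.symm (P q))) (𝓝 (i x)) (𝓝 x) := by
    have h1 : Tendsto (fun q => e.symm (P q)) (𝓝 (i x)) (𝓝 (φ x)) := by
      rw [← hesymm]
      exact hec.tendsto.comp hPc
    have h2 : Tendsto φ.symm (𝓝 (φ x)) (𝓝 x) := by
      have := hφsymm.tendsto
      rwa [hx] at this
    exact h2.comp h1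
  -- The extension is constant along the fibres of `P`: its value at `q` is that of `k` at the
  -- nearby point `y` with `P (i y) = P q`.
  refine ⟨fun q => k (φ.symm (e.symm (P q))), ?_, ?_, ?_⟩
  · have h1 := hkey.eventually hk
    have h2 : ∀ᶠ q in 𝓝 (i x), e.symm (P q) ∈ φ.target := by
      have : Tendsto (fun q => e.symm (P q)) (𝓝 (i x)) (𝓝 (φ x)) := by
        rw [← hesymm]
        exact hec.tendsto.comp hPc
      exact this.eventually (extChartAt_target_mem_nhds x)
    filter_upwards [h1, h2, hP, hPc.eventually hsymm] with q h1 h2 h3 h4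
    have h5 : ContMDiffAt 𝓘(ℝ, E') J ∞ φ.symm (e.symm (P q)) :=
      (contMDiffOn_extChartAt_symm x).contMDiffAt ((isOpen_extChartAt_target x).mem_nhds h2)
    exact h1.comp q (h5.comp q (h4.contMDiffAt.comp q h3))
  · have hφc : ContinuousAt φ x := continuousAt_extChartAt x
    filter_upwards [extChartAt_source_mem_nhds (I := J) x,
      hφc.eventually (e.open_source.mem_nhds hsrc)] with y h1 h2
    have h3 : P (i y) = e (φ y) := by
      rw [heΦ, hΦ]
      simp only [Function.comp_apply]
      rw [φ.left_inv h1]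
    rw [h3, e.left_inv h2, φ.left_inv h1]
  · intro U hU
    filter_upwards [hkey.eventually hU, hPc.eventually (e.open_target.mem_nhds htgt)] with q h1 h2
    refine ⟨_, h1, ?_, rfl⟩
    exact e.right_inv h2

end BoundaryMap

/-! ### The boundary of a manifold modelled on a half-space -/

section HalfSpace

variable {m : ℕ} {M : Type*} [TopologicalSpace M] [ChartedSpace (EuclideanHalfSpace (m + 1)) M]
  {N : Type*} [TopologicalSpace N]
  [ChartedSpace (EuclideanSpace ℝ (Fin m)) N] [IsManifold (𝓡 m) ∞ N] {i : N → M}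

/-- In charts where the immersion is a linear inclusion, `P` is the projection to the first factor.
Then `P ∘ i` read in the preferred chart is a change of coordinates of `N`, whose derivative is
invertible. -/
theorem exists_retraction (hi : Manifold.IsSmoothEmbedding (𝓡 m) (𝓡∂ (m + 1)) ∞ i) (x : N) :
    ∃ P : M → EuclideanSpace ℝ (Fin m),
      (∀ᶠ q in 𝓝 (i x), ContMDiffAt (𝓡∂ (m + 1)) 𝓘(ℝ, EuclideanSpace ℝ (Fin m)) ∞ P q) ∧
      ∃ L : EuclideanSpace ℝ (Fin m) ≃L[ℝ] EuclideanSpace ℝ (Fin m),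
        HasFDerivAt (P ∘ i ∘ (extChartAt (𝓡 m) x).symm)
          (L : EuclideanSpace ℝ (Fin m) →L[ℝ] EuclideanSpace ℝ (Fin m))
          (extChartAt (𝓡 m) x x) := by
  have h := hi.isImmersion.isImmersionAt x
  set P : M → EuclideanSpace ℝ (Fin m) :=
    fun q => (h.equiv.symm (h.codChart.extend (𝓡∂ (m + 1)) q)).1 with hPdef
  refine ⟨P, ?_, ?_⟩
  · filter_upwards [h.codChart.open_source.mem_nhds h.mem_codChart_source] with q hq
    have h1 := OpenPartialHomeomorph.contMDiffAt_extend h.codChart_mem_maximalAtlas hq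
    have h2 : ContDiff ℝ ∞ fun y => (h.equiv.symm y).1 := by fun_prop
    exact h2.contDiffAt.contMDiffAt.comp q h1
  · have hmem : chartAt (EuclideanSpace ℝ (Fin m)) x ∈ IsManifold.maximalAtlas (𝓡 m) ∞ N :=
      IsManifold.chart_mem_maximalAtlas x
    set c := (𝓡 m).extendCoordChange (chartAt (EuclideanSpace ℝ (Fin m)) x) h.domChart
    have hx : extChartAt (𝓡 m) x x ∈ c.source := by
      rw [← OpenPartialHomeomorph.extend_image_source_inter]
      exact ⟨x, ⟨mem_chart_source _ x, h.mem_domChart_source⟩, rfl⟩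
    have hnhds : c.source ∈ 𝓝 (extChartAt (𝓡 m) x x) := by
      have := (𝓡 m).extendCoordChange_source_mem_nhdsWithin hx
      rwa [ModelWithCorners.range_eq_univ, nhdsWithin_univ] at this
    obtain ⟨L, hL⟩ := (𝓡 m).isInvertible_fderivWithin_extendCoordChange (n := ∞) (by simp) hmem
      h.domChart_mem_maximalAtlas hx
    refine ⟨L, ?_⟩
    have h1 : HasFDerivAt c (L : EuclideanSpace ℝ (Fin m) →L[ℝ] EuclideanSpace ℝ (Fin m))
        (extChartAt (𝓡 m) x x) := by
      have h2 := ((((𝓡 m).contDiffOn_extendCoordChange hmem h.domChart_mem_maximalAtlas) _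
        hx).differentiableWithinAt (by simp)).hasFDerivWithinAt
      rw [hL]
      exact h2.hasFDerivAt hnhds
    refine h1.congr_of_eventuallyEq ?_
    filter_upwards [hnhds] with y hy
    have hy' : (extChartAt (𝓡 m) x).symm y ∈ h.domChart.source := by
      have := hy.2
      simpa using this
    have h3 := h.writtenInCharts ((h.domChart.extend (𝓡 m)).map_source
      (by rw [OpenPartialHomeomorph.extend_source]; exact hy'))
    simp only [Function.comp_apply] at h3
    rw [OpenPartialHomeomorph.extend_left_inv _ hy'] at h3
    simp only [hPdef, Function.comp_apply]
    rw [h3, ContinuousLinearEquiv.symm_apply_apply]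
    rfl

theorem isBoundaryMap_of_isSmoothEmbedding [IsManifold (𝓡∂ (m + 1)) ∞ M]
    (hi : Manifold.IsSmoothEmbedding (𝓡 m) (𝓡∂ (m + 1)) ∞ i)
    (hrange : range i = (𝓡∂ (m + 1)).boundary M) :
    IsBoundaryMap (𝓡∂ (m + 1)) (𝓡 m) i := by
  have hsm : ContMDiff (𝓡 m) (𝓡∂ (m + 1)) ∞ i := hi.contMDiff
  -- The derivative of `P ∘ i` is injective and factors through that of `i`.
  have hinj : ∀ x, Function.Injective (mapDiff (𝓡∂ (m + 1)) (𝓡 m) i x) := by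
    intro x
    obtain ⟨P, hP, L, hL⟩ := exists_retraction hi x
    have h1 : HasFDerivAt (writtenInExtChartAt (𝓡 m) (𝓡∂ (m + 1)) x i)
        (mapDiff (𝓡∂ (m + 1)) (𝓡 m) i x) (extChartAt (𝓡 m) x x) := by
      have : HasFDerivWithinAt (writtenInExtChartAt (𝓡 m) (𝓡∂ (m + 1)) x i)
        (mapDiff (𝓡∂ (m + 1)) (𝓡 m) i x) (range (𝓡 m)) (extChartAt (𝓡 m) x x) :=
        ((hsm x).mdifferentiableAt (by simp)).hasMFDerivAt.2
      rwa [ModelWithCorners.range_eq_univ, hasFDerivWithinAt_univ] at this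
    have h2 : DifferentiableWithinAt ℝ (P ∘ (extChartAt (𝓡∂ (m + 1)) (i x)).symm)
        (range (𝓡∂ (m + 1))) (extChartAt (𝓡∂ (m + 1)) (i x) (i x)) :=
      ((contMDiffAt_iff.1 hP.self_of_nhds).2).differentiableWithinAt (by simp)
    have h3 : HasFDerivWithinAt (P ∘ (extChartAt (𝓡∂ (m + 1)) (i x)).symm)
        (fderivWithin ℝ (P ∘ (extChartAt (𝓡∂ (m + 1)) (i x)).symm) (range (𝓡∂ (m + 1)))
          (extChartAt (𝓡∂ (m + 1)) (i x) (i x))) (range (𝓡∂ (m + 1)))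
        (writtenInExtChartAt (𝓡 m) (𝓡∂ (m + 1)) x i (extChartAt (𝓡 m) x x)) := by
      have e : writtenInExtChartAt (𝓡 m) (𝓡∂ (m + 1)) x i (extChartAt (𝓡 m) x x) =
          extChartAt (𝓡∂ (m + 1)) (i x) (i x) := by
        simp only [writtenInExtChartAt, Function.comp_apply, extChartAt_to_inv]
      rw [e]
      exact h2.hasFDerivWithinAt
    have h4 := h3.comp_hasFDerivAt (extChartAt (𝓡 m) x x) h1
      (Eventually.of_forall fun y => by simp [writtenInExtChartAt])
    have h5 : HasFDerivAt (P ∘ i ∘ (extChartAt (𝓡 m) x).symm)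
        ((fderivWithin ℝ (P ∘ (extChartAt (𝓡∂ (m + 1)) (i x)).symm) (range (𝓡∂ (m + 1)))
          (extChartAt (𝓡∂ (m + 1)) (i x) (i x))) ∘L mapDiff (𝓡∂ (m + 1)) (𝓡 m) i x)
        (extChartAt (𝓡 m) x x) := by
      refine h4.congr_of_eventuallyEq ?_
      have hc : ContinuousAt (i ∘ (extChartAt (𝓡 m) x).symm) (extChartAt (𝓡 m) x x) :=
        hsm.continuous.continuousAt.comp (continuousAt_extChartAt_symm x)
      have := hc.eventually (p := fun q => q ∈ (extChartAt (𝓡∂ (m + 1)) (i x)).source) (by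
        simp only [Function.comp_apply, extChartAt_to_inv]
        exact extChartAt_source_mem_nhds (i x))
      filter_upwards [this] with y hy
      simp only [Function.comp_apply] at hy
      simp only [writtenInExtChartAt, Function.comp_apply]
      rw [(extChartAt (𝓡∂ (m + 1)) (i x)).left_inv hy]
    have h6 := h5.unique hL
    intro v w hvw
    apply L.injective
    have hv := DFunLike.congr_fun h6 v
    have hw := DFunLike.congr_fun h6 w
    rw [ContinuousLinearMap.comp_apply] at hv hw
    rw [hvw] at hv
    exact hv.symm.trans hw
  refine ⟨hsm, hi.isEmbedding, ?_, fun x => ?_, fun q hq => ?_, exists_retraction hi⟩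
  · rw [hrange]
    exact ModelWithCorners.isClosed_boundary (n := ∞) (by simp)
  -- The image lies in the face and has dimension `m`. At a boundary point the face misses the first
  -- coordinate vector, so its dimension is at most `m`.
  · refine Submodule.eq_of_le_of_finrank_le ?_ ?_
    · rintro _ ⟨v, rfl⟩
      exact mapDiff_mem_face hsm x v
    · have h1 : Module.finrank ℝ (mapDiff (𝓡∂ (m + 1)) (𝓡 m) i x).range = m := by
        rw [LinearMap.finrank_range_of_inj (hinj x)]
        simp
      rw [h1]
      have hx : i x ∈ (𝓡∂ (m + 1)).boundary M := hrange ▸ mem_range_self x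
      have hx0 : 0 = extChartAt (𝓡∂ (m + 1)) (i x) (i x) 0 := by
        have : extChartAt (𝓡∂ (m + 1)) (i x) (i x) ∈ frontier (range (𝓡∂ (m + 1))) := hx
        rw [frontier_range_modelWithCornersEuclideanHalfSpace] at this
        exact this
      have hlt : faceSubmodule (𝓡∂ (m + 1)) (i x) < ⊤ := by
        rw [lt_top_iff_ne_top]
        intro htop
        have h2 : EuclideanSpace.single (0 : Fin (m + 1)) (1 : ℝ) ∈
            faceSubmodule (𝓡∂ (m + 1)) (i x) := htop ▸ trivial
        have h3 : ∀ᶠ t : ℝ in 𝓝 0, extChartAt (𝓡∂ (m + 1)) (i x) (i x) +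
          t • EuclideanSpace.single (0 : Fin (m + 1)) (1 : ℝ) ∈ range (𝓡∂ (m + 1)) := h2
        rw [range_modelWithCornersEuclideanHalfSpace] at h3
        have h4 : ∀ᶠ t : ℝ in 𝓝 0, 0 ≤ t := by
          filter_upwards [h3] with t ht
          have ht' : 0 ≤ (extChartAt (𝓡∂ (m + 1)) (i x) (i x) +
            t • EuclideanSpace.single (0 : Fin (m + 1)) (1 : ℝ)) 0 := ht
          rw [PiLp.add_apply, ← hx0] at ht'
          simpa using ht'
        obtain ⟨t, ht, ht'⟩ := ((h4.filter_mono nhdsWithin_le_nhds).and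
          (self_mem_nhdsWithin : ∀ᶠ t : ℝ in 𝓝[<] 0, t ∈ Iio (0 : ℝ))).exists
        exact (not_lt.2 ht) ht'
      have := Submodule.finrank_lt hlt.ne
      simp at this
      omega
  · rw [hrange, ← mem_compl_iff, ModelWithCorners.compl_boundary] at hq
    exact range_mem_nhds_isInteriorPoint hq

end HalfSpace

/-! ### Adapted functions and their gluing -/

section Adapted

variable {E' H' N : Type*} [NormedAddCommGroup E'] [NormedSpace ℝ E'] [TopologicalSpace H']
  {J : ModelWithCorners ℝ E' H'} [TopologicalSpace N] [ChartedSpace H' N]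
  {E H M : Type*} [NormedAddCommGroup E] [NormedSpace ℝ E] [TopologicalSpace H]
  {I : ModelWithCorners ℝ E H} [TopologicalSpace M] [ChartedSpace H M]

/-- The underlying set of a trivalent manifold. -/
def TrivalentData.support (V : TrivalentData I M) : Set M := V.blue ∪ V.red ∪ V.binding

/-- The germ of `h` at `q` is suitable for a function whose zero set, outside `V`, is the part of
the red hypersurface to be added to `V`, and which is positive on the white regions and negative
on the black regions. -/
structure IsAdaptedAt (V : TrivalentData I M) (S : ShadingData J N) (i : N → M) (h : M → ℝ)
    (q : M) : Prop where
  smooth : q ∉ V.support → SmoothNear I h q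
  facet : q ∈ V.blue ∪ V.red → ∃ f, IsLocalEquation I (V.blue ∪ V.red) q f ∧
    V.pos q = posSide I f q ∧ ∀ᶠ q' in 𝓝 q, SignType.sign (h q') = -SignType.sign (f q')
  -- Where `f ≥ 0`, only signs of `h` matter. The function `k` is an equation for the red
  -- hypersurface on both sides of the binding: its zeros are those of `g` where `f ≥ 0` and those
  -- of `h` where `f < 0`. The condition on differentials makes it regular and transverse to `f =
  -- 0`.
  binding : q ∈ V.binding → ∃ f g k, IsBindingModel V f g q ∧ SmoothNear I k q ∧
    (∃ c > (0 : ℝ), chartDiff I k q = c • chartDiff I g q) ∧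
    ∀ᶠ q' in 𝓝 q, (f q' < 0 → h q' = k q') ∧ (0 ≤ f q' →
      SignType.sign (k q') = SignType.sign (g q') ∧
      SignType.sign (h q') = -SignType.sign (f q' * g q'))
  white : ∀ x, i x = q → x ∈ S.white → 0 < h q
  black : ∀ x, i x = q → x ∉ S.red ∪ S.blue → x ∉ S.white → h q < 0
  red : ∀ x, i x = q → x ∈ S.red → q ∉ V.support →
    h q = 0 ∧ posSide J (h ∘ i) x = S.redPos x

theorem sign_add_mul {a b x y : ℝ} {s : SignType} (ha : 0 < a) (hb : 0 ≤ b)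
    (hx : SignType.sign x = s) (hy : SignType.sign y = s) : SignType.sign (a * x + b * y) = s := by
  cases s with
  | zero =>
    have hx : x = 0 := sign_eq_zero_iff.1 hx
    have hy : y = 0 := sign_eq_zero_iff.1 hy
    simp [hx, hy]
  | neg =>
    have hx : x < 0 := sign_eq_neg_one_iff.1 hx
    have hy : y < 0 := sign_eq_neg_one_iff.1 hy
    exact sign_neg (by nlinarith [mul_neg_of_pos_of_neg ha hx, mul_nonneg hb (neg_nonneg.2 hy.le)])
  | pos =>
    have hx : 0 < x := sign_eq_one_iff.1 hx
    have hy : 0 < y := sign_eq_one_iff.1 hy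
    exact sign_pos (by positivity)

variable {V : TrivalentData I M} {S : ShadingData J N} {i : N → M}

theorem IsAdaptedAt.congr {h h' : M → ℝ} {q : M} (hi : Continuous i)
    (ha : IsAdaptedAt V S i h q) (hh : h =ᶠ[𝓝 q] h') : IsAdaptedAt V S i h' q where
  smooth hq := (ha.smooth hq).congr hh
  facet hq := by
    obtain ⟨f, h1, h2, h3⟩ := ha.facet hq
    refine ⟨f, h1, h2, ?_⟩
    filter_upwards [h3, hh] with q' e1 e2
    rw [← e2, e1]
  binding hq := by
    obtain ⟨f, g, k, h1, h2, h3, h4⟩ := ha.binding hq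
    refine ⟨f, g, k, h1, h2, h3, ?_⟩
    filter_upwards [h4, hh] with q' e1 e2
    rwa [← e2]
  white x hx hxw := hh.self_of_nhds ▸ ha.white x hx hxw
  black x hx hx1 hx2 := hh.self_of_nhds ▸ ha.black x hx hx1 hx2
  red x hx hx1 hx2 := by
    refine ⟨hh.self_of_nhds ▸ (ha.red x hx hx1 hx2).1, ?_⟩
    rw [← (ha.red x hx hx1 hx2).2]
    subst hx
    refine posSide_congr ?_
    exact (hi.continuousAt.eventually hh).mono fun y hy => hy.symm

/-- The two functions may come with different local equations, but these agree in sign wherever a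
sign is prescribed: equations of a facet by `eventually_sign_eq`, models of a binding by `sign_left`
and `sign_right`. So the combination is adapted with the equations chosen for `h` and the combined
`k`. -/
theorem IsAdaptedAt.add_mul [IsManifold I ∞ M] [FlatFaces I] (hi : ContMDiff J I ∞ i)
    {a b h h' : M → ℝ} {q : M} (hh : IsAdaptedAt V S i h q) (hh' : IsAdaptedAt V S i h' q)
    (has : SmoothNear I a q) (hbs : SmoothNear I b q) (ha : 0 < a q)
    (hb : ∀ᶠ q' in 𝓝 q, 0 ≤ b q') : IsAdaptedAt V S i (a * h + b * h') q := by
  have ha' : ∀ᶠ q' in 𝓝 q, 0 < a q' := has.continuousAt.eventually (lt_mem_nhds ha)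
  have hbq : 0 ≤ b q := hb.self_of_nhds
  refine ⟨fun hq => (has.mul (hh.smooth hq)).add (hbs.mul (hh'.smooth hq)), fun hq => ?_,
    fun hq => ?_, fun x hx hxw => ?_, fun x hx hx1 hx2 => ?_, fun x hx hx1 hx2 => ?_⟩
  · obtain ⟨f, h1, h2, h3⟩ := hh.facet hq
    obtain ⟨f', h1', h2', h3'⟩ := hh'.facet hq
    refine ⟨f, h1, h2, ?_⟩
    obtain ⟨v, hv, hfv⟩ := h1.2.1.exists_eq_one
    have hfv' : 0 < chartDiff I f' q v :=
      (posSide_eq_iff.1 (h2.symm.trans h2') v).1 (by simp [hfv])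
    have hs := eventually_sign_eq h1.1 h1'.1 (h1.eq_zero hq) hv (by simp [hfv]) hfv' (by
      filter_upwards [h1.2.2, h1'.2.2] with q' e1 e2 e3 using e2.1 (e1.2 e3))
    filter_upwards [h3, h3', hs, ha', hb] with q' e1 e2 e3 e4 e5
    exact sign_add_mul e4 e5 e1 (e2.trans (by rw [e3]))
  · obtain ⟨f, g, k, h1, h2, ⟨c, hc, hcg⟩, h4⟩ := hh.binding hq
    obtain ⟨f', g', k', h1', h2', ⟨c', hc', hcg'⟩, h4'⟩ := hh'.binding hq
    have hf := h1.sign_left h1'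
    obtain ⟨hg, d, hd, hdg⟩ := h1.sign_right h1'
    refine ⟨f, g, a * k + b * k', h1, (has.mul h2).add (hbs.mul h2'), ?_, ?_⟩
    · have hk0 : k q = 0 := by
        have := (h4.self_of_nhds.2 h1.left_eq_zero.ge).1
        rwa [h1.right_eq_zero, sign_zero, sign_eq_zero_iff] at this
      have hk0' : k' q = 0 := by
        have := (h4'.self_of_nhds.2 h1'.left_eq_zero.ge).1
        rwa [h1'.right_eq_zero, sign_zero, sign_eq_zero_iff] at this
      refine ⟨a q * c + b q * (c' * d), by positivity, ?_⟩
      rw [chartDiff_add (has.mul h2).mdifferentiableAt (hbs.mul h2').mdifferentiableAt,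
        chartDiff_mul_of_eq_zero has.mdifferentiableAt h2.mdifferentiableAt hk0,
        chartDiff_mul_of_eq_zero hbs.mdifferentiableAt h2'.mdifferentiableAt hk0', hcg, hcg', hdg]
      module
    · filter_upwards [h4, h4', hf, hg, ha', hb] with q' e1 e2 e3 e4 e5 e6
      refine ⟨fun hneg => ?_, fun hpos => ?_⟩
      · have hneg' : f' q' < 0 := by
          rwa [sign_neg hneg, sign_eq_neg_one_iff] at e3
        simp [e1.1 hneg, e2.1 hneg']
      · have hpos' : 0 ≤ f' q' := by
          rw [← sign_nonneg_iff] at hpos ⊢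
          rwa [e3]
        refine ⟨sign_add_mul e5 e6 (e1.2 hpos).1 ((e2.2 hpos').1.trans (e4 hpos)),
          sign_add_mul e5 e6 (e1.2 hpos).2 ((e2.2 hpos').2.trans ?_)⟩
        rw [sign_mul, sign_mul, e3, e4 hpos]
  · have h1 := hh.white x hx hxw
    have h2 := hh'.white x hx hxw
    simp only [Pi.add_apply, Pi.mul_apply]
    positivity
  · have h1 := hh.black x hx hx1 hx2
    have h2 := hh'.black x hx hx1 hx2
    simp only [Pi.add_apply, Pi.mul_apply]
    nlinarith
  · obtain ⟨h1, h2⟩ := hh.red x hx hx1 hx2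
    obtain ⟨h1', h2'⟩ := hh'.red x hx hx1 hx2
    refine ⟨by simp [h1, h1'], ?_⟩
    subst hx
    have hs := SmoothNear.comp hi (hh.smooth hx2)
    have hs' := SmoothNear.comp hi (hh'.smooth hx2)
    have hsa := SmoothNear.comp hi has
    have hsb := SmoothNear.comp hi hbs
    have hcomp : (a * h + b * h') ∘ i = (a ∘ i) * (h ∘ i) + (b ∘ i) * (h' ∘ i) := rfl
    -- Both functions vanish at the point, so the derivatives of the weights drop out.
    have hd : chartDiff J ((a * h + b * h') ∘ i) x =
        a (i x) • chartDiff J (h ∘ i) x + b (i x) • chartDiff J (h' ∘ i) x := by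
      rw [hcomp, chartDiff_add (hsa.mul hs).mdifferentiableAt (hsb.mul hs').mdifferentiableAt,
        chartDiff_mul_of_eq_zero hsa.mdifferentiableAt hs.mdifferentiableAt h1,
        chartDiff_mul_of_eq_zero hsb.mdifferentiableAt hs'.mdifferentiableAt h1']
      rfl
    rw [← h2, posSide_eq_iff]
    have h3 := posSide_eq_iff.1 (h2'.trans h2.symm)
    intro v
    have e := DFunLike.congr_fun hd v
    simp only [add_apply, smul_apply, smul_eq_mul] at e
    rw [e]
    constructor
    · intro hpos
      by_contra! hle
      have hle' : chartDiff J (h' ∘ i) x v ≤ 0 := by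
        by_contra! hlt
        exact hle.not_gt ((h3 v).1 hlt)
      nlinarith
    · intro hpos
      have := (h3 v).2 hpos
      positivity

/-- Locally defined adapted functions can be glued. -/
theorem exists_isAdapted_of_local [FiniteDimensional ℝ E] [IsManifold I ∞ M] [FlatFaces I]
    [T2Space M] [SigmaCompactSpace M] (hi : ContMDiff J I ∞ i)
    (hloc : ∀ p, ∃ h : M → ℝ, ∀ᶠ q in 𝓝 p, IsAdaptedAt V S i h q) :
    ∃ h : M → ℝ, ∀ q, IsAdaptedAt V S i h q := by
  choose h hh using hloc
  obtain ⟨ρ, hρ⟩ := SmoothPartitionOfUnity.exists_isSubordinate I isClosed_univ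
    (fun p => interior {q | IsAdaptedAt V S i (h p) q}) (fun p => isOpen_interior)
    (fun p _ => mem_iUnion.2 ⟨p, mem_interior_iff_mem_nhds.2 (hh p)⟩)
  refine ⟨fun q => ∑ᶠ p, ρ p q * h p q, fun q => ?_⟩
  have hsm : ∀ p, SmoothNear I (ρ p) q := fun p =>
    Eventually.of_forall fun y => (ρ p).contMDiff.contMDiffAt
  have hloc : ∀ᶠ y in 𝓝 q, ∑ p ∈ ρ.fintsupport q, ρ p y * h p y = ∑ᶠ p, ρ p y * h p y := by
    filter_upwards [ρ.eventually_finsupport_subset q] with y hy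
    symm
    refine finsum_eq_sum_of_support_subset _ fun p hp => hy ?_
    rw [ρ.mem_finsupport]
    exact fun h0 => hp (by simp [h0])
  -- The sum is built up from a term of positive weight at `q`, since `IsAdaptedAt.add_mul` needs
  -- one strictly positive coefficient.
  obtain ⟨p₀, hp₀⟩ : ∃ p, 0 < ρ p q := ρ.exists_pos_of_mem (mem_univ q)
  have hmem : p₀ ∈ ρ.fintsupport q := by
    rw [ρ.mem_fintsupport_iff]
    exact subset_tsupport _ hp₀.ne'
  have had : ∀ p ∈ ρ.fintsupport q, IsAdaptedAt V S i (h p) q := fun p hp =>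
    interior_subset (hρ p ((ρ.mem_fintsupport_iff q p).1 hp))
  have key : ∀ s ⊆ ρ.fintsupport q, p₀ ∉ s →
      IsAdaptedAt V S i (fun y => ρ p₀ y * h p₀ y + ∑ p ∈ s, ρ p y * h p y) q := by
    classical
    intro s
    induction s using Finset.induction_on with
    | empty =>
      intro _ _
      refine ((had p₀ hmem).add_mul hi (had p₀ hmem) (hsm p₀) (smoothNear_const (c := 0)) hp₀
        (Eventually.of_forall fun _ => le_rfl)).congr hi.continuous
        (Eventually.of_forall fun y => ?_)
      simp
    | insert p s hps ih =>
      intro hs hp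
      rw [Finset.insert_subset_iff] at hs
      rw [Finset.mem_insert, not_or] at hp
      refine ((ih hs.2 hp.2).add_mul hi (had p hs.1) (smoothNear_const (c := 1)) (hsm p) one_pos
        (Eventually.of_forall fun y => ρ.nonneg p y)).congr hi.continuous
        (Eventually.of_forall fun y => ?_)
      simp only [Pi.add_apply, Pi.mul_apply, Finset.sum_insert hps]
      ring
  classical
  refine (key ((ρ.fintsupport q).erase p₀) (Finset.erase_subset _ _)
    (Finset.notMem_erase _ _)).congr hi.continuous ?_
  filter_upwards [hloc] with y hy
  rw [← hy]
  exact Finset.add_sum_erase _ (fun p => ρ p y * h p y) hmem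

end Adapted

/-! ### Equations of facets and colours of regions -/

section Trivalent

variable {E H M : Type*} [NormedAddCommGroup E] [NormedSpace ℝ E] [TopologicalSpace H]
  {I : ModelWithCorners ℝ E H} [TopologicalSpace M] [ChartedSpace H M] {V : TrivalentData I M}

theorem IsTrivalent.isClosed_support (hV : IsTrivalent V) : IsClosed V.support := hV.closed

theorem IsTrivalent.eventually_notMem_support (hV : IsTrivalent V) {p : M} (hp : p ∉ V.support) :
    ∀ᶠ q in 𝓝 p, q ∉ V.support :=
  hV.isClosed_support.isOpen_compl.mem_nhds hp

theorem IsTrivalent.exists_facet_equation (hV : IsTrivalent V) {p : M}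
    (hp : p ∈ V.blue ∪ V.red) : ∃ f, IsLocalEquation I (V.blue ∪ V.red) p f ∧
      ∀ᶠ q in 𝓝 p, q ∉ V.binding ∧ (q ∈ V.blue ∪ V.red → V.pos q = posSide I f q) := by
  rcases hp with hp | hp
  · obtain ⟨f, hf, h⟩ := hV.blue_facet p hp
    refine ⟨f, hf.congr_set ?_, ?_⟩
    · filter_upwards [h] with q hq
      simp [hq.1]
    · filter_upwards [h] with q hq
      exact ⟨hq.2.1, fun h' => hq.2.2 (h'.resolve_right hq.1)⟩
  · obtain ⟨f, hf, h⟩ := hV.red_facet p hp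
    refine ⟨f, hf.congr_set ?_, ?_⟩
    · filter_upwards [h] with q hq
      simp [hq.1]
    · filter_upwards [h] with q hq
      exact ⟨hq.2.1, fun h' => hq.2.2 (h'.resolve_left hq.1)⟩

theorem RegularAt.frequently_pos {f : M → ℝ} {p : M} (hf : SmoothNear I f p)
    (h : RegularAt I f p) (hp : f p = 0) : ∃ᶠ q in 𝓝 p, 0 < f q := by
  rw [frequently_iff]
  intro U hU
  obtain ⟨v, hv, hfv⟩ := h.exists_eq_one
  obtain ⟨z, hz⟩ := exists_increasing_paths hv hU (f := fun _ : Unit => f)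
    (fun _ => hf) (fun _ => by simp [hfv])
  obtain ⟨γ, -, -, -, hU, hinc⟩ := hz.self_of_nhds
  exact ⟨γ 1, hU 1 (by simp), by simpa [hp] using hinc 1 (by simp) ()⟩

variable {S : ShadingData I M}

theorem IsShading.mem_white_iff (hS : IsShading S) {s : Set M} (hs : IsPreconnected s)
    (hsub : s ⊆ (S.red ∪ S.blue)ᶜ) {y z : M} (hy : y ∈ s) (hz : z ∈ s) :
    y ∈ S.white ↔ z ∈ S.white :=
  ⟨fun h => hS.white_region y h (hs.subset_connectedComponentIn hy hsub hz),
    fun h => hS.white_region z h (hs.subset_connectedComponentIn hz hsub hy)⟩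

theorem IsShading.isOpen_regions (hS : IsShading S) : IsOpen (S.red ∪ S.blue)ᶜ :=
  (hS.red_hypersurface.1.union hS.blue_hypersurface.1).isOpen_compl

theorem IsShading.eventually_mem_white_iff [LocallyConnectedSpace M] (hS : IsShading S) {p : M}
    (hp : p ∉ S.red ∪ S.blue) : ∀ᶠ q in 𝓝 p, (q ∈ S.white ↔ p ∈ S.white) := by
  have h1 : connectedComponentIn (S.red ∪ S.blue)ᶜ p ∈ 𝓝 p :=
    hS.isOpen_regions.connectedComponentIn.mem_nhds (mem_connectedComponentIn hp)
  filter_upwards [h1] with q hq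
  exact hS.mem_white_iff isPreconnected_connectedComponentIn
    (connectedComponentIn_subset _ _) hq (mem_connectedComponentIn hp)

/-- The color of a quadrant at a crossing can be read off near the points of one of its sides. -/
theorem IsShading.eventually_quadrant [IsManifold I ∞ M] [FlatFaces I] (hS : IsShading S)
    {f k : M → ℝ} {p : M} (hf : SmoothNear I f p) (hk : SmoothNear I k p) (hfp : f p = 0)
    (hkp : k p = 0) (hind : IndependentAt I f k p)
    (hregion : ∀ᶠ q in 𝓝 p, q ∈ S.red ∪ S.blue → f q = 0 ∨ k q = 0) {w : Prop}
    (hw : ∀ᶠ q in 𝓝 p, f q = 0 → 0 < k q → ∀ᶠ y in 𝓝 q, 0 < f y → (y ∈ S.white ↔ w)) :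
    ∀ᶠ q in 𝓝 p, 0 < f q → 0 < k q → (q ∈ S.white ↔ w) := by
  obtain ⟨z, hz⟩ := exists_preconnected_quadrant hf hk hind hregion
  have hcolor : ∀ᶠ q in 𝓝 p, 0 < f q → 0 < k q → (q ∈ S.white ↔ z ∈ S.white) := by
    filter_upwards [hz] with q hq h1 h2
    obtain ⟨s, hs, hqs, hzs, hsub⟩ := hq h1 h2
    refine hS.mem_white_iff hs (fun y hy hy' => ?_) hqs hzs
    obtain ⟨e1, e2, e3⟩ := hsub hy
    rcases e1 hy' with e | e
    · exact e2.ne' e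
    · exact e3.ne' e
  -- The quadrant has one colour near `p`, so one of its points settles it. Such a point is found
  -- next to a point `y` of the side `f = 0 < k`, where the colour is `w` by hypothesis.
  obtain ⟨y, ⟨hky, hfy⟩, h1, h2, h3, h4, h5⟩ :=
    ((frequently_pos_eq_zero hk hf hkp hfp hind.symm).and_eventually
      (hw.and ((eventually_eventually_nhds.2 hcolor).and (hf.eventually.and
        (hk.eventually.and (hind.eventually hf hk)))))).exists
  obtain ⟨y', e1, e2, e3, e4⟩ := ((h5.regularAt_left.frequently_pos h3 hfy).and_eventually
    ((h1 hfy hky).and (h2.and (h4.continuousAt.eventually (lt_mem_nhds hky))))).exists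
  have hzw : z ∈ S.white ↔ w := (e3 e1 e4).symm.trans (e2 e1)
  filter_upwards [hcolor] with q hq a b using (hq a b).trans hzw

end Trivalent

/-! ### Adapted functions near facets and off the trivalent manifold -/

section Local

variable {E' H' N : Type*} [NormedAddCommGroup E'] [NormedSpace ℝ E'] [TopologicalSpace H']
  {J : ModelWithCorners ℝ E' H'} [TopologicalSpace N] [ChartedSpace H' N]
  {E H M : Type*} [NormedAddCommGroup E] [NormedSpace ℝ E] [TopologicalSpace H]
  {I : ModelWithCorners ℝ E H} [TopologicalSpace M] [ChartedSpace H M]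

/-- `V` is a trivalent manifold whose boundary is the trivalent manifold of the shading `S`. -/
structure IsFilling (V : TrivalentData I M) (S : ShadingData J N) (i : N → M) : Prop where
  trivalent : IsTrivalent V
  shading : IsShading S
  boundaryMap : IsBoundaryMap I J i
  restrict_eq : V.restrict J i = S.Gamma

variable {V : TrivalentData I M} {S : ShadingData J N} {i : N → M}

namespace IsFilling

theorem mem_blue (h : IsFilling V S i) {x : N} : i x ∈ V.blue ↔ x ∈ S.blue ∧ x ∉ S.red :=
  Set.ext_iff.1 (congrArg TrivalentData.blue h.restrict_eq) x

theorem mem_red (h : IsFilling V S i) {x : N} : i x ∈ V.red ↔ x ∈ S.keptRed :=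
  Set.ext_iff.1 (congrArg TrivalentData.red h.restrict_eq) x

theorem mem_binding (h : IsFilling V S i) {x : N} : i x ∈ V.binding ↔ x ∈ S.red ∧ x ∈ S.blue :=
  Set.ext_iff.1 (congrArg TrivalentData.binding h.restrict_eq) x

theorem pos_eq_outward (h : IsFilling V S i) {x : N} (hx : i x ∈ V.blue ∪ V.red) :
    {v | mfderiv J I i x v ∈ V.pos (i x)} = outward J S.white x := by
  have h1 := congrFun (congrArg TrivalentData.pos h.restrict_eq) x
  refine h1.trans ?_
  have h2 : x ∈ (S.blue \ S.red) ∪ S.keptRed := hx.imp h.mem_blue.1 h.mem_red.1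
  ext v
  exact ⟨fun h' => h'.2, fun h' => ⟨h2, h'⟩⟩

theorem mem_facets (h : IsFilling V S i) {x : N} (hx : i x ∈ V.blue ∪ V.red) :
    x ∈ S.red ∪ S.blue ∧ x ∉ S.red ∩ S.blue := by
  rcases hx with hx | hx
  · have := h.mem_blue.1 hx
    exact ⟨Or.inr this.1, fun h' => this.2 h'.1⟩
  · have := (h.mem_red.1 hx).1
    exact ⟨Or.inl this.1, fun h' => this.2 h'.2⟩

theorem mem_support_of_blue (h : IsFilling V S i) {x : N} (hx : x ∈ S.blue) :
    i x ∈ V.support := by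
  by_cases hr : x ∈ S.red
  · exact Or.inr (h.mem_binding.2 ⟨hr, hx⟩)
  · exact Or.inl (Or.inl (h.mem_blue.2 ⟨hx, hr⟩))

/-- Germs on `M` at `p` of properties of the points of `N`. -/
theorem eventually_forall_preimage (h : IsFilling V S i) {p : M} {P : N → Prop}
    (hP : ∀ x, i x = p → ∀ᶠ y in 𝓝 x, P y) : ∀ᶠ q in 𝓝 p, ∀ y, i y = q → P y := by
  by_cases hp : p ∈ range i
  · obtain ⟨x, rfl⟩ := hp
    have := hP x rfl
    rwa [h.boundaryMap.isEmbedding.isInducing.nhds_eq_comap, eventually_comap] at this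
  · filter_upwards [h.boundaryMap.isClosed_range.isOpen_compl.mem_nhds hp] with q hq y hy
    exact (hq ⟨y, hy⟩).elim

/-- The boundary of `V` is oriented out of white, so `f ∘ i` and the checkerboard function `f₀`
increase towards the same side. As `f₀` vanishes on the zeros of `f ∘ i`, they have the same sign.
-/
theorem facet_boundary (h : IsFilling V S i) [J.Boundaryless] {x : N}
    (hx : i x ∈ V.blue ∪ V.red) {f : M → ℝ} (hf : IsLocalEquation I (V.blue ∪ V.red) (i x) f)
    (hpos : V.pos (i x) = posSide I f (i x)) :
    ∀ᶠ y in 𝓝 x, (y ∈ S.white ↔ f (i y) < 0) ∧ (y ∈ S.red ∪ S.blue ↔ f (i y) = 0) := by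
  obtain ⟨h1, h2⟩ := h.mem_facets hx
  obtain ⟨f₀, hf₀, hw⟩ := h.shading.checkerboard x h1 h2
  have hi := h.boundaryMap.contMDiff
  have hfs : SmoothNear J (f ∘ i) x := SmoothNear.comp hi hf.1
  have hreg : RegularAt J (f ∘ i) x :=
    (h.boundaryMap.regularAt_comp hf.1.mdifferentiableAt).2 hf.2.1
  have hside : posSide J (f ∘ i) x = posSide J f₀ x := by
    rw [posSide_comp hi hf.1.mdifferentiableAt, ← hpos, h.pos_eq_outward hx,
      outward_eq_posSide hf₀.1 (hf₀.eq_zero h1) hf₀.2.1 hw]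
  obtain ⟨v, hv, hfv⟩ := hreg.exists_eq_one
  have hzero : ∀ᶠ y in 𝓝 x, (f ∘ i) y = 0 → f₀ y = 0 := by
    filter_upwards [hi.continuous.continuousAt.eventually hf.2.2, hf₀.2.2] with y e1 e2 e3
    exact e2.1 (h.mem_facets (e1.2 e3)).1
  have hsign := eventually_sign_eq hfs hf₀.1 (hf.eq_zero hx) hv (by simp [hfv])
    ((posSide_eq_iff.1 hside v).1 (by simp [hfv])) hzero
  filter_upwards [hsign, hw, hf₀.2.2] with y e1 e2 e3
  have e4 : f (i y) < 0 ↔ f₀ y < 0 := by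
    rw [← sign_eq_neg_one_iff, ← sign_eq_neg_one_iff, e1, Function.comp_apply]
  have e5 : f (i y) = 0 ↔ f₀ y = 0 := by
    rw [← sign_eq_zero_iff, ← sign_eq_zero_iff (a := f₀ y), e1, Function.comp_apply]
  exact ⟨e2.trans e4.symm, e3.trans e5.symm⟩

theorem exists_adapted_facet [J.Boundaryless] [IsManifold I ∞ M] [FlatFaces I]
    (h : IsFilling V S i) {p : M}
    (hp : p ∈ V.blue ∪ V.red) : ∃ k : M → ℝ, ∀ᶠ q in 𝓝 p, IsAdaptedAt V S i k q := by
  obtain ⟨f, hf, hfp⟩ := h.trivalent.exists_facet_equation hp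
  refine ⟨-f, ?_⟩
  have hb := h.eventually_forall_preimage (p := p) (P := fun y =>
    (y ∈ S.white ↔ f (i y) < 0) ∧ (y ∈ S.red ∪ S.blue ↔ f (i y) = 0)) (by
      rintro x rfl
      exact h.facet_boundary hp hf (hfp.self_of_nhds.2 hp))
  filter_upwards [hf.1.eventually, hf.eventually, hfp, hb, hf.2.2] with q h1 h2 h3 h4 h5
  refine ⟨fun _ => h1.neg, fun hq => ⟨f, h2, h3.2 hq, Eventually.of_forall fun y => ?_⟩,
    fun hq => (h3.1 hq).elim, fun y hy hw => ?_, fun y hy e1 e2 => ?_, fun y hy e1 e2 => ?_⟩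
  · simp [Left.sign_neg]
  · have := (h4 y hy).1.1 hw
    rw [hy] at this
    simpa using this
  · have e3 := (h4 y hy).1
    have e4 := (h4 y hy).2
    rw [hy] at e3 e4
    have e5 : 0 ≤ f q := not_lt.1 fun h' => e2 (e3.2 h')
    have e6 : f q ≠ 0 := fun h' => e1 (e4.2 h')
    simpa using e5.lt_of_ne' e6
  · have e4 := (h4 y hy).2.1 (Or.inl e1)
    rw [hy] at e4
    exact (e2 (Or.inl (h5.2 e4))).elim

/-- A red point outside `V` is not kept by `Γ`, so the red orientation there is not the outward one.
Hence the oriented equation `k` has the sign opposite to the checkerboard function. -/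
theorem red_boundary (h : IsFilling V S i) {x : N} (hx : i x ∉ V.support) (hxr : x ∈ S.red) :
    ∃ k : N → ℝ, SmoothNear J k x ∧ ∀ᶠ y in 𝓝 x, (y ∈ S.red ∪ S.blue ↔ k y = 0) ∧
      (y ∈ S.white ↔ 0 < k y) ∧ (y ∈ S.red → posSide J k y = S.redPos y) := by
  obtain ⟨k, hk, hkpos⟩ := h.shading.red_orientation.2 x hxr
  have hxb : x ∉ S.blue := fun h' => hx (h.mem_support_of_blue h')
  obtain ⟨f₀, hf₀, hw⟩ := h.shading.checkerboard x (Or.inl hxr) fun h' => hxb h'.2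
  have hfx := hf₀.eq_zero (Or.inl hxr)
  have hzero : ∀ᶠ y in 𝓝 x, k y = 0 → f₀ y = 0 := by
    filter_upwards [hk.2.2, hf₀.2.2] with y e1 e2 e3 using e2.1 (Or.inl (e1.2 e3))
  have hsign := (sign_eq_or_sign_eq_neg hk.1 hf₀.1 (hk.eq_zero hxr) hk.2.1 hf₀.2.1
    hzero).resolve_left fun hs => by
      have e1 := posSide_eq_of_sign hk.1.mdifferentiableAt hf₀.1.mdifferentiableAt
        (hk.eq_zero hxr) hk.2.1 hf₀.chartDiff_ne_zero hs
      refine hx (Or.inl (Or.inr (h.mem_red.2 ⟨⟨hxr, hxb⟩, ?_⟩)))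
      rw [hkpos.self_of_nhds hxr, outward_eq_posSide hf₀.1 hfx hf₀.2.1 hw, e1]
  refine ⟨k, hk.1, ?_⟩
  filter_upwards [hsign, hw, hf₀.2.2, hkpos] with y e1 e2 e3 e4
  refine ⟨?_, ?_, fun hy => (e4 hy).symm⟩
  · rw [e3, ← sign_eq_zero_iff, e1, ← sign_eq_zero_iff (a := k y)]
    generalize SignType.sign (k y) = s
    revert s
    decide
  · rw [e2, ← sign_eq_neg_one_iff, e1, ← sign_eq_one_iff]
    generalize SignType.sign (k y) = s
    revert s
    decide

theorem exists_adapted_off [J.Boundaryless] [IsManifold J ∞ N] [CompleteSpace E']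
    [LocallyConnectedSpace N] (h : IsFilling V S i) {p : M} (hp : p ∉ V.support) :
    ∃ k : M → ℝ, ∀ᶠ q in 𝓝 p, IsAdaptedAt V S i k q := by
  have hoff := h.trivalent.eventually_notMem_support hp
  suffices hsuff : ∃ k : M → ℝ, SmoothNear I k p ∧ ∀ x, i x = p → ∀ᶠ y in 𝓝 x,
      (y ∈ S.white → 0 < k (i y)) ∧ (y ∉ S.red ∪ S.blue → y ∉ S.white → k (i y) < 0) ∧
      (y ∈ S.red → k (i y) = 0 ∧ posSide J (k ∘ i) y = S.redPos y) by
    obtain ⟨k, hk, hb⟩ := hsuff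
    refine ⟨k, ?_⟩
    filter_upwards [hoff, hk.eventually, h.eventually_forall_preimage hb] with q h1 h2 h3
    refine ⟨fun _ => h2, fun hq => (h1 (Or.inl hq)).elim, fun hq => (h1 (Or.inr hq)).elim,
      fun y hy => hy ▸ (h3 y hy).1, fun y hy => hy ▸ (h3 y hy).2.1,
      fun y hy hyr _ => hy ▸ (h3 y hy).2.2 hyr⟩
  by_cases hpi : p ∈ range i
  swap
  -- Away from `V` and the boundary only smoothness is required; regularity of the zeros is left to
  -- the later perturbation.
  · exact ⟨fun _ => 0, smoothNear_const, fun x hx => (hpi ⟨x, hx⟩).elim⟩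
  obtain ⟨x, rfl⟩ := hpi
  have hinj : ∀ x', i x' = i x → x' = x := fun x' hx' => h.boundaryMap.isEmbedding.injective hx'
  have hxb : x ∉ S.blue := fun h' => hp (h.mem_support_of_blue h')
  by_cases hxr : x ∈ S.red
  · obtain ⟨k, hk, hk'⟩ := h.red_boundary hp hxr
    obtain ⟨P, hP, L, hL⟩ := h.boundaryMap.retract x
    obtain ⟨k', hks, hkk, -⟩ := exists_extension h.boundaryMap.contMDiff hP hL hk
    refine ⟨k', hks, fun x' hx' => ?_⟩
    obtain rfl := hinj x' hx'
    filter_upwards [hk', hkk, eventually_eventually_nhds.2 hkk] with y e1 e2 e3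
    refine ⟨fun hy => e2 ▸ e1.2.1.1 hy, fun hy hy' => ?_, fun hy => ⟨?_, ?_⟩⟩
    · rw [e2]
      exact lt_of_le_of_ne (not_lt.1 fun h' => hy' (e1.2.1.2 h')) fun h' => hy (e1.1.2 h')
    · rw [e2]
      exact e1.1.1 (Or.inl hy)
    · rw [← e1.2.2 hy]
      exact posSide_congr e3
  · have hx : x ∉ S.red ∪ S.blue := fun h' => h'.elim hxr hxb
    have hcol := h.shading.eventually_mem_white_iff hx
    have hreg : ∀ᶠ y in 𝓝 x, y ∉ S.red ∪ S.blue := h.shading.isOpen_regions.mem_nhds hx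
    by_cases hxw : x ∈ S.white
    · refine ⟨fun _ => 1, smoothNear_const, fun x' hx' => ?_⟩
      obtain rfl := hinj x' hx'
      filter_upwards [hcol, hreg] with y e1 e2
      exact ⟨fun _ => one_pos, fun _ hy => (hy (e1.2 hxw)).elim,
        fun hy => (e2 (Or.inl hy)).elim⟩
    · refine ⟨fun _ => -1, smoothNear_const, fun x' hx' => ?_⟩
      obtain rfl := hinj x' hx'
      filter_upwards [hcol, hreg] with y e1 e2
      exact ⟨fun hy => (hxw (e1.1 hy)).elim, fun _ _ => by norm_num,
        fun hy => (e2 (Or.inl hy)).elim⟩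

end IsFilling

end Local

/-! ### Adapted functions near a binding -/

section LocalBinding

variable {E H M : Type*} [NormedAddCommGroup E] [NormedSpace ℝ E] [TopologicalSpace H]
  {I : ModelWithCorners ℝ E H} [TopologicalSpace M] [ChartedSpace H M]
  {E' H' N : Type*} [NormedAddCommGroup E'] [NormedSpace ℝ E'] [TopologicalSpace H']
  {J : ModelWithCorners ℝ E' H'} [TopologicalSpace N] [ChartedSpace H' N]
  {V : TrivalentData I M} {S : ShadingData J N} {i : N → M}

theorem IsBindingModel.facet_equation [IsManifold I ∞ M] [FlatFaces I] {f g : M → ℝ} {p : M}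
    (h : IsBindingModel V f g p) : ∀ᶠ q in 𝓝 p,
      (f q = 0 → 0 < g q → IsLocalEquation I (V.blue ∪ V.red) q f ∧ V.pos q = posSide I f q) ∧
      (f q = 0 → g q < 0 →
        IsLocalEquation I (V.blue ∪ V.red) q (-f) ∧ V.pos q = posSide I (-f) q) ∧
      (0 < f q → g q = 0 → IsLocalEquation I (V.blue ∪ V.red) q g ∧ V.pos q = posSide I g q) := by
  filter_upwards [h.smooth_left.eventually, h.smooth_right.eventually,
    h.independent.eventually h.smooth_left h.smooth_right, h.eventually_iff,
    eventually_eventually_nhds.2 h.eventually_iff] with q h1 h2 h3 h4 h5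
  have key : f q = 0 → g q ≠ 0 → IsLocalEquation I (V.blue ∪ V.red) q f := fun hf hg =>
    ⟨h1, h3.regularAt_left, by
      filter_upwards [h5, h2.continuousAt.eventually (isOpen_ne.mem_nhds hg)] with y e1 e2
      have e2 : g y ≠ 0 := e2
      simp [e1.2.1, e1.2.2.1, e2]⟩
  refine ⟨fun hf hg => ⟨key hf hg.ne', ?_⟩, fun hf hg => ⟨(key hf hg.ne).neg, ?_⟩,
    fun hf hg => ⟨⟨h2, h3.symm.regularAt_left, ?_⟩, ?_⟩⟩
  · exact h4.2.2.2.2.1 (h4.2.1.2 ⟨hf, hg.ne'⟩) hg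
  · exact h4.2.2.2.2.2 (h4.2.1.2 ⟨hf, hg.ne⟩) hg
  · filter_upwards [h5, h1.continuousAt.eventually (lt_mem_nhds hf)] with y e1 e2
    have e2 : 0 < f y := e2
    simp [e1.2.1, e1.2.2.1, e2, e2.ne']
  · exact h4.2.2.2.1 (h4.2.2.1.2 ⟨hf, hg⟩)

theorem IndependentAt.neg_left {f g : M → ℝ} {p : M} (h : IndependentAt I f g p) :
    IndependentAt I (-f) g p := by
  obtain ⟨u, hu, v, hv, h1, h2, h3, h4⟩ := h.exists_dual
  exact independentAt_of_det hu hv (by simp [chartDiff_neg, h1, h2, h3, h4])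

theorem IndependentAt.neg_right {f g : M → ℝ} {p : M} (h : IndependentAt I f g p) :
    IndependentAt I f (-g) p := h.symm.neg_left.symm

theorem IndependentAt.of_smul_right {f g g' : M → ℝ} {p : M} (h : IndependentAt I f g p) {c : ℝ}
    (hc : c ≠ 0) (hg : chartDiff I g' p = c • chartDiff I g p) : IndependentAt I f g' p := by
  obtain ⟨u, hu, v, hv, h1, h2, h3, h4⟩ := h.exists_dual
  exact independentAt_of_det hu hv (by simp [hg, h1, h2, h3, h4, hc])

namespace IsFilling

variable [J.Boundaryless] [IsManifold J ∞ N] [IsManifold I ∞ M] [FlatFaces I]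

/-- The shading of the boundary near a crossing, in terms of a model of the binding. -/
theorem binding_boundary (h : IsFilling V S i) {x : N} {f g : M → ℝ}
    (hx : i x ∈ V.binding) (hm : IsBindingModel V f g (i x)) :
    ∃ k : N → ℝ, SmoothNear J k x ∧ chartDiff J k x ≠ 0 ∧
      posSide J k x = {v | mfderiv J I i x v ∈ posSide I g (i x)} ∧
      ∀ᶠ y in 𝓝 x, (y ∈ S.red ↔ k y = 0) ∧ (y ∈ S.blue ↔ f (i y) = 0) ∧
      (y ∈ S.white ↔ f (i y) * k y < 0) ∧ (y ∈ S.red → posSide J k y = S.redPos y) ∧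
      (0 ≤ f (i y) → SignType.sign (k y) = SignType.sign (g (i y))) := by
  have hi := h.boundaryMap.contMDiff
  have hic : Tendsto i (𝓝 x) (𝓝 (i x)) := hi.continuous.continuousAt
  obtain ⟨hxr, hxb⟩ := h.mem_binding.1 hx
  obtain ⟨k, hk, hkpos⟩ := h.shading.red_orientation.2 x hxr
  have hF : SmoothNear J (f ∘ i) x := SmoothNear.comp hi hm.smooth_left
  have hG : SmoothNear J (g ∘ i) x := SmoothNear.comp hi hm.smooth_right
  have hind : IndependentAt J (f ∘ i) (g ∘ i) x := h.boundaryMap.independentAt_comp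
    hm.smooth_left.mdifferentiableAt hm.smooth_right.mdifferentiableAt hm.independent
  have hmod := hic.eventually hm.eventually_iff
  -- Where `f > 0` the red facet of `∂V` is kept by `Γ`, so `k` and `g ∘ i` orient it alike; hence
  -- `k` has the sign of `g ∘ i` on `f ≥ 0`.
  obtain ⟨hsign, c, hc, hkc⟩ := sign_eq_of_posSide_eq hF hG hk.1 hm.left_eq_zero hm.right_eq_zero
    hind hk.2.1 (by
      filter_upwards [hmod, hkpos, hic.eventually hm.smooth_right.eventually]
        with y e1 e2 e3 hFy hGy
      have hyr := e1.2.2.1.2 ⟨hFy, hGy⟩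
      have hyk := h.mem_red.1 hyr
      rw [← e2 hyk.1.1, hyk.2, posSide_comp hi e3.mdifferentiableAt, ← e1.2.2.2.1 hyr,
        h.pos_eq_outward (Or.inr hyr)]) (by
      filter_upwards [hmod, hk.2.2] with y e1 e2 hFy hGy
      refine e2.1 ?_
      rcases hFy.eq_or_lt with hFy | hFy
      · exact (h.mem_binding.1 (e1.1.2 ⟨hFy.symm, hGy⟩)).1
      · exact (h.mem_red.1 (e1.2.2.1.2 ⟨hFy, hGy⟩)).1.1)
  have hindk : IndependentAt J (f ∘ i) k x := hind.of_smul_right hc.ne' hkc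
  have hblue : ∀ᶠ y in 𝓝 x, (y ∈ S.blue ↔ f (i y) = 0) := by
    filter_upwards [hmod] with y e1
    constructor
    · intro hy
      by_cases hyr : y ∈ S.red
      · exact (e1.1.1 (h.mem_binding.2 ⟨hyr, hy⟩)).1
      · exact (e1.2.1.1 (h.mem_blue.2 ⟨hy, hyr⟩)).1
    · intro hy
      by_cases hgy : g (i y) = 0
      · exact (h.mem_binding.1 (e1.1.2 ⟨hy, hgy⟩)).2
      · exact (h.mem_blue.1 (e1.2.1.2 ⟨hy, hgy⟩)).1
  have hregion : ∀ᶠ y in 𝓝 x, y ∈ S.red ∪ S.blue → f (i y) = 0 ∨ k y = 0 := by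
    filter_upwards [hblue, hk.2.2] with y e1 e2 hy
    exact hy.elim (fun h' => Or.inr (e2.1 h')) (fun h' => Or.inl (e1.1 h'))
  have hfacet := hic.eventually hm.facet_equation
  have hfacet' : ∀ᶠ y in 𝓝 x, f (i y) = 0 →
      (0 < k y → ∀ᶠ z in 𝓝 y, (z ∈ S.white ↔ f (i z) < 0)) ∧
      (k y < 0 → ∀ᶠ z in 𝓝 y, (z ∈ S.white ↔ 0 < f (i z))) := by
    filter_upwards [hfacet, hmod, hsign] with y e1 e2 e3 hfy
    have e3 := e3 hfy.ge
    refine ⟨fun hky => ?_, fun hky => ?_⟩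
    · rw [sign_pos hky, eq_comm, sign_eq_one_iff] at e3
      obtain ⟨e4, e5⟩ := e1.1 hfy e3
      exact (h.facet_boundary (Or.inl (e2.2.1.2 ⟨hfy, e3.ne'⟩)) e4 e5).mono fun z hz => hz.1
    · rw [sign_neg hky, eq_comm, sign_eq_neg_one_iff] at e3
      obtain ⟨e4, e5⟩ := e1.2.1 hfy e3
      refine (h.facet_boundary (Or.inl (e2.2.1.2 ⟨hfy, e3.ne⟩)) e4 e5).mono fun z hz => ?_
      simpa using hz.1
  have hkx := hk.eq_zero hxr
  have hFx : (f ∘ i) x = 0 := hm.left_eq_zero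
  -- Each quadrant gets its colour from the adjacent blue facet. The facets point out of white,
  -- towards `f > 0` where `k > 0` and towards `f < 0` where `k < 0`, so white is where `f` and `k`
  -- have opposite signs.
  have q1 := h.shading.eventually_quadrant hF hk.1 hFx hkx hindk hregion (w := False) (by
    filter_upwards [hfacet'] with y e1 e2 e3
    filter_upwards [(e1 e2).1 e3] with z e4 e5
    rw [e4]
    exact iff_of_false e5.not_gt id)
  have q2 := h.shading.eventually_quadrant hF.neg hk.1 (by simpa using hFx) hkx hindk.neg_left
    (by simpa using hregion) (w := True) (by
    filter_upwards [hfacet'] with y e1 e2 e3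
    filter_upwards [(e1 (by simpa using e2)).1 e3] with z e4 e5
    rw [e4]
    exact iff_of_true (by simpa using e5) trivial)
  have q3 := h.shading.eventually_quadrant hF hk.1.neg hFx (by simpa using hkx) hindk.neg_right
    (by simpa using hregion) (w := True) (by
    filter_upwards [hfacet'] with y e1 e2 e3
    filter_upwards [(e1 e2).2 (by simpa using e3)] with z e4 e5
    rw [e4]
    exact iff_of_true e5 trivial)
  have q4 := h.shading.eventually_quadrant hF.neg hk.1.neg (by simpa using hFx)
    (by simpa using hkx) hindk.neg_left.neg_right (by simpa using hregion) (w := False) (by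
    filter_upwards [hfacet'] with y e1 e2 e3
    filter_upwards [(e1 (by simpa using e2)).2 (by simpa using e3)] with z e4 e5
    rw [e4]
    exact iff_of_false (by simpa using (show 0 < -f (i z) from e5).le) id)
  refine ⟨k, hk.1, hk.chartDiff_ne_zero, ?_, ?_⟩
  · rw [posSide_eq_of_smul hc hkc, posSide_comp hi hm.smooth_right.mdifferentiableAt]
  filter_upwards [hk.2.2, hblue, hkpos, hsign, q1, q2, q3, q4]
    with y e1 e2 e3 e4 e5 e6 e7 e8
  refine ⟨e1, e2, ?_, fun hy => (e3 hy).symm, e4⟩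
  simp only [Function.comp_apply, Pi.neg_apply, Left.neg_pos_iff] at e5 e6 e7 e8
  by_cases hfy : f (i y) = 0
  · rw [hfy, zero_mul]
    exact iff_of_false (fun hy => h.shading.white_subset hy (Or.inr (e2.2 hfy))) (lt_irrefl _)
  by_cases hky : k y = 0
  · rw [hky, mul_zero]
    exact iff_of_false (fun hy => h.shading.white_subset hy (Or.inl (e1.2 hky))) (lt_irrefl _)
  rcases lt_or_gt_of_ne hfy with hfy | hfy <;> rcases lt_or_gt_of_ne hky with hky | hky
  · rw [e8 hfy hky]
    exact iff_of_false id (mul_pos_of_neg_of_neg hfy hky).not_gt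
  · rw [e6 hfy hky]
    exact iff_of_true trivial (mul_neg_of_neg_of_pos hfy hky)
  · rw [e7 hfy hky]
    exact iff_of_true trivial (mul_neg_of_pos_of_neg hfy hky)
  · rw [e5 hfy hky]
    exact iff_of_false id (mul_pos hfy hky).not_gt

/-- Near a binding, the equation of the red hypersurface of the boundary extends to `M`. -/
theorem exists_red_equation [FiniteDimensional ℝ E'] (hdim : Module.finrank ℝ E' ≤ 2)
    (h : IsFilling V S i) {p : M} {f g : M → ℝ} (hp : p ∈ V.binding)
    (hm : IsBindingModel V f g p) :
    ∃ k : M → ℝ, SmoothNear I k p ∧ chartDiff I k p ≠ 0 ∧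
      (∀ᶠ q in 𝓝 p, 0 ≤ f q → SignType.sign (k q) = SignType.sign (g q)) ∧
      ∀ x, i x = p → ∀ᶠ y in 𝓝 x, (y ∈ S.red ↔ k (i y) = 0) ∧ (y ∈ S.blue ↔ f (i y) = 0) ∧
        (y ∈ S.white ↔ f (i y) * k (i y) < 0) ∧
        (y ∈ S.red → posSide J (k ∘ i) y = S.redPos y) := by
  by_cases hpi : p ∈ range i
  swap
  · exact ⟨g, hm.smooth_right, hm.independent.symm.regularAt_left.chartDiff_ne_zero,
      Eventually.of_forall fun _ _ => rfl, fun x hx => (hpi ⟨x, hx⟩).elim⟩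
  obtain ⟨x, rfl⟩ := hpi
  obtain ⟨κ, hκ, hκ0, -, hκe⟩ := h.binding_boundary hp hm
  have hi := h.boundaryMap.contMDiff
  have hF : SmoothNear J (f ∘ i) x := SmoothNear.comp hi hm.smooth_left
  have hG : SmoothNear J (g ∘ i) x := SmoothNear.comp hi hm.smooth_right
  have hind : IndependentAt J (f ∘ i) (g ∘ i) x := h.boundaryMap.independentAt_comp
    hm.smooth_left.mdifferentiableAt hm.smooth_right.mdifferentiableAt hm.independent
  set A : E' →L[ℝ] ℝ × ℝ := (chartDiff J (f ∘ i) x).prod (chartDiff J (g ∘ i) x)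
  have hA : HasFDerivAt ((fun q => (f q, g q)) ∘ i ∘ (extChartAt J x).symm) A
      (extChartAt J x x) := by
    have h1 := hasFDerivWithinAt_chart hF.mdifferentiableAt
    have h2 := hasFDerivWithinAt_chart hG.mdifferentiableAt
    rw [J.range_eq_univ, hasFDerivWithinAt_univ] at h1 h2
    exact h1.prodMk h2
  have hsurj : Function.Surjective A := by
    obtain ⟨u, -, v, -, h1, h2, h3, h4⟩ := hind.exists_dual
    rintro ⟨a, b⟩
    exact ⟨a • u + b • v, by simp [A, h1, h2, h3, h4]⟩
  -- Here the bound on the dimension is used: `f` and `g` restrict to local coordinates on the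
  -- boundary. In dimension below two there is no such surjection, so no binding meets the boundary.
  have hrank : Module.finrank ℝ E' = Module.finrank ℝ (ℝ × ℝ) := by
    refine le_antisymm (by simpa using hdim) ?_
    exact LinearMap.finrank_le_finrank_of_surjective (f := (A : E' →ₗ[ℝ] ℝ × ℝ)) hsurj
  have hinj : Function.Injective A :=
    (LinearMap.injective_iff_surjective_of_finrank_eq_finrank
      (f := (A : E' →ₗ[ℝ] ℝ × ℝ)) hrank).2 hsurj
  set L : E' ≃L[ℝ] ℝ × ℝ :=
    (LinearEquiv.ofBijective (A : E' →ₗ[ℝ] ℝ × ℝ) ⟨hinj, hsurj⟩).toContinuousLinearEquiv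
  have hL : (L : E' →L[ℝ] ℝ × ℝ) = A := by
    ext v <;> rfl
  have hP : ∀ᶠ q in 𝓝 (i x), ContMDiffAt I 𝓘(ℝ, ℝ × ℝ) ∞ (fun q => (f q, g q)) q := by
    filter_upwards [hm.smooth_left, hm.smooth_right] with q e1 e2 using e1.prodMk_space e2
  have : CompleteSpace E' := FiniteDimensional.complete ℝ E'
  obtain ⟨k, hk, hkκ, hkP⟩ := exists_extension hi hP (L := L) (by rw [hL]; exact hA) hκ
  refine ⟨k, hk, fun h0 => hκ0 ?_, ?_, fun x' hx' => ?_⟩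
  · have h1 : k ∘ i =ᶠ[𝓝 x] κ := hkκ
    rw [← chartDiff_congr h1, chartDiff_comp hi hk.mdifferentiableAt, h0,
      ContinuousLinearMap.zero_comp]
  -- The value of `k` at `q` is that of `κ` at a boundary point with the same `f` and `g`, so the
  -- comparison of signs on `f ≥ 0` is inherited from the boundary.
  · filter_upwards [hkP _ hκe] with q ⟨y, e1, e2, e3⟩ hfq
    rw [Prod.mk.injEq] at e2
    rw [e3, ← e2.2]
    exact e1.2.2.2.2 (by rwa [e2.1])
  · obtain rfl := h.boundaryMap.isEmbedding.injective hx'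
    filter_upwards [hκe, hkκ, eventually_eventually_nhds.2 hkκ] with y e1 e2 e3
    rw [e2]
    refine ⟨e1.1, e1.2.1, e1.2.2.1, fun hy => ?_⟩
    rw [← e1.2.2.2.1 hy]
    exact posSide_congr e3

theorem exists_adapted_binding [FiniteDimensional ℝ E'] (hdim : Module.finrank ℝ E' ≤ 2)
    (h : IsFilling V S i) {p : M} (hp : p ∈ V.binding) :
    ∃ k : M → ℝ, ∀ᶠ q in 𝓝 p, IsAdaptedAt V S i k q := by
  obtain ⟨f, g, hm⟩ := h.trivalent.exists_bindingModel hp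
  obtain ⟨k, hk, hk0, hkg, hkb⟩ := h.exists_red_equation hdim hp hm
  -- The two formulas need not match along `f = 0`, but near `p` this set is contained in `V`, where
  -- no continuity is required.
  set φ : M → ℝ := fun q => if f q < 0 then k q else -(f q * g q) with hφ
  have hneg : ∀ q, f q < 0 → φ q = k q := fun q hq => by simp [hφ, hq]
  have hpos : ∀ q, 0 ≤ f q → φ q = -(f q * g q) := fun q hq => by simp [hφ, hq.not_gt]
  refine ⟨φ, ?_⟩
  filter_upwards [hm.eventually, hm.eventually_iff, hm.facet_equation, hm.smooth_left.eventually,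
    hm.smooth_right.eventually, hk.eventually, eventually_chartDiff_ne_zero hk hk0, hkg,
    eventually_eventually_nhds.2 hkg, h.eventually_forall_preimage hkb]
    with q h1 h2 h3 h4 h5 h6 h7 h8 h9 h10
  have hf_neg : f q < 0 → ∀ᶠ y in 𝓝 q, f y < 0 := fun h' =>
    h4.continuousAt.eventually (gt_mem_nhds h')
  have hf_pos : 0 < f q → ∀ᶠ y in 𝓝 q, 0 < f y := fun h' =>
    h4.continuousAt.eventually (lt_mem_nhds h')
  refine ⟨fun hq => ?_, fun hq => ?_, fun hq => ?_, fun y hy hw => ?_, fun y hy e1 e2 => ?_,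
    fun y hy e1 e2 => ?_⟩
  · rcases lt_trichotomy (f q) 0 with hf | hf | hf
    · exact h6.congr ((hf_neg hf).mono fun y hy => (hneg y hy).symm)
    · exfalso
      by_cases hg : g q = 0
      · exact hq (Or.inr (h2.1.2 ⟨hf, hg⟩))
      · exact hq (Or.inl (Or.inl (h2.2.1.2 ⟨hf, hg⟩)))
    · exact (h4.mul h5).neg.congr ((hf_pos hf).mono fun y hy => (hpos y hy.le).symm)
  · rcases hq with hq | hq
    · obtain ⟨hf, hg⟩ := h2.2.1.1 hq
      have hkq := h8 hf.ge
      rcases lt_or_gt_of_ne hg with hg | hg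
      · obtain ⟨e1, e2⟩ := h3.2.1 hf hg
        refine ⟨-f, e1, e2, ?_⟩
        rw [sign_neg hg, sign_eq_neg_one_iff] at hkq
        filter_upwards [h6.continuousAt.eventually (gt_mem_nhds hkq),
          h5.continuousAt.eventually (gt_mem_nhds hg)] with y e3 e4
        rw [Pi.neg_apply, Left.sign_neg, neg_neg]
        rcases lt_or_ge (f y) 0 with hy | hy
        · rw [hneg y hy, sign_neg hy, sign_neg e3]
        · rw [hpos y hy, Left.sign_neg, sign_mul, sign_neg e4]
          simp
      · obtain ⟨e1, e2⟩ := h3.1 hf hg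
        refine ⟨f, e1, e2, ?_⟩
        rw [sign_pos hg, sign_eq_one_iff] at hkq
        filter_upwards [h6.continuousAt.eventually (lt_mem_nhds hkq),
          h5.continuousAt.eventually (lt_mem_nhds hg)] with y e3 e4
        rcases lt_or_ge (f y) 0 with hy | hy
        · rw [hneg y hy, sign_neg hy, sign_pos e3]
          rfl
        · rw [hpos y hy, Left.sign_neg, sign_mul, sign_pos e4]
          simp
    · obtain ⟨hf, hg⟩ := h2.2.2.1.1 hq
      obtain ⟨e1, e2⟩ := h3.2.2 hf hg
      refine ⟨g, e1, e2, ?_⟩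
      filter_upwards [hf_pos hf] with y hy
      rw [hpos y hy.le, Left.sign_neg, sign_mul, sign_pos hy, one_mul]
  · have hmq := h1 hq
    refine ⟨f, g, k, hmq, h6, ?_, ?_⟩
    · have hkq : k q = 0 := by
        have := h8 hmq.left_eq_zero.ge
        rwa [hmq.right_eq_zero, sign_zero, sign_eq_zero_iff] at this
      obtain ⟨c, hc, hcg⟩ := chartDiff_eq_smul_of_sign_on h4.mdifferentiableAt
        h5.mdifferentiableAt h6.mdifferentiableAt hmq.left_eq_zero hmq.right_eq_zero hkq
        hmq.independent (by
          filter_upwards [h9] with y e1 e2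
          have e1 := e1 e2.le
          refine ⟨fun e3 => ?_, fun e3 => ?_⟩
          · rw [sign_pos e3, sign_eq_one_iff] at e1
            exact e1.le
          · rw [sign_neg e3, sign_eq_neg_one_iff] at e1
            exact e1.le)
      refine ⟨c, hc.lt_of_ne ?_, hcg⟩
      rintro rfl
      exact h7 (by simpa using hcg)
    · filter_upwards [h9] with y e1
      exact ⟨hneg y, fun hy => ⟨e1 hy, by rw [hpos y hy, Left.sign_neg]⟩⟩
  · have e1 := (h10 y hy).2.2.1.1 hw
    rw [hy] at e1
    rcases lt_or_ge (f q) 0 with hf | hf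
    · rw [hneg q hf]
      exact pos_of_mul_neg_right e1 hf.le
    · have hf' : f q ≠ 0 := by
        rintro h0
        simp [h0] at e1
      have hkq : k q < 0 := by
        by_contra! h'
        exact e1.not_ge (mul_nonneg hf h')
      have := h8 hf
      rw [sign_neg hkq, eq_comm, sign_eq_neg_one_iff] at this
      rw [hpos q hf]
      exact neg_pos.2 (mul_neg_of_pos_of_neg (hf.lt_of_ne' hf') this)
  · obtain ⟨e3, e4, e5, -⟩ := h10 y hy
    rw [hy] at e3 e4 e5
    have hf0 : f q ≠ 0 := fun h' => e1 (Or.inr (e4.2 h'))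
    have hk0 : k q ≠ 0 := fun h' => e1 (Or.inl (e3.2 h'))
    have hfk : 0 < f q * k q :=
      lt_of_le_of_ne (not_lt.1 fun h' => e2 (e5.2 h')) (mul_ne_zero hf0 hk0).symm
    rcases lt_or_gt_of_ne hf0 with hf | hf
    · rw [hneg q hf]
      exact neg_of_mul_pos_right hfk hf.le
    · have hkq : 0 < k q := pos_of_mul_pos_right hfk hf.le
      have := h8 hf.le
      rw [sign_pos hkq, eq_comm, sign_eq_one_iff] at this
      rw [hpos q hf.le]
      exact neg_neg_of_pos (mul_pos hf this)
  · obtain ⟨e3, e4, e5, e6⟩ := h10 y hy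
    rw [hy] at e3 e4 e5
    have hkq := e3.1 e1
    rcases lt_trichotomy (f q) 0 with hf | hf | hf
    · rw [hneg q hf]
      refine ⟨hkq, ?_⟩
      rw [← e6 e1]
      subst hy
      refine posSide_congr ?_
      exact (h.boundaryMap.contMDiff.continuous.continuousAt.eventually (hf_neg hf)).mono
        fun z hz => hneg _ hz
    · exfalso
      by_cases hg : g q = 0
      · exact e2 (Or.inr (h2.1.2 ⟨hf, hg⟩))
      · exact e2 (Or.inl (Or.inl (h2.2.1.2 ⟨hf, hg⟩)))
    · exfalso
      have := h8 hf.le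
      rw [hkq, sign_zero, eq_comm, sign_eq_zero_iff] at this
      exact e2 (Or.inl (Or.inr (h2.2.2.1.2 ⟨hf, this⟩)))

end IsFilling

end LocalBinding

/-! ### Affine perturbations making zero a regular value -/

section Perturbation

variable {E : Type*} [NormedAddCommGroup E] [NormedSpace ℝ E] {κ : Type*}

/-- The affine functions `1` and the coordinates with respect to a basis. -/
def affineCoord (b : Module.Basis κ ℝ E) : Option κ → E → ℝ
  | none => fun _ => 1
  | some k => b.coord k

theorem contDiff_affineCoord [FiniteDimensional ℝ E] (b : Module.Basis κ ℝ E) (a : Option κ) :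
    ContDiff ℝ ∞ (affineCoord b a) := by
  cases a with
  | none => exact contDiff_const
  | some k => exact (b.coord k).toContinuousLinearMap.contDiff

/-- Zero is a regular value of almost every affine perturbation of a function. -/
theorem dense_affine_perturbation [FiniteDimensional ℝ E] [Fintype κ] (b : Module.Basis κ ℝ E)
    {F : E → ℝ} {Ω : Set E} (hF : ∀ x ∈ Ω, ContDiffAt ℝ 2 F x) :
    Dense {t : Option κ → ℝ | ∀ x ∈ Ω, ¬ (F x + ∑ a, t a * affineCoord b a x = 0 ∧
      HasFDerivAt (fun y => F y + ∑ a, t a * affineCoord b a y) (0 : E →L[ℝ] ℝ) x)} := by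
  -- `Φ x` is the only parameter for which `x` is a degenerate zero: the vanishing derivative fixes
  -- the linear coefficients, and then the vanishing value fixes the constant. The bad parameters
  -- thus lie in a locally Lipschitz image of a subset of `E`, in a space of one dimension more.
  set Φ : E → Option κ → ℝ := fun x a =>
    Option.elim a (fderiv ℝ F x x - F x) fun k => -fderiv ℝ F x (b k)
  have hΦ : ∀ x ∈ Ω, ContDiffAt ℝ 1 Φ x := by
    intro x hx
    have h1 : ContDiffAt ℝ 1 (fderiv ℝ F) x := (hF x hx).fderiv_right (by norm_num)
    have h2 : ContDiffAt ℝ 1 F x := (hF x hx).of_le (by norm_num)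
    rw [contDiffAt_pi]
    intro a
    cases a with
    | none => exact (h1.clm_apply contDiffAt_id).sub h2
    | some k => exact (h1.clm_apply contDiffAt_const).neg
  have hdim : dimH (Φ '' Ω) < Module.finrank ℝ (Option κ → ℝ) := by
    calc dimH (Φ '' Ω) ≤ dimH Ω := by
          refine dimH_image_le_of_locally_lipschitzOn fun x hx => ?_
          obtain ⟨K, s, hs, h⟩ := (hΦ x hx).exists_lipschitzOnWith
          exact ⟨K, s, mem_nhdsWithin_of_mem_nhds hs, h⟩
      _ ≤ dimH (univ : Set E) := dimH_mono (subset_univ _)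
      _ = Module.finrank ℝ E := Real.dimH_univ_eq_finrank E
      _ < Module.finrank ℝ (Option κ → ℝ) := by
          rw [Module.finrank_fintype_fun_eq_card, Fintype.card_option,
            Module.finrank_eq_card_basis b]
          exact_mod_cast Nat.lt_succ_self _
  have hdense : Dense (Φ '' Ω)ᶜ := dense_compl_of_dimH_lt_finrank hdim
  refine Dense.mono ?_ hdense
  rintro t ht x hx ⟨h1, h2⟩
  refine ht ⟨x, hx, ?_⟩
  have hd : HasFDerivAt (fun y => F y + ∑ a, t a * affineCoord b a y)
      (fderiv ℝ F x + ∑ k, t (some k) • (b.coord k).toContinuousLinearMap) x := by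
    have h3 : HasFDerivAt (fun y => ∑ k, t (some k) * b.coord k y)
        (∑ k, t (some k) • (b.coord k).toContinuousLinearMap) x :=
      HasFDerivAt.fun_sum fun k _ =>
        ((b.coord k).toContinuousLinearMap.hasFDerivAt (x := x)).const_mul (t (some k))
    have h4 := ((hF x hx).differentiableAt (by norm_num)).hasFDerivAt.add
      ((hasFDerivAt_const (t none) x).add h3)
    rw [zero_add] at h4
    refine h4.congr_of_eventuallyEq (Eventually.of_forall fun y => ?_)
    simp [Fintype.sum_option, affineCoord]
  have h3 := hd.unique h2
  have h4 : ∀ k, fderiv ℝ F x (b k) = -t (some k) := by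
    intro k
    have := DFunLike.congr_fun h3 (b k)
    simp only [add_apply, sum_apply, smul_apply, LinearMap.coe_toContinuousLinearMap',
      Module.Basis.coord_apply, Module.Basis.repr_self, zero_apply, smul_eq_mul] at this
    rw [Finset.sum_eq_single k] at this
    · rw [Finsupp.single_eq_same, mul_one] at this
      linarith
    · intro l _ hl
      simp [hl.symm]
    · simp
  have h5 : fderiv ℝ F x x = -∑ k, t (some k) * b.coord k x := by
    have := DFunLike.congr_fun h3 x
    simp only [add_apply, sum_apply, smul_apply, LinearMap.coe_toContinuousLinearMap',
      zero_apply, smul_eq_mul] at this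
    linarith
  funext a
  cases a with
  | none =>
    simp only [Fintype.sum_option, affineCoord, mul_one] at h1
    simp only [Φ, Option.elim, h5]
    linarith
  | some k => simp [Φ, h4]

variable {H M : Type*} [TopologicalSpace H]
  {I : ModelWithCorners ℝ E H} [TopologicalSpace M] [ChartedSpace H M]

theorem chartDiff_sum {α : Type*} {s : Finset α} {f : α → M → ℝ} {p : M}
    (hf : ∀ a ∈ s, MDifferentiableAt I 𝓘(ℝ, ℝ) (f a) p) :
    MDifferentiableAt I 𝓘(ℝ, ℝ) (fun y => ∑ a ∈ s, f a y) p ∧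
      chartDiff I (fun y => ∑ a ∈ s, f a y) p = ∑ a ∈ s, chartDiff I (f a) p := by
  classical
  induction s using Finset.induction_on with
  | empty => exact ⟨mdifferentiableAt_const, mfderiv_const⟩
  | insert a s ha ih =>
    rw [Finset.forall_mem_insert] at hf
    simp only [Finset.sum_insert ha]
    refine ⟨hf.1.add (ih hf.2).1, ?_⟩
    rw [← (ih hf.2).2]
    exact chartDiff_add hf.1 (ih hf.2).1

theorem chartDiff_const_mul {f : M → ℝ} {p : M} (c : ℝ)
    (hf : MDifferentiableAt I 𝓘(ℝ, ℝ) f p) :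
    chartDiff I (fun y => c * f y) p = c • chartDiff I f p :=
  const_smul_mfderiv hf c

theorem SmoothNear.sum_mul {α : Type*} {s : Finset α} {f : α → M → ℝ} {θ : α → ℝ} {p : M}
    (hf : ∀ a, ContMDiff I 𝓘(ℝ, ℝ) ∞ (f a)) : SmoothNear I (fun y => ∑ a ∈ s, θ a * f a y) p :=
  Eventually.of_forall fun y => ContMDiffAt.sum fun a _ => contMDiffAt_const.mul (hf a y)

variable [IsManifold I ∞ M]

/-- Zero is a regular value of almost every perturbation by an affine function in a chart,
multiplied by a function `ψ`, where `ψ` does not vanish. -/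
theorem dense_chart_perturbation [FiniteDimensional ℝ E] [Fintype κ] (b : Module.Basis κ ℝ E)
    (c : M) {h ψ : M → ℝ} {W : Set M} (hψ : ∀ q ∈ W, ψ q ≠ 0 ∧ SmoothNear I ψ q)
    (hh : ∀ q ∈ W, SmoothNear I h q)
    (hW : ∀ q ∈ W, q ∈ (extChartAt I c).source ∧ range I ∈ 𝓝 (extChartAt I c q)) :
    Dense {t : Option κ → ℝ | ∀ q ∈ W, (h q + ∑ a, t a * (ψ q * affineCoord b a (extChartAt I c q))
      = 0) → chartDiff I
        (fun y => h y + ∑ a, t a * (ψ y * affineCoord b a (extChartAt I c y))) q ≠ 0} := by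
  -- Dividing by `ψ` reduces to affine perturbations of `h / ψ`: the zeros are the same, and at a
  -- zero the differentials differ by the factor `ψ q`.
  set F : E → ℝ := (fun q => (ψ q)⁻¹ * h q) ∘ (extChartAt I c).symm
  have hR : ∀ q ∈ W, SmoothNear I (fun q => (ψ q)⁻¹ * h q) q := by
    intro q hq
    filter_upwards [(hψ q hq).2, hh q hq,
      (hψ q hq).2.continuousAt.eventually (isOpen_ne.mem_nhds (hψ q hq).1)] with y h1 h2 h3
    exact (h1.inv₀ h3).mul h2
  have hF : ∀ x ∈ extChartAt I c '' W, ContDiffAt ℝ 2 F x := by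
    rintro _ ⟨q, hq, rfl⟩
    have h1 := (contMDiffAt_iff_of_mem_source (x' := q) (x := c) (y := (0 : ℝ))
      (by simpa using (hW q hq).1) (mem_univ _)).1 (hR q hq).contMDiffAt
    have h2 := h1.2
    simp only [extChartAt_model_space_eq_id, PartialEquiv.refl_coe, Function.id_comp] at h2
    exact ((h2.contDiffAt (hW q hq).2).of_le (by norm_cast))
  refine (dense_affine_perturbation b hF).mono fun t ht q hq h0 hd => ?_
  refine ht _ ⟨q, hq, rfl⟩ ?_
  obtain ⟨hqs, hqr⟩ := hW q hq
  have hinv := (extChartAt I c).left_inv hqs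
  set A : M → ℝ := fun y => ∑ a, t a * affineCoord b a (extChartAt I c y)
  set R : M → ℝ := fun y => (ψ y)⁻¹ * h y + A y
  have hA : ContMDiffAt I 𝓘(ℝ, ℝ) ∞ A q := by
    refine ContMDiffAt.sum fun a _ => contMDiffAt_const.mul ?_
    have := (contMDiffAt_extChartAt' (I := I) (n := ∞) (x := c) (x' := q)
      (by simpa using hqs))
    exact (contDiff_affineCoord b a).contDiffAt.contMDiffAt.comp q this
  have hRd : MDifferentiableAt I 𝓘(ℝ, ℝ) R q :=
    ((hR q hq).contMDiffAt.add hA).mdifferentiableAt (by simp)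
  have hfac : ∀ᶠ y in 𝓝 q, h y + ∑ a, t a * (ψ y * affineCoord b a (extChartAt I c y)) =
      (ψ * R) y := by
    filter_upwards [(hψ q hq).2.continuousAt.eventually (isOpen_ne.mem_nhds (hψ q hq).1)]
      with y hy
    simp only [Pi.mul_apply, R, A, mul_add, mul_inv_cancel_left₀ hy, Finset.mul_sum]
    congr 1
    exact Finset.sum_congr rfl fun a _ => by ring
  have hR0 : R q = 0 := by
    have := hfac.self_of_nhds
    rw [h0] at this
    exact (mul_eq_zero.1 this.symm).resolve_left (hψ q hq).1
  rw [chartDiff_congr hfac, chartDiff_mul_of_eq_zero (hψ q hq).2.mdifferentiableAt hRd hR0,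
    smul_eq_zero] at hd
  have hd' := hd.resolve_left (hψ q hq).1
  have h1 := (hasFDerivWithinAt_chart_of_mem hqs hRd).hasFDerivAt hqr
  rw [hd', ContinuousLinearMap.zero_comp] at h1
  have heq : ∀ᶠ y in 𝓝 (extChartAt I c q), F y + ∑ a, t a * affineCoord b a y =
      (R ∘ (extChartAt I c).symm) y := by
    have htarget : (extChartAt I c).target ∈ 𝓝 (extChartAt I c q) := by
      have := extChartAt_target_mem_nhdsWithin_of_mem (I := I) ((extChartAt I c).map_source hqs)
      rwa [nhdsWithin_eq_nhds.2 hqr] at this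
    filter_upwards [htarget] with y hy
    simp only [F, R, A, Function.comp_apply, (extChartAt I c).right_inv hy]
  refine ⟨?_, h1.congr_of_eventuallyEq heq⟩
  rw [heq.self_of_nhds, Function.comp_apply, hinv, hR0]

end Perturbation

/-! ### Regular zeros by a Baire category argument -/

section Baire

variable {E H M : Type*} [NormedAddCommGroup E] [NormedSpace ℝ E] [TopologicalSpace H]
  {I : ModelWithCorners ℝ E H} [TopologicalSpace M] [ChartedSpace H M] {α : Type*}

/-- The function `h` plus a linear combination of a locally finite family. -/
def perturb {M : Type*} (h : M → ℝ) (u : α → M → ℝ) (θ : α → ℝ) (q : M) : ℝ :=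
  h q + ∑ᶠ a, θ a * u a q

variable {h : M → ℝ} {u : α → M → ℝ}

theorem perturb_eq_sum {M : Type*} {h : M → ℝ} {u : α → M → ℝ} {s : Finset α} {q : M}
    (hs : ∀ a ∉ s, u a q = 0) (θ : α → ℝ) :
    perturb h u θ q = h q + ∑ a ∈ s, θ a * u a q := by
  rw [perturb, finsum_eq_sum_of_support_subset]
  intro a ha
  by_contra h'
  exact ha (by simp [hs a h'])

theorem chartDiff_perturb {s : Finset α} {q : M} (hs : ∀ᶠ y in 𝓝 q, ∀ a ∉ s, u a y = 0)
    (hh : SmoothNear I h q) (hu : ∀ a, ContMDiff I 𝓘(ℝ, ℝ) ∞ (u a)) (θ : α → ℝ) :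
    SmoothNear I (perturb h u θ) q ∧
      chartDiff I (perturb h u θ) q = chartDiff I h q + ∑ a ∈ s, θ a • chartDiff I (u a) q := by
  have heq : (h + fun y => ∑ a ∈ s, θ a * u a y) =ᶠ[𝓝 q] perturb h u θ := by
    filter_upwards [hs] with y hy
    exact (perturb_eq_sum hy θ).symm
  have hd : ∀ a, MDifferentiableAt I 𝓘(ℝ, ℝ) (u a) q := fun a =>
    (hu a q).mdifferentiableAt (by simp)
  refine ⟨(hh.add (SmoothNear.sum_mul hu)).congr heq, ?_⟩
  have h1 := chartDiff_sum (I := I) (s := s) (f := fun a y => θ a * u a y) (p := q)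
    fun a _ => (contMDiffAt_const.mul (hu a q)).mdifferentiableAt (by simp)
  rw [← chartDiff_congr heq, chartDiff_add hh.mdifferentiableAt h1.1, h1.2]
  congr 1
  exact Finset.sum_congr rfl fun a _ => chartDiff_const_mul _ (hd a)

/-- Regularity of the zeros in a compact set is an open condition on the perturbation. -/
theorem isOpen_regular_perturb [IsManifold I ∞ M] [FlatFaces I] {K : Set M} (hK : IsCompact K)
    (hh : ∀ q ∈ K, SmoothNear I h q) (hu : ∀ a, ContMDiff I 𝓘(ℝ, ℝ) ∞ (u a))
    (hs : ∀ q, ∃ s : Finset α, ∀ᶠ y in 𝓝 q, ∀ a ∉ s, u a y = 0) :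
    IsOpen {θ : α → ℝ | ∀ q ∈ K, perturb h u θ q = 0 → chartDiff I (perturb h u θ) q ≠ 0} := by
  rw [isOpen_iff_mem_nhds]
  intro θ hθ
  refine hK.eventually_forall_of_forall_eventually
    (P := fun θ q => perturb h u θ q = 0 → chartDiff I (perturb h u θ) q ≠ 0) fun q hq => ?_
  obtain ⟨s, hs⟩ := hs q
  have hev : ∀ᶠ z : (α → ℝ) × M in 𝓝 (θ, q), (∀ᶠ y in 𝓝 z.2, ∀ a ∉ s, u a y = 0) ∧
      SmoothNear I h z.2 := by
    have hsnd : Tendsto (fun z : (α → ℝ) × M => z.2) (𝓝 (θ, q)) (𝓝 q) := continuousAt_snd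
    exact hsnd.eventually ((eventually_eventually_nhds.2 hs).and (hh q hq).eventually)
  have hcoef : ∀ a, Tendsto (fun z : (α → ℝ) × M => z.1 a) (𝓝 (θ, q)) (𝓝 (θ a)) := fun a =>
    (by fun_prop : Continuous fun z : (α → ℝ) × M => z.1 a).tendsto _
  have hsnd : Tendsto (fun z : (α → ℝ) × M => z.2) (𝓝 (θ, q)) (𝓝 q) := continuousAt_snd
  by_cases h0 : perturb h u θ q = 0
  · obtain ⟨v, hv⟩ : ∃ v, chartDiff I (perturb h u θ) q v ≠ 0 := by
      by_contra! h'
      exact hθ q hq h0 (ContinuousLinearMap.ext h')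
    -- Testing the differential on one vector field reduces the claim to a function of the parameter
    -- and the point that is continuous at `(θ, q)` and nonzero there.
    obtain ⟨X, -, hX⟩ := exists_vector_field (I := I) q v
    have hlim : Tendsto (fun z : (α → ℝ) × M => chartDiff I h z.2 (X z.2) +
        ∑ a ∈ s, z.1 a * chartDiff I (u a) z.2 (X z.2)) (𝓝 (θ, q))
        (𝓝 (chartDiff I h q v + ∑ a ∈ s, θ a * chartDiff I (u a) q v)) :=
      ((hX h (hh q hq)).comp hsnd).add (tendsto_finsetSum s fun a _ => (hcoef a).mul
        ((hX (u a) (Eventually.of_forall (hu a))).comp hsnd))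
    have hne : chartDiff I h q v + ∑ a ∈ s, θ a * chartDiff I (u a) q v ≠ 0 := by
      rw [(chartDiff_perturb hs (hh q hq) hu θ).2] at hv
      simpa using hv
    filter_upwards [hev, hlim.eventually (isOpen_ne.mem_nhds hne)] with z h1 h2 _ h3
    have h4 := DFunLike.congr_fun (((chartDiff_perturb h1.1 h1.2 hu z.1).2).symm.trans h3) (X z.2)
    exact h2 (by simpa using h4)
  · have hlim : Tendsto (fun z : (α → ℝ) × M => h z.2 + ∑ a ∈ s, z.1 a * u a z.2) (𝓝 (θ, q))
        (𝓝 (h q + ∑ a ∈ s, θ a * u a q)) :=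
      ((hh q hq).continuousAt.tendsto.comp hsnd).add (tendsto_finsetSum s fun a _ =>
        (hcoef a).mul (((hu a).continuous.tendsto q).comp hsnd))
    rw [← perturb_eq_sum hs.self_of_nhds] at hlim
    filter_upwards [hev, hlim.eventually (isOpen_ne.mem_nhds h0)] with z h1 h2 h3
    exact (h2 ((perturb_eq_sum h1.1.self_of_nhds z.1).symm.trans h3)).elim

theorem chartDiff_eq_zero_of_nonneg {ψ : M → ℝ} {q : M} (hq : range I ∈ 𝓝 (extChartAt I q q))
    (hψ : MDifferentiableAt I 𝓘(ℝ, ℝ) ψ q) (h0 : ψ q = 0) (hnn : ∀ y, 0 ≤ ψ y) :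
    chartDiff I ψ q = 0 := by
  refine IsLocalMin.hasFDerivAt_eq_zero (Eventually.of_forall fun x => ?_)
    ((hasFDerivWithinAt_chart hψ).hasFDerivAt hq)
  simp only [Function.comp_apply, extChartAt_to_inv, h0, hnn]

/-- A function which is smooth outside a closed set `A` can be changed away from `A`, so that its
zeros outside `A` become regular, if those near `A` are. -/
theorem exists_regular_perturbation [FiniteDimensional ℝ E] [IsManifold I ∞ M] [FlatFaces I]
    [T2Space M] [SigmaCompactSpace M] {A O : Set M} (hA : IsClosed A) (hO : IsOpen O)
    (hAO : A ⊆ O) (hinn : ∀ q ∉ A, range I ∈ 𝓝 (extChartAt I q q))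
    (hh : ∀ q ∉ A, SmoothNear I h q)
    (hreg : ∀ q ∈ O, q ∉ A → h q = 0 → chartDiff I h q ≠ 0) :
    ∃ h' : M → ℝ, (∀ q ∈ A, h =ᶠ[𝓝 q] h') ∧ ∀ q ∉ A, SmoothNear I h' q ∧
      (h' q = 0 → chartDiff I h' q ≠ 0) := by
  classical
  have hU : ∀ c ∈ Oᶜ, {q | q ∈ (extChartAt I c).source ∧ range I ∈ 𝓝 (extChartAt I c q)} ∩ Aᶜ ∈
      𝓝 c := by
    intro c hc
    have hcA : c ∉ A := fun h' => hc (hAO h')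
    refine inter_mem ?_ (hA.isOpen_compl.mem_nhds hcA)
    filter_upwards [extChartAt_source_mem_nhds (I := I) c,
      (continuousAt_extChartAt c).eventually (eventually_mem_nhds_iff.2 (hinn c hcA))] with q h1 h2
    exact ⟨h1, h2⟩
  obtain ⟨ι, ψ, hψ⟩ := SmoothBumpCovering.exists_isSubordinate I hO.isClosed_compl hU
  -- Countability leaves countably many conditions and makes the space of parameters completely
  -- metrizable, so that Baire's theorem applies.
  have hcount : Countable ι := by
    rw [← countable_univ_iff]
    refine ψ.locallyFinite'.countable_univ fun j => ⟨ψ.c j, ?_⟩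
    rw [Function.mem_support, (ψ.toFun j).eventuallyEq_one.self_of_nhds]
    exact one_ne_zero
  set κ := Module.Basis.ofVectorSpaceIndex ℝ E
  have b : Module.Basis κ ℝ E := Module.Basis.ofVectorSpace ℝ E
  have : Fintype κ := FiniteDimensional.fintypeBasisIndex b
  set u : ι × Option κ → M → ℝ := fun p q =>
    ψ.toFun p.1 q * affineCoord b p.2 (extChartAt I (ψ.c p.1) q) with hudef
  have hu : ∀ p, ContMDiff I 𝓘(ℝ, ℝ) ∞ (u p) := fun p =>
    (ψ.toFun p.1).contMDiff_smul
      ((contDiff_affineCoord b p.2).contMDiff.comp_contMDiffOn contMDiffOn_extChartAt)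
  have hs : ∀ q, ∃ s : Finset ι, ∀ᶠ y in 𝓝 q, ∀ j ∉ s, ψ.toFun j y = 0 := by
    intro q
    obtain ⟨t, ht, hfin⟩ := ψ.locallyFinite' q
    refine ⟨hfin.toFinset, ?_⟩
    filter_upwards [ht] with y hy j hj
    by_contra h'
    exact hj (hfin.mem_toFinset.2 ⟨y, h', hy⟩)
  have hs' : ∀ q, ∃ s : Finset (ι × Option κ), ∀ᶠ y in 𝓝 q, ∀ p ∉ s, u p y = 0 := by
    intro q
    obtain ⟨s, hs⟩ := hs q
    refine ⟨s ×ˢ Finset.univ, ?_⟩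
    filter_upwards [hs] with y hy p hp
    rw [hudef]
    simp only
    rw [hy p.1 (by simpa using hp), zero_mul]
  have hsm : ∀ q ∉ A, ∀ θ, SmoothNear I (perturb h u θ) q := fun q hq θ => by
    obtain ⟨s, hs⟩ := hs' q
    exact (chartDiff_perturb hs (hh q hq) hu θ).1
  -- These compact sets exhaust the points where some bump function is positive. Their compactness
  -- gives open conditions, and `ψ.toFun j` does not vanish on them, which gives dense ones.
  set K : ι → ℕ → Set M := fun j n => {q | (1 : ℝ) / (n + 1) ≤ ψ.toFun j q}
  have hKs : ∀ j n, K j n ⊆ tsupport (ψ.toFun j) := fun j n q hq => by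
    refine subset_tsupport _ (ne_of_gt (lt_of_lt_of_le ?_ hq))
    positivity
  have hKA : ∀ j n, ∀ q ∈ K j n, q ∉ A := fun j n q hq => (hψ j (hKs j n hq)).2
  set G : ι × ℕ → Set (ι × Option κ → ℝ) := fun z =>
    {θ | ∀ q ∈ K z.1 z.2, perturb h u θ q = 0 → chartDiff I (perturb h u θ) q ≠ 0}
  have hGo : ∀ z, IsOpen (G z) := by
    intro z
    refine isOpen_regular_perturb (IsCompact.of_isClosed_subset (ψ.toFun z.1).hasCompactSupport
      ?_ (hKs z.1 z.2)) (fun q hq => hh q (hKA _ _ q hq)) hu hs'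
    exact isClosed_le continuous_const (ψ.toFun z.1).contMDiff.continuous
  have hGd : ∀ z, Dense (G z) := by
    rintro ⟨j, n⟩ θ
    -- For density it is enough to vary the coefficients belonging to `j`; the other terms are
    -- absorbed into the unperturbed function.
    set σ : (Option κ → ℝ) → ι × Option κ → ℝ := fun t p => if p.1 = j then t p.2 else θ p
    have hσ : Continuous σ := by
      refine continuous_pi fun p => ?_
      by_cases hp : p.1 = j
      · simpa [σ, hp] using continuous_apply p.2
      · simpa [σ, hp] using continuous_const
    have hσθ : σ (fun a => θ (j, a)) = θ := by
      funext p
      by_cases hp : p.1 = j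
      · obtain ⟨j', a⟩ := p
        simp only at hp
        simp [σ, hp]
      · simp [σ, hp]
    have hslice : ∀ t, perturb h u (σ t) = fun q => perturb h u (σ 0) q +
        ∑ a, t a * (ψ.toFun j q * affineCoord b a (extChartAt I (ψ.c j) q)) := by
      intro t
      funext q
      obtain ⟨s, hs⟩ := hs q
      have hz : ∀ p ∉ (insert j s) ×ˢ (Finset.univ : Finset (Option κ)), u p q = 0 := by
        intro p hp
        rw [hudef]
        simp only
        rw [hs.self_of_nhds p.1 (fun h' => hp (by simp [h'])), zero_mul]
      rw [perturb_eq_sum hz, perturb_eq_sum hz, add_assoc, Finset.sum_product,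
        Finset.sum_product, ← Finset.add_sum_erase _ _ (Finset.mem_insert_self j s),
        ← Finset.add_sum_erase _ _ (Finset.mem_insert_self j s)]
      have e1 : ∀ t, ∑ x ∈ (insert j s).erase j, ∑ y, σ t (x, y) * u (x, y) q =
          ∑ x ∈ (insert j s).erase j, ∑ y, θ (x, y) * u (x, y) q := fun t => by
        refine Finset.sum_congr rfl fun x hx => Finset.sum_congr rfl fun y _ => ?_
        simp [σ, (Finset.mem_erase.1 hx).1]
      rw [e1, e1]
      simp only [σ, if_true, Pi.zero_apply, zero_mul, Finset.sum_const_zero, zero_add]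
      rw [add_comm (Finset.sum _ _)]
    have hdense := dense_chart_perturbation (I := I) b (ψ.c j) (h := perturb h u (σ 0))
      (ψ := ψ.toFun j) (W := K j n)
      (fun q hq => ⟨ne_of_gt (lt_of_lt_of_le (by positivity) hq),
        Eventually.of_forall (ψ.toFun j).contMDiff⟩)
      (fun q hq => hsm q (hKA j n q hq) _) (fun q hq => (hψ j (hKs j n hq)).1)
    rw [mem_closure_iff_nhds]
    intro W hW
    rw [← hσθ] at hW
    have hW' : σ ⁻¹' W ∈ 𝓝 fun a => θ (j, a) := hσ.continuousAt.preimage_mem_nhds hW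
    obtain ⟨t, ht, htW⟩ := hdense.inter_nhds_nonempty hW'
    refine ⟨σ t, htW, ?_⟩
    simp only [G, mem_ofPred_eq, hslice t]
    exact ht
  obtain ⟨θ, hθ⟩ := (dense_iInter_of_isOpen hGo hGd).nonempty
  rw [mem_iInter] at hθ
  refine ⟨perturb h u θ, fun q hq => ?_, fun q hq => ⟨hsm q hq θ, fun h0 hd => ?_⟩⟩
  · have hlf : LocallyFinite fun j => tsupport (ψ.toFun j) := ψ.locallyFinite'.closure
    have hcl : IsClosed (⋃ j, tsupport (ψ.toFun j)) :=
      hlf.isClosed_iUnion fun j => isClosed_tsupport _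
    have hq' : q ∉ ⋃ j, tsupport (ψ.toFun j) := by
      rw [mem_iUnion]
      rintro ⟨j, hj⟩
      exact (hψ j hj).2 hq
    filter_upwards [hcl.isOpen_compl.mem_nhds hq'] with y hy
    rw [perturb_eq_sum (s := ∅) fun p _ => ?_]
    · simp
    · rw [hudef]
      simp only
      rw [image_eq_zero_of_notMem_tsupport fun h' => hy (mem_iUnion.2 ⟨p.1, h'⟩), zero_mul]
  · by_cases hpos : ∃ j, 0 < ψ.toFun j q
    · obtain ⟨j, hj⟩ := hpos
      obtain ⟨n, hn⟩ := exists_nat_one_div_lt hj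
      exact hθ (j, n) q hn.le h0 hd
    · push Not at hpos
      have hz : ∀ j, ψ.toFun j q = 0 := fun j => le_antisymm (hpos j) (ψ.toFun j).nonneg
      have hqO : q ∈ O := by
        by_contra h'
        obtain ⟨j, hj⟩ := ψ.eventuallyEq_one' q h'
        have := hj.self_of_nhds
        rw [hz j] at this
        exact zero_ne_one this
      -- The bump functions are nonnegative, so at an interior point where they vanish their
      -- differentials vanish too. There the perturbation changes neither the value nor the
      -- differential of `h`, and `q` lies in `O`, where zeros are regular already.
      have hu0 : ∀ p, u p q = 0 ∧ chartDiff I (u p) q = 0 := by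
        intro p
        refine ⟨by simp [hudef, hz], ?_⟩
        by_cases hq' : q ∈ tsupport (ψ.toFun p.1)
        · have hsrc := (hψ p.1 hq').1.1
          have hψd : MDifferentiableAt I 𝓘(ℝ, ℝ) (ψ.toFun p.1) q :=
            ((ψ.toFun p.1).contMDiff q).mdifferentiableAt (by simp)
          have h1 : MDifferentiableAt I 𝓘(ℝ, ℝ)
              (fun y => affineCoord b p.2 (extChartAt I (ψ.c p.1) y)) q :=
            ((contDiff_affineCoord b p.2).contDiffAt.contMDiffAt.comp q
              (contMDiffAt_extChartAt' (I := I) (n := ∞) (by simpa using hsrc))).mdifferentiableAt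
              (by simp)
          have h2 := chartDiff_mul_of_eq_zero h1 hψd (hz p.1)
          rw [chartDiff_eq_zero_of_nonneg (hinn q hq) hψd (hz p.1)
            (fun y => (ψ.toFun p.1).nonneg), smul_zero] at h2
          rw [← h2]
          refine chartDiff_congr (Eventually.of_forall fun y => ?_)
          simp only [hudef, Pi.mul_apply, mul_comm]
        · have : u p =ᶠ[𝓝 q] fun _ => 0 := by
            filter_upwards [(isClosed_tsupport (ψ.toFun p.1)).isOpen_compl.mem_nhds hq'] with y hy
            rw [hudef]
            simp only
            rw [image_eq_zero_of_notMem_tsupport hy, zero_mul]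
          rw [chartDiff_congr this]
          exact mfderiv_const
      obtain ⟨s, hs⟩ := hs' q
      refine hreg q hqO hq ?_ ?_
      · rw [perturb_eq_sum hs.self_of_nhds] at h0
        simpa [hu0] using h0
      · rw [(chartDiff_perturb hs (hh q hq) hu θ).2] at hd
        simpa [hu0] using hd

end Baire

/-! ### An adapted function with regular zeros -/

section Regular

variable {E H M : Type*} [NormedAddCommGroup E] [NormedSpace ℝ E] [TopologicalSpace H]
  {I : ModelWithCorners ℝ E H} [TopologicalSpace M] [ChartedSpace H M]
  {E' H' N : Type*} [NormedAddCommGroup E'] [NormedSpace ℝ E'] [TopologicalSpace H']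
  {J : ModelWithCorners ℝ E' H'} [TopologicalSpace N] [ChartedSpace H' N]
  {V : TrivalentData I M} {S : ShadingData J N} {i : N → M}

theorem eq_zero_of_sign_eq_neg {x y : ℝ} (h : SignType.sign x = -SignType.sign y) (hx : x = 0) :
    y = 0 := by
  rwa [hx, sign_zero, ← Left.sign_neg, eq_comm, sign_eq_zero_iff, neg_eq_zero] at h

theorem pos_iff_of_sign_eq_neg {x y : ℝ} (h : SignType.sign x = -SignType.sign y) :
    0 < x ↔ y < 0 := by
  rw [← sign_eq_one_iff, h, ← Left.sign_neg, sign_eq_one_iff, neg_pos]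

theorem regularAt_of_interior {f : M → ℝ} {q : M} (hq : range I ∈ 𝓝 (extChartAt I q q))
    (h : chartDiff I f q ≠ 0) : RegularAt I f q := by
  obtain ⟨v, hv⟩ : ∃ v, chartDiff I f q v ≠ 0 := by
    by_contra! h'
    exact h (ContinuousLinearMap.ext h')
  refine ⟨v, ?_, hv⟩
  have hc : ContinuousAt (fun t : ℝ => extChartAt I q q + t • v) 0 := by fun_prop
  exact hc.eventually (p := fun z => z ∈ range I) (by simp only [zero_smul, add_zero]; exact hq)

namespace IsFilling

theorem mem_red_of_eq_zero (h : IsFilling V S i) {k : M → ℝ} {x : N}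
    (ha : IsAdaptedAt V S i k (i x)) (hx : i x ∉ V.support) (h0 : k (i x) = 0) : x ∈ S.red := by
  by_contra hr
  have hrb : x ∉ S.red ∪ S.blue := fun h' => h'.elim hr fun hb => hx (h.mem_support_of_blue hb)
  by_cases hw : x ∈ S.white
  · exact (ha.white x rfl hw).ne' h0
  · exact (ha.black x rfl hrb hw).ne h0

/-- On the boundary such a zero is a red point, and `k ∘ i` defines the red orientation there, so
already the restricted differential is nonzero. -/
theorem regularAt_of_boundary [J.Boundaryless] (h : IsFilling V S i) {k : M → ℝ} {x : N}
    (ha : IsAdaptedAt V S i k (i x)) (hx : i x ∉ V.support) (h0 : k (i x) = 0) :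
    RegularAt I k (i x) := by
  have hr := h.mem_red_of_eq_zero ha hx h0
  rw [← h.boundaryMap.regularAt_comp (ha.smooth hx).mdifferentiableAt]
  obtain ⟨f, hf, hpos⟩ := h.shading.red_orientation.2 x hr
  obtain ⟨v, hv, hfv⟩ := hf.2.1.exists_eq_one
  refine ⟨v, hv, ne_of_gt ?_⟩
  refine (posSide_eq_iff.1 ((ha.red x rfl hr hx).2.trans (hpos.self_of_nhds hr)) v).2 ?_
  simp [hfv]

/-- Near a facet the sign condition leaves no zeros off `V`. Near a binding they lie in `f < 0`,
where the function is the smooth one whose differential does not vanish. Near other boundary points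
regularity spreads from the boundary. -/
theorem eventually_regular [J.Boundaryless] [IsManifold I ∞ M] [FlatFaces I]
    (h : IsFilling V S i) {k : M → ℝ} {p : M}
    (ha : IsAdaptedAt V S i k p) (hp : p ∈ V.support ∪ range i) :
    ∀ᶠ q in 𝓝 p, q ∉ V.support → k q = 0 → chartDiff I k q ≠ 0 := by
  by_cases hV : p ∈ V.support
  · rcases hV with hV | hV
    · obtain ⟨f, hf, -, hs⟩ := ha.facet hV
      filter_upwards [hf.2.2, hs] with q e1 e2 hq h0
      exact (hq (Or.inl (e1.2 (eq_zero_of_sign_eq_neg e2 h0)))).elim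
    · obtain ⟨f, g, κ, hm, hκ, ⟨c, hc, hcg⟩, hs⟩ := ha.binding hV
      have hκ0 : chartDiff I κ p ≠ 0 := by
        rw [hcg]
        exact smul_ne_zero hc.ne' hm.independent.symm.regularAt_left.chartDiff_ne_zero
      filter_upwards [hm.eventually_iff, hs, eventually_eventually_nhds.2 hs,
        hm.smooth_left.eventually, eventually_chartDiff_ne_zero hκ hκ0] with q e1 e2 e3 e4 e5 hq h0
      rcases lt_or_ge (f q) 0 with hfq | hfq
      · have : k =ᶠ[𝓝 q] κ := by
          filter_upwards [e3, e4.continuousAt.eventually (gt_mem_nhds hfq)] with y e6 e7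
          exact e6.1 e7
        rwa [chartDiff_congr this]
      · have e6 := eq_zero_of_sign_eq_neg (e2.2 hfq).2 h0
        refine (hq ?_).elim
        by_cases hg : g q = 0
        · rcases hfq.eq_or_lt with hfq | hfq
          · exact Or.inr (e1.1.2 ⟨hfq.symm, hg⟩)
          · exact Or.inl (Or.inr (e1.2.2.1.2 ⟨hfq, hg⟩))
        · exact Or.inl (Or.inl (e1.2.1.2 ⟨(mul_eq_zero.1 e6).resolve_right hg, hg⟩))
  · obtain ⟨x, rfl⟩ := hp.resolve_left hV
    by_cases h0 : k (i x) = 0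
    · filter_upwards [eventually_chartDiff_ne_zero (ha.smooth hV)
        (h.regularAt_of_boundary ha hV h0).chartDiff_ne_zero] with q hq _ _ using hq
    · filter_upwards [(ha.smooth hV).continuousAt.eventually (isOpen_ne.mem_nhds h0)]
        with q hq _ hq0 using (hq hq0).elim

/-- There is an adapted function all of whose zeros outside `V` are regular. -/
theorem exists_regular_adapted [FiniteDimensional ℝ E] [FiniteDimensional ℝ E']
    [IsManifold I ∞ M] [IsManifold J ∞ N] [FlatFaces I] [J.Boundaryless] [T2Space M]
    [SigmaCompactSpace M] [LocallyConnectedSpace N] (hdim : Module.finrank ℝ E' ≤ 2)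
    (h : IsFilling V S i) : ∃ k : M → ℝ, (∀ q, IsAdaptedAt V S i k q) ∧
      ∀ q ∉ V.support, k q = 0 → RegularAt I k q := by
  have : CompleteSpace E' := FiniteDimensional.complete ℝ E'
  have hi := h.boundaryMap.contMDiff
  obtain ⟨k, hk⟩ := exists_isAdapted_of_local (V := V) (S := S) hi fun p => by
    by_cases hp : p ∈ V.support
    · rcases hp with hp | hp
      · exact h.exists_adapted_facet hp
      · exact h.exists_adapted_binding hdim hp
    · exact h.exists_adapted_off hp
  have hinn : ∀ q ∉ V.support ∪ range i, range I ∈ 𝓝 (extChartAt I q q) := fun q hq =>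
    h.boundaryMap.interior q fun h' => hq (Or.inr h')
  obtain ⟨k', hk', hreg⟩ := exists_regular_perturbation (A := V.support ∪ range i)
    (O := interior {q | q ∉ V.support → k q = 0 → chartDiff I k q ≠ 0}) (h := k)
    (h.trivalent.isClosed_support.union h.boundaryMap.isClosed_range) isOpen_interior
    (fun q hq => mem_interior_iff_mem_nhds.2 (h.eventually_regular (hk q) hq)) hinn
    (fun q hq => (hk q).smooth fun h' => hq (Or.inl h'))
    (fun q hq hq' => interior_subset hq fun h' => hq' (Or.inl h'))
  have hadapt : ∀ q, IsAdaptedAt V S i k' q := by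
    intro q
    by_cases hq : q ∈ V.support ∪ range i
    · exact (hk q).congr hi.continuous (hk' q hq)
    · exact ⟨fun _ => (hreg q hq).1, fun h' => (hq (Or.inl (Or.inl h'))).elim,
        fun h' => (hq (Or.inl (Or.inr h'))).elim, fun x hx => (hq (Or.inr ⟨x, hx⟩)).elim,
        fun x hx => (hq (Or.inr ⟨x, hx⟩)).elim, fun x hx => (hq (Or.inr ⟨x, hx⟩)).elim⟩
  refine ⟨k', hadapt, fun q hq h0 => ?_⟩
  by_cases hqi : q ∈ range i
  · obtain ⟨x, rfl⟩ := hqi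
    exact h.regularAt_of_boundary (hadapt _) hq h0
  · have hqA : q ∉ V.support ∪ range i := fun h' => h'.elim hq hqi
    exact regularAt_of_interior (hinn q hqA) ((hreg q hqA).2 h0)

end IsFilling

end Regular

/-! ### The shading defined by an adapted function -/

section Fill

variable {E' H' N : Type*} [NormedAddCommGroup E'] [NormedSpace ℝ E'] [TopologicalSpace H']
  {J : ModelWithCorners ℝ E' H'} [TopologicalSpace N] [ChartedSpace H' N]
  {E H M : Type*} [NormedAddCommGroup E] [NormedSpace ℝ E] [TopologicalSpace H]
  {I : ModelWithCorners ℝ E H} [TopologicalSpace M] [ChartedSpace H M]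

/-- The shading obtained from a trivalent manifold `V` by adding the zeros of `h` outside `V` to
the red facets, and painting the points where `h` is positive white. -/
def TrivalentData.fill (V : TrivalentData I M) (h : M → ℝ) : ShadingData I M where
  red := V.red ∪ V.binding ∪ {q | q ∉ V.support ∧ h q = 0}
  -- At a binding all models give the same side, by `IsBindingModel.posSide_right`.
  redPos q := {v | (q ∈ V.red ∧ v ∈ V.pos q) ∨
    (q ∈ V.binding ∧ ∃ f g, IsBindingModel V f g q ∧ v ∈ posSide I g q) ∨
    ((q ∉ V.support ∧ h q = 0) ∧ v ∈ posSide I h q)}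
  blue := V.blue ∪ V.binding
  white := {q | q ∉ V.support ∧ 0 < h q}

variable {V : TrivalentData I M} {S : ShadingData J N} {i : N → M} {h : M → ℝ}

theorem IsTrivalent.notMem_of_red (hV : IsTrivalent V) {p : M} (hp : p ∈ V.red) :
    p ∉ V.blue ∧ p ∉ V.binding := by
  obtain ⟨f, -, hf⟩ := hV.red_facet p hp
  exact ⟨hf.self_of_nhds.1, hf.self_of_nhds.2.1⟩

theorem IsTrivalent.notMem_of_blue (hV : IsTrivalent V) {p : M} (hp : p ∈ V.blue) :
    p ∉ V.red ∧ p ∉ V.binding := by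
  obtain ⟨f, -, hf⟩ := hV.blue_facet p hp
  exact ⟨hf.self_of_nhds.1, hf.self_of_nhds.2.1⟩

theorem fill_redPos_of_red (hV : IsTrivalent V) {p : M} (hp : p ∈ V.red) :
    (V.fill h).redPos p = V.pos p := by
  ext v
  constructor
  · rintro (h1 | h1 | h1)
    · exact h1.2
    · exact ((hV.notMem_of_red hp).2 h1.1).elim
    · exact (h1.1.1 (Or.inl (Or.inr hp))).elim
  · exact fun hv => Or.inl ⟨hp, hv⟩

theorem fill_redPos_off {p : M} (hp : p ∉ V.support) (h0 : h p = 0) :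
    (V.fill h).redPos p = posSide I h p := by
  ext v
  constructor
  · rintro (h1 | h1 | h1)
    · exact (hp (Or.inl (Or.inr h1.1))).elim
    · exact (hp (Or.inr h1.1)).elim
    · exact h1.2
  · exact fun hv => Or.inr (Or.inr ⟨⟨hp, h0⟩, hv⟩)

theorem fill_redPos_of_notMem {p : M} (hp : p ∉ (V.fill h).red) : (V.fill h).redPos p = ∅ := by
  rw [eq_empty_iff_forall_notMem]
  rintro v (h1 | h1 | h1)
  · exact hp (Or.inl (Or.inl h1.1))
  · exact hp (Or.inl (Or.inr h1.1))
  · exact hp (Or.inr h1.1)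

theorem mem_fill_red_off {p : M} (hp : p ∉ V.support) : p ∈ (V.fill h).red ↔ h p = 0 :=
  ⟨fun h' => h'.elim (fun h1 => (hp (h1.elim (fun h2 => Or.inl (Or.inr h2)) Or.inr)).elim)
    fun h1 => h1.2, fun h' => Or.inr ⟨hp, h'⟩⟩

theorem notMem_fill_blue_off {p : M} (hp : p ∉ V.support) : p ∉ (V.fill h).blue := fun h' =>
  hp (h'.elim (fun h1 => Or.inl (Or.inl h1)) Or.inr)

theorem mem_fill_white_off {p : M} (hp : p ∉ V.support) : p ∈ (V.fill h).white ↔ 0 < h p :=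
  ⟨fun h' => h'.2, fun h' => ⟨hp, h'⟩⟩

theorem notMem_fill_red_of_blue (hV : IsTrivalent V) {p : M} (hp : p ∈ V.blue) :
    p ∉ (V.fill h).red := by
  rintro ((h1 | h1) | h1)
  · exact (hV.notMem_of_blue hp).1 h1
  · exact (hV.notMem_of_blue hp).2 h1
  · exact h1.1 (Or.inl (Or.inl hp))

theorem notMem_fill_blue_of_red (hV : IsTrivalent V) {p : M} (hp : p ∈ V.red) :
    p ∉ (V.fill h).blue := by
  rintro (h1 | h1)
  · exact (hV.notMem_of_red hp).1 h1
  · exact (hV.notMem_of_red hp).2 h1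

theorem fill_red_inter_blue (hV : IsTrivalent V) :
    (V.fill h).red ∩ (V.fill h).blue = V.binding := by
  ext p
  constructor
  · rintro ⟨h1, h2 | h2⟩
    · exact (notMem_fill_red_of_blue hV h2 h1).elim
    · exact h2
  · exact fun hp => ⟨Or.inl (Or.inr hp), Or.inr hp⟩

/-- The equation of a facet of `V` is an equation of the shading. -/
theorem IsAdaptedAt.fill_facet {p : M} (hV : IsTrivalent V) (ha : IsAdaptedAt V S i h p)
    (hp : p ∈ V.blue ∪ V.red) :
    (∀ᶠ q in 𝓝 p, q ∉ V.support → h q ≠ 0) ∧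
    ∃ f, IsLocalEquation I ((V.fill h).red ∪ (V.fill h).blue) p f ∧ V.pos p = posSide I f p ∧
      ∀ᶠ q in 𝓝 p, (q ∈ (V.fill h).white ↔ f q < 0) := by
  obtain ⟨f, hf, hpos, hs⟩ := ha.facet hp
  have hb : ∀ᶠ q in 𝓝 p, q ∉ V.binding := by
    obtain ⟨_, _, h1⟩ := hV.exists_facet_equation hp
    exact h1.mono fun q hq => hq.1
  have hoff : ∀ᶠ q in 𝓝 p, q ∉ V.support → h q ≠ 0 := by
    filter_upwards [hf.2.2, hs] with q e1 e2 hq h0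
    exact hq (Or.inl (e1.2 (eq_zero_of_sign_eq_neg e2 h0)))
  refine ⟨hoff, f, hf.congr_set ?_, hpos, ?_⟩
  · filter_upwards [hoff, hb] with q e1 e2
    constructor
    · rintro (((h1 | h1) | h1) | (h1 | h1))
      · exact Or.inr h1
      · exact (e2 h1).elim
      · exact (e1 h1.1 h1.2).elim
      · exact Or.inl h1
      · exact (e2 h1).elim
    · exact fun h1 => h1.elim (fun h2 => Or.inr (Or.inl h2)) fun h2 => Or.inl (Or.inl (Or.inl h2))
  · filter_upwards [hf.2.2, hs, hb] with q e1 e2 e3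
    have e4 := pos_iff_of_sign_eq_neg e2
    refine ⟨fun h1 => e4.1 h1.2, fun h1 => ⟨fun h2 => ?_, e4.2 h1⟩⟩
    exact h1.ne (e1.1 (h2.resolve_right e3))

/-- The facets of `V` point out of white because `h` has the sign opposite to their oriented
equations. The added red facets are oriented towards `h > 0`, into white, so they are not kept. -/
theorem gamma_fill (hV : IsTrivalent V) (ha : ∀ q, IsAdaptedAt V S i h q)
    (hr : ∀ q ∉ V.support, h q = 0 → RegularAt I h q) : (V.fill h).Gamma = V := by
  have hout : ∀ p ∈ V.blue ∪ V.red, outward I (V.fill h).white p = V.pos p := by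
    intro p hp
    obtain ⟨-, f, hf, hpos, hw⟩ := (ha p).fill_facet hV hp
    have hmem : p ∈ (V.fill h).red ∪ (V.fill h).blue :=
      hp.elim (fun h' => Or.inr (Or.inl h')) fun h' => Or.inl (Or.inl (Or.inl h'))
    rw [outward_eq_posSide hf.1 (hf.eq_zero hmem) hf.2.1 hw, hpos]
  have hblue : (V.fill h).blue \ (V.fill h).red = V.blue := by
    ext p
    refine ⟨?_, fun hp => ⟨Or.inl hp, notMem_fill_red_of_blue hV hp⟩⟩
    rintro ⟨h1 | h1, h2⟩
    · exact h1
    · exact (h2 (Or.inl (Or.inr h1))).elim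
  have hred : (V.fill h).keptRed = V.red := by
    ext p
    constructor
    · rintro ⟨⟨(h1 | h1) | ⟨h1, h0⟩, h2⟩, h3⟩
      · exact h1
      · exact (h2 (Or.inr h1)).elim
      · exfalso
        have hs := (ha p).smooth h1
        rw [fill_redPos_off h1 h0, outward_eq_posSide hs.neg (by simpa) (hr p h1 h0).neg (by
          filter_upwards [hV.eventually_notMem_support h1] with q hq
          rw [mem_fill_white_off hq, Pi.neg_apply, neg_lt_zero])] at h3
        obtain ⟨v, -, hv⟩ := (hr p h1 h0).exists_eq_one
        have := (posSide_eq_iff.1 h3 v).1 (by simp [hv])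
        rw [chartDiff_neg] at this
        simp only [neg_apply, hv] at this
        linarith
    · intro hp
      refine ⟨⟨Or.inl (Or.inl hp), notMem_fill_blue_of_red hV hp⟩, ?_⟩
      rw [fill_redPos_of_red hV hp, hout p (Or.inr hp)]
  have hpos : (V.fill h).Gamma.pos = V.pos := by
    funext p
    ext v
    simp only [ShadingData.Gamma, hblue, hred]
    by_cases hp : p ∈ V.blue ∪ V.red
    · rw [← hout p hp]
      exact ⟨fun h' => h'.2, fun h' => ⟨hp, h'⟩⟩
    · rw [hV.pos_eq_empty p hp]
      exact ⟨fun h' => (hp h'.1).elim, fun h' => h'.elim⟩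
  have hmk : ∀ W : TrivalentData I M, W.blue = V.blue → W.red = V.red → W.binding = V.binding →
      W.pos = V.pos → W = V := by
    rintro ⟨⟩ h1 h2 h3 h4
    subst h1 h2 h3 h4
    rfl
  exact hmk _ hblue hred (fill_red_inter_blue hV) hpos

variable [IsManifold I ∞ M] [FlatFaces I]

theorem fill_redPos_of_binding (hV : IsTrivalent V) {p : M} (hp : p ∈ V.binding) {f g : M → ℝ}
    (hm : IsBindingModel V f g p) : (V.fill h).redPos p = posSide I g p := by
  ext v
  constructor
  · rintro (h1 | h1 | h1)
    · exact ((hV.notMem_of_red h1.1).2 hp).elim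
    · obtain ⟨f', g', hm', hv⟩ := h1.2
      rwa [← hm.posSide_right hm']
    · exact (h1.1.1 (Or.inr hp)).elim
  · exact fun hv => Or.inr (Or.inl ⟨hp, f, g, hm, hv⟩)

/-- The shading near a binding of `V`. -/
theorem IsAdaptedAt.fill_binding {p : M} (hV : IsTrivalent V) (ha : IsAdaptedAt V S i h p)
    (hp : p ∈ V.binding) : ∃ f k, SmoothNear I f p ∧ SmoothNear I k p ∧ IndependentAt I f k p ∧
      ∀ᶠ q in 𝓝 p, (q ∈ (V.fill h).red ↔ k q = 0) ∧ (q ∈ (V.fill h).blue ↔ f q = 0) ∧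
        (q ∈ (V.fill h).red → (V.fill h).redPos q = posSide I k q) := by
  obtain ⟨f, g, k, hm, hk, ⟨c, hc, hcg⟩, hs⟩ := ha.binding hp
  have hk0 : chartDiff I k p ≠ 0 := by
    rw [hcg]
    exact smul_ne_zero hc.ne' hm.independent.symm.regularAt_left.chartDiff_ne_zero
  refine ⟨f, k, hm.smooth_left, hk, hm.independent.of_smul_right hc.ne' hcg, ?_⟩
  filter_upwards [hm.eventually, hm.eventually_iff, hm.smooth_left.eventually,
    hm.smooth_right.eventually, hm.independent.eventually hm.smooth_left hm.smooth_right, hs,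
    eventually_eventually_nhds.2 hs, hk.eventually, eventually_chartDiff_ne_zero hk hk0]
    with q e1 e2 e3 e4 e5 e6 e7 e8 e9
  have hmem : 0 ≤ f q → f q * g q = 0 → q ∈ V.support := fun hfq hfg => by
    by_cases hg : g q = 0
    · rcases hfq.eq_or_lt with hfq | hfq
      · exact Or.inr (e2.1.2 ⟨hfq.symm, hg⟩)
      · exact Or.inl (Or.inr (e2.2.2.1.2 ⟨hfq, hg⟩))
    · exact Or.inl (Or.inl (e2.2.1.2 ⟨(mul_eq_zero.1 hfg).resolve_right hg, hg⟩))
  have hsupp : q ∈ V.support → 0 ≤ f q := by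
    rintro ((h1 | h1) | h1)
    · exact (e2.2.1.1 h1).1.ge
    · exact (e2.2.2.1.1 h1).1.le
    · exact (e2.1.1 h1).1.ge
  have hkg : 0 ≤ f q → (k q = 0 ↔ g q = 0) := fun hfq => by
    rw [← sign_eq_zero_iff, (e6.2 hfq).1, sign_eq_zero_iff]
  have hoff : q ∉ V.support → h q = 0 → f q < 0 := fun hq h0 => by
    by_contra! hfq
    exact hq (hmem hfq (eq_zero_of_sign_eq_neg (e6.2 hfq).2 h0))
  -- Where `f ≥ 0` the zeros of `k` are those of `g`, forming the red facet and the binding; where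
  -- `f < 0` they are the zeros of `h`, which equals `k` there.
  have hred : q ∈ (V.fill h).red ↔ k q = 0 := by
    constructor
    · rintro ((h1 | h1) | ⟨h1, h2⟩)
      · have := e2.2.2.1.1 h1
        exact (hkg this.1.le).2 this.2
      · have := e2.1.1 h1
        exact (hkg this.1.ge).2 this.2
      · rw [← e6.1 (hoff h1 h2), h2]
    · intro hkq
      rcases lt_trichotomy (f q) 0 with hfq | hfq | hfq
      · exact Or.inr ⟨fun h' => (hsupp h').not_gt hfq, (e6.1 hfq).trans hkq⟩
      · exact Or.inl (Or.inr (e2.1.2 ⟨hfq, (hkg hfq.ge).1 hkq⟩))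
      · exact Or.inl (Or.inl (e2.2.2.1.2 ⟨hfq, (hkg hfq.le).1 hkq⟩))
  refine ⟨hred, ⟨?_, fun hfq => ?_⟩, ?_⟩
  · rintro (h1 | h1)
    · exact (e2.2.1.1 h1).1
    · exact (e2.1.1 h1).1
  · by_cases hg : g q = 0
    · exact Or.inr (e2.1.2 ⟨hfq, hg⟩)
    · exact Or.inl (e2.2.1.2 ⟨hfq, hg⟩)
  · rintro ((h1 | h1) | ⟨h1, h2⟩)
    · obtain ⟨hfq, hgq⟩ := e2.2.2.1.1 h1
      rw [fill_redPos_of_red hV h1, e2.2.2.2.1 h1]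
      refine (posSide_eq_of_sign e4.mdifferentiableAt e8.mdifferentiableAt hgq
        e5.symm.regularAt_left e9 ?_).symm
      filter_upwards [e7, e3.continuousAt.eventually (lt_mem_nhds hfq)] with y h3 h4
      exact (h3.2 (le_of_lt h4)).1
    · obtain ⟨hfq, hgq⟩ := e2.1.1 h1
      rw [fill_redPos_of_binding hV h1 (e1 h1)]
      obtain ⟨d, hd, hdk⟩ := chartDiff_eq_smul_of_sign_on e3.mdifferentiableAt
        e4.mdifferentiableAt e8.mdifferentiableAt hfq hgq (hred.1 (Or.inl (Or.inr h1))) e5 (by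
          filter_upwards [e7] with y h3 hfy
          have h4 := (h3.2 hfy.le).1
          refine ⟨fun h5 => ?_, fun h5 => ?_⟩
          · rw [sign_pos h5, sign_eq_one_iff] at h4
            exact h4.le
          · rw [sign_neg h5, sign_eq_neg_one_iff] at h4
            exact h4.le)
      refine (posSide_eq_of_smul (hd.lt_of_ne ?_) hdk).symm
      rintro rfl
      exact e9 (by rw [hdk, zero_smul])
    · rw [fill_redPos_off h1 h2]
      refine posSide_congr ?_
      filter_upwards [e7, e3.continuousAt.eventually (gt_mem_nhds (hoff h1 h2))] with y h3 h4
      exact h3.1 h4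

theorem isOrientation_fill (hV : IsTrivalent V) (ha : ∀ q, IsAdaptedAt V S i h q)
    (hr : ∀ q ∉ V.support, h q = 0 → RegularAt I h q) :
    IsOrientation I (V.fill h).red (V.fill h).redPos := by
  refine ⟨fun p hp => fill_redPos_of_notMem hp, ?_⟩
  rintro p ((hp | hp) | ⟨hp, h0⟩)
  · obtain ⟨f, hf, hfp⟩ := hV.red_facet p hp
    have hred : ∀ᶠ q in 𝓝 p, (q ∈ (V.fill h).red ↔ q ∈ V.red) := by
      filter_upwards [((ha p).fill_facet hV (Or.inr hp)).1, hfp] with q e1 e2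
      refine ⟨?_, fun h' => Or.inl (Or.inl h')⟩
      rintro ((h1 | h1) | h1)
      · exact h1
      · exact (e2.2.1 h1).elim
      · exact (e1 h1.1 h1.2).elim
    refine ⟨f, hf.congr_set hred, ?_⟩
    filter_upwards [hred, hfp] with q e1 e2 hq
    rw [fill_redPos_of_red hV (e1.1 hq), e2.2.2 (e1.1 hq)]
  · obtain ⟨f, k, hf, hk, hind, he⟩ := (ha p).fill_binding hV hp
    exact ⟨k, ⟨hk, hind.symm.regularAt_left, he.mono fun q hq => hq.1⟩, he.mono fun q hq => hq.2.2⟩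
  · have hoff := hV.eventually_notMem_support hp
    refine ⟨h, ⟨(ha p).smooth hp, hr p hp h0, hoff.mono fun q hq => mem_fill_red_off hq⟩, ?_⟩
    filter_upwards [hoff] with q hq hq'
    exact fill_redPos_off hq ((mem_fill_red_off hq).1 hq')

theorem isShading_fill (hV : IsTrivalent V) (ha : ∀ q, IsAdaptedAt V S i h q)
    (hr : ∀ q ∉ V.support, h q = 0 → RegularAt I h q) : IsShading (V.fill h) where
  red_hypersurface := by
    refine ⟨?_, fun p hp => ?_⟩
    · rw [← isOpen_compl_iff, isOpen_iff_mem_nhds]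
      intro p hp
      by_cases hpV : p ∈ V.support
      · have hpb : p ∈ V.blue := by
          rcases hpV with (h1 | h1) | h1
          · exact h1
          · exact (hp (Or.inl (Or.inl h1))).elim
          · exact (hp (Or.inl (Or.inr h1))).elim
        obtain ⟨f, -, hf⟩ := hV.blue_facet p hpb
        filter_upwards [((ha p).fill_facet hV (Or.inl hpb)).1, hf] with q e1 e2
        rintro ((h1 | h1) | h1)
        · exact e2.1 h1
        · exact e2.2.1 h1
        · exact e1 h1.1 h1.2
      · have h0 : h p ≠ 0 := fun h' => hp ((mem_fill_red_off hpV).2 h')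
        filter_upwards [hV.eventually_notMem_support hpV,
          ((ha p).smooth hpV).continuousAt.eventually (isOpen_ne.mem_nhds h0)] with q e1 e2 e3
        exact e2 ((mem_fill_red_off e1).1 e3)
    · obtain ⟨f, hf, -⟩ := (isOrientation_fill hV ha hr).2 p hp
      exact ⟨f, hf⟩
  red_orientation := isOrientation_fill hV ha hr
  blue_hypersurface := by
    refine ⟨?_, ?_⟩
    · rw [← isOpen_compl_iff, isOpen_iff_mem_nhds]
      intro p hp
      by_cases hpV : p ∈ V.support
      · have hpr : p ∈ V.red := by
          rcases hpV with (h1 | h1) | h1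
          · exact (hp (Or.inl h1)).elim
          · exact h1
          · exact (hp (Or.inr h1)).elim
        obtain ⟨f, -, hf⟩ := hV.red_facet p hpr
        filter_upwards [hf] with q e2
        exact fun h' => h'.elim e2.1 e2.2.1
      · filter_upwards [hV.eventually_notMem_support hpV] with q e1
        exact notMem_fill_blue_off e1
    · rintro p (hp | hp)
      · obtain ⟨f, hf, hfp⟩ := hV.blue_facet p hp
        refine ⟨f, hf.congr_set ?_⟩
        filter_upwards [hfp] with q e1
        exact ⟨fun h' => h'.resolve_right e1.2.1, Or.inl⟩
      · obtain ⟨f, k, hf, hk, hind, he⟩ := (ha p).fill_binding hV hp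
        exact ⟨f, hf, hind.regularAt_left, he.mono fun q hq => hq.2.1⟩
  transverse := by
    intro p hp
    rw [fill_red_inter_blue hV] at hp
    obtain ⟨f, k, hf, hk, hind, he⟩ := (ha p).fill_binding hV hp
    exact ⟨k, f, ⟨hk, hind.symm.regularAt_left, he.mono fun q hq => hq.1⟩,
      ⟨hf, hind.regularAt_left, he.mono fun q hq => hq.2.1⟩, hind.symm⟩
  white_subset := by
    rintro p ⟨hp, h0⟩ (h1 | h1)
    · exact h0.ne' ((mem_fill_red_off hp).1 h1)
    · exact notMem_fill_blue_off hp h1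
  white_region := by
    intro p hp
    have hsub := connectedComponentIn_subset ((V.fill h).red ∪ (V.fill h).blue)ᶜ p
    have hoff : ∀ q ∈ ((V.fill h).red ∪ (V.fill h).blue)ᶜ, q ∉ V.support := by
      rintro q hq ((h1 | h1) | h1)
      · exact hq (Or.inr (Or.inl h1))
      · exact hq (Or.inl (Or.inl (Or.inl h1)))
      · exact hq (Or.inr (Or.inr h1))
    intro q hq
    by_contra hqw
    have hpC : p ∈ connectedComponentIn ((V.fill h).red ∪ (V.fill h).blue)ᶜ p := by
      by_contra h'
      rw [connectedComponentIn_eq_empty fun h1 => h' (mem_connectedComponentIn h1)] at hq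
      exact hq
    have hle : h q ≤ 0 := not_lt.1 fun h' => hqw ⟨hoff q (hsub hq), h'⟩
    -- `h` is continuous off `V`, so a region with a white and a non-white point would contain a
    -- zero of `h`, which is a red point.
    obtain ⟨y, hy, hy0⟩ := isPreconnected_connectedComponentIn.intermediate_value hq hpC
      (f := h) (fun y hy =>
        ((ha y).smooth (hoff y (hsub hy))).continuousAt.continuousWithinAt) ⟨hle, hp.2.le⟩
    exact hsub hy (Or.inl ((mem_fill_red_off (hoff y (hsub hy))).2 hy0))
  checkerboard := by
    intro p hp hp'
    rw [fill_red_inter_blue hV] at hp'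
    by_cases hpV : p ∈ V.support
    · obtain ⟨-, f, hf, -, hw⟩ := (ha p).fill_facet hV (hpV.resolve_right hp')
      exact ⟨f, hf, hw⟩
    · have h0 : h p = 0 := (mem_fill_red_off hpV).1
        (hp.resolve_right (notMem_fill_blue_off hpV))
      have hoff := hV.eventually_notMem_support hpV
      refine ⟨-h, IsLocalEquation.neg ⟨(ha p).smooth hpV, hr p hpV h0, ?_⟩, ?_⟩
      · filter_upwards [hoff] with q hq
        rw [← mem_fill_red_off hq]
        exact or_iff_left (notMem_fill_blue_off hq)
      · filter_upwards [hoff] with q hq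
        rw [mem_fill_white_off hq, Pi.neg_apply, neg_lt_zero]

theorem IsFilling.restrict_fill [J.Boundaryless] [IsManifold J ∞ N] (hF : IsFilling V S i)
    (ha : ∀ q, IsAdaptedAt V S i h q) : (V.fill h).restrict J i = S := by
  have hV := hF.trivalent
  have hi := hF.boundaryMap.contMDiff
  have hred : ∀ x, i x ∈ (V.fill h).red ↔ x ∈ S.red := by
    intro x
    constructor
    · rintro ((h1 | h1) | ⟨h1, h2⟩)
      · exact (hF.mem_red.1 h1).1.1
      · exact (hF.mem_binding.1 h1).1
      · exact hF.mem_red_of_eq_zero (ha _) h1 h2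
    · intro hx
      by_cases hxV : i x ∈ V.support
      · rcases hxV with (h1 | h1) | h1
        · exact ((hF.mem_blue.1 h1).2 hx).elim
        · exact Or.inl (Or.inl h1)
        · exact Or.inl (Or.inr h1)
      · exact Or.inr ⟨hxV, ((ha _).red x rfl hx hxV).1⟩
  have hblue : ∀ x, i x ∈ (V.fill h).blue ↔ x ∈ S.blue := by
    intro x
    constructor
    · rintro (h1 | h1)
      · exact (hF.mem_blue.1 h1).1
      · exact (hF.mem_binding.1 h1).2
    · intro hx
      by_cases hr : x ∈ S.red
      · exact Or.inr (hF.mem_binding.2 ⟨hr, hx⟩)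
      · exact Or.inl (hF.mem_blue.2 ⟨hx, hr⟩)
  have hwhite : ∀ x, i x ∈ (V.fill h).white ↔ x ∈ S.white := by
    intro x
    constructor
    · rintro ⟨h1, h2⟩
      by_contra hw
      refine ((ha _).black x rfl ?_ hw).not_gt h2
      rintro (h3 | h3)
      · exact h2.ne' ((ha _).red x rfl h3 h1).1
      · exact h1 (hF.mem_support_of_blue h3)
    · intro hw
      have h1 := hF.shading.white_subset hw
      refine ⟨?_, (ha _).white x rfl hw⟩
      rintro (h2 | h2)
      · exact h1 (hF.mem_facets h2).1
      · exact h1 (Or.inl (hF.mem_binding.1 h2).1)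
  have hpos : ∀ x, {v | mfderiv J I i x v ∈ (V.fill h).redPos (i x)} = S.redPos x := by
    intro x
    by_cases hx : i x ∈ (V.fill h).red
    · have hxr := (hred x).1 hx
      rcases hx with (h1 | h1) | ⟨h1, h2⟩
      · rw [fill_redPos_of_red hV h1, hF.pos_eq_outward (Or.inr h1), (hF.mem_red.1 h1).2]
      · obtain ⟨f, g, hm⟩ := hV.exists_bindingModel h1
        obtain ⟨k, -, -, hk, he⟩ := hF.binding_boundary h1 hm
        rw [fill_redPos_of_binding hV h1 hm, ← hk]
        exact he.self_of_nhds.2.2.2.1 hxr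
      · rw [fill_redPos_off h1 h2, ← posSide_comp hi ((ha _).smooth h1).mdifferentiableAt]
        exact ((ha _).red x rfl hxr h1).2
    · rw [fill_redPos_of_notMem hx, hF.shading.red_orientation.1 x fun h' => hx ((hred x).2 h')]
      rfl
  have hmk : ∀ T : ShadingData J N, T.red = S.red → T.redPos = S.redPos → T.blue = S.blue →
      T.white = S.white → T = S := by
    rintro ⟨⟩ h1 h2 h3 h4
    subst h1 h2 h3 h4
    rfl
  exact hmk _ (Set.ext hred) (funext hpos) (Set.ext hblue) (Set.ext hwhite)

end Fill

end TrivalentShading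
end

theorem mainTheorem3 (m : ℕ) (hm : m + 1 = 2 ∨ m + 1 = 3)
    -- the smooth manifold `M` of dimension `m + 1`, possibly with boundary
    (M : Type*) [TopologicalSpace M] [T2Space M] [SecondCountableTopology M]
    [ChartedSpace (EuclideanHalfSpace (m + 1)) M] [IsManifold (𝓡∂ (m + 1)) ∞ M]
    -- its boundary as a smooth manifold `N` of dimension `m`, with the inclusion `ι`
    (N : Type*) [TopologicalSpace N]
    [ChartedSpace (EuclideanSpace ℝ (Fin m)) N] [IsManifold (𝓡 m) ∞ N]
    (ι : N → M) (hι : Manifold.IsSmoothEmbedding (𝓡 m) (𝓡∂ (m + 1)) ∞ ι)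
    (hrange : Set.range ι = (𝓡∂ (m + 1)).boundary M)
    (V : TrivalentShading.TrivalentData (𝓡∂ (m + 1)) M) (hV : TrivalentShading.IsTrivalent V)
    (S₀ : TrivalentShading.ShadingData (𝓡 m) N) (hS₀ : TrivalentShading.IsShading S₀)
    (hVS₀ : V.restrict (𝓡 m) ι = S₀.Gamma) :
    ∃ S : TrivalentShading.ShadingData (𝓡∂ (m + 1)) M,
      TrivalentShading.IsShading S ∧ S.restrict (𝓡 m) ι = S₀ ∧ S.Gamma = V := by
  have : LocallyCompactSpace M := Manifold.locallyCompact_of_finiteDimensional (𝓡∂ (m + 1))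
  have : LocallyConnectedSpace N :=
    ChartedSpace.locallyConnectedSpace (EuclideanSpace ℝ (Fin m)) N
  have hF : TrivalentShading.IsFilling V S₀ ι :=
    ⟨hV, hS₀, TrivalentShading.isBoundaryMap_of_isSmoothEmbedding hι hrange, hVS₀⟩
  obtain ⟨h, ha, hr⟩ := hF.exists_regular_adapted (by
    rw [finrank_euclideanSpace_fin]
    omega)
  exact ⟨V.fill h, TrivalentShading.isShading_fill hV ha hr, hF.restrict_fill ha,
    TrivalentShading.gamma_fill hV ha hr⟩
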